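/- **Skew monoidal categories.** A (left) skew monoidal category is a category $\mathcal C$ with a functor $\mathcal C\times\mathcal C\to\mathcal C$, $(a,b)\mapsto ab$, an object $i$, and natural transformations (not assumed invertible) $\alpha_{a,b,c}\colon (ab)c\to a(bc)$, $\lambda_a\colon ia\to a$, $\rho_a\colon a\to ai$ such that $$\alpha_{a,b,cd}\,\alpha_{ab,c,d}=(a\,\alpha_{b,c,d})\,\alpha_{a,bc,d}\,(\alpha_{a,b,c}\,d),\qquad \lambda_{ab}\,\alpha_{i,a,b}=\lambda_a b,\qquad \alpha_{a,b,i}\,\rho_{ab}=a\rho_b,$$ $$(a\lambda_b)\,\alpha_{a,i,b}\,(\rho_a b)=1_{ab},\qquad \lambda_i\rho_i=1_i .$$ A lax monoidal functor is a functor $F$ with a map $f_0\colon i\to Fi$ and a natural family $f_2\colon Fa\,Fb\to F(ab)$ such that $$F\alpha\cdot f_2\cdot(f_2\,Fc)=f_2\cdot(Fa\,f_2)\cdot\alpha,\qquad F\lambda_a\cdot f_2\cdot(f_0\,Fa)=\lambda_{Fa},\qquad f_2\cdot(Fa\,f_0)\cdot\rho_{Fa}=F\rho_a .$$ Skew monoidal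 categories and lax monoidal functors form a category $\mathbf{SkMon}$. **Types.** For $x,y\in\{t,l\}$ (tight, loose) put $x\circ_i y=t$ if $x=t$ and either $y=t$ or $i\ne 1$, and $x\circ_iy=l$ otherwise. **Skew multicategories.** A skew multicategory $\mathbb C$ consists of objects, sets $\mathbb C^l_n(a_1,\dots,a_n;b)$ of loose multimaps for $n\ge 0$, sets $\mathbb C^t_n(a_1,\dots,a_n;b)$ of tight multimaps for $n\ge1$ (there are no tight nullary maps), comparison functions $j\colon\mathbb C^t_n(\bar a;b)\to\mathbb C^l_n(\bar a;b)$, tight identities $1_a\in\mathbb C^t_1(a;a)$, and substitutions $$-\circ_i-\colon \mathbb C^x_n(\bar b;c)\times\mathbb C^y_m(\bar a;b_i)\to\mathbb C^{x\circ_iy}_{n+m-1}(b_1,\dots,b_{i-1},\bar a,b_{i+1},\dots,b_n;c)$$ for all $x,y,n,m$ and $1\le i\le n$ for which these sets are defined. Substitution commutes with the comparisons $j$ and satisfies $1\circ_1f=f=f\circ_i1$, $h\circ_i(g\circ_jf)=(h\circ_ig)\circ_{i+j-1}f$ and, for $g$ of arity $m$ and $i<k$, $(h\circ_ig)\circ_{k+m-1}f=(h\circ_kf)\circ_ig$.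 A skew multifunctor is a function on objects together with functions on tight and on loose multimaps that preserve identities, substitutions and $j$. This gives a category $\mathbf{SkMult}$. A multimap $\theta\in\mathbb C^x_n(\bar a;m)$ is a left universal classifier if $$-\circ_1\theta\colon\mathbb C^t_{1+r}(m,\bar x;b)\to\mathbb C^x_{n+r}(\bar a,\bar x;b)$$ is a bijection for all $r\ge 0$, all $\bar x=(x_1,\dots,x_r)$ and all $b$; and $\mathbb C$ is left representable if every list $\bar a$ has a left universal loose classifier and every non-empty list $\bar a$ has a left universal tight classifier. Let $\mathbf{SkMult}_{lr}\subseteq\mathbf{SkMult}$ be the full subcategory of left representable skew multicategories. **Short skew multicategories.** A short skew multicategory $\mathbb C$ consists of a category $\mathcal C$, functors $\mathbb C^t_n\colon(\mathcal C^n)^{op}\times\mathcal C\to\mathrm{Set}$ for $1\le n\le4$ with $\mathbb C^t_1=\mathcal C(-,-)$, functors $\mathbb C^l_n\colon(\mathcal C^n)^{op}\times\mathcal C\to\mathrm{Set}$ for $n=0,1,2$, natural transformations $j_n\colon\mathbb C^t_n\to\mathbb C^l_n$ for $n=1,2$, and substitutions $g\circ_if$, typed as above, natural in all inputs of $f$,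 in the other inputs of $g$ and in the output of $g$, and dinatural in the $i$-th input of $g$, in the following cases: $g$ tight binary or ternary and $f$ tight binary; $g$ tight binary and $f$ tight ternary; $g$ tight binary or ternary and $f$ nullary; $g$ loose unary and $f$ nullary; $g$ tight binary and $f$ loose unary; $g$ loose unary and $f$ tight binary. With the functorial actions written as composition with tight unary maps, the following equations hold for $g$ tight binary, $p$ tight unary and $v$ nullary: $$g\circ_1jp=j(g\circ_1p),\qquad g\circ_2jp=g\circ_2p,\qquad jp\circ g=j(p\circ g),\qquad jp\circ v=p\circ v .$$ Moreover, for $f$ tight binary, $g$ of arity $n$ and $h$ of arity $p$ (tight if of arity $2$, nullary if of arity $0$), one requires $$f\circ_i(g\circ_jh)=(f\circ_ig)\circ_{i+j-1}h\quad(i,j\in\{1,2\})\qquad\text{for }(n,p)=(2,2),(2,0),$$ $$(f\circ_1g)\circ_{n+1}h=(f\circ_2h)\circ_1g\qquad\text{for }(n,p)=(2,2),(2,0),(0,2),(0,0).$$ A morphism is a functor $F$ with natural families $F^t_n$ ($1\le n\le4$, $F^t_1=F$) and $F^l_n$ ($n=0,1,2$) commuting with all substitutions and with $j$. This gives a category $\mathbf{FSkMult}$.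 The short skew multicategory $\mathbb C$ is left representable if there are a nullary map $u\in\mathbb C^l_0(;i)$ such that $-\circ_1u\colon\mathbb C^t_{1+r}(i,\bar x;d)\to\mathbb C^l_r(\bar x;d)$ is bijective for $r=0,1,2$ and all $\bar x,d$, and, for all $a,b$, a tight binary map $\theta_{a,b}\in\mathbb C^t_2(a,b;ab)$ such that $-\circ_1\theta_{a,b}\colon\mathbb C^t_{1+r}(ab,\bar x;d)\to\mathbb C^t_{2+r}(a,b,\bar x;d)$ is bijective for $r=0,1,2$ and all $\bar x,d$. Let $\mathbf{FSkMult}_{lr}\subseteq\mathbf{FSkMult}$ be the full subcategory of left representable short skew multicategories. **The functor $K^s$.** For each left representable short skew multicategory $\mathbb C$ choose $u$ and the $\theta_{a,b}$ as above. Then $K^s\mathbb C$ is the category $\mathcal C$ with tensor product $ab$ and unit $i$ the targets of $\theta_{a,b}$ and $u$, and with $fg\colon ac\to bd$, $\alpha$, $\lambda$ determined uniquely, and $\rho$ defined, by $$(fg)\circ\theta_{a,c}=(\theta_{b,d}\circ_1f)\circ_2g,\qquad (\alpha\circ\theta_{ab,c})\circ_1\theta_{a,b}=\theta_{a,bc}\circ_2\theta_{b,c},\qquad(\lambda_a\circ\theta_{i,a})\circ_1u=j(1_a),\qquad\rho_a=\theta_{a,i}\circ_2u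 .$$ On a morphism $F$, the lax monoidal functor $K^sF$ is the functor $F$ with $f_0,f_2$ determined by $f_0\circ u=F^l_0u$ and $f_2\circ\theta_{Fa,Fb}=F^t_2\theta_{a,b}$. This defines a functor $K^s\colon\mathbf{FSkMult}_{lr}\to\mathbf{SkMon}$. **The functor $U^s$.** Forgetting all multimaps and substitutions other than those listed in the definition of a short skew multicategory defines a functor $\mathbf{SkMult}\to\mathbf{FSkMult}$, which restricts to a functor $U^s\colon\mathbf{SkMult}_{lr}\to\mathbf{FSkMult}_{lr}$. **Theorem.** The functor $K^s\colon\mathbf{FSkMult}_{lr}\to\mathbf{SkMon}$ is an equivalence of categories, and so is the forgetful functor $U^s\colon\mathbf{SkMult}_{lr}\to\mathbf{FSkMult}_{lr}$. -/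

import Mathlib

open CategoryTheory

universe v u

namespace SkewMulti

noncomputable section

set_option linter.unusedVariables false
set_option linter.checkUnivs false

/-! ### Skew monoidal categories and lax monoidal functors -/

/-- A (left) skew monoidal category (bundled). -/
structure SkewMonoidalCategory where
  Obj : Type u
  [cat : Category.{v} Obj]
  tensorObj : Obj → Obj → Obj
  tensorHom : ∀ {a b c d : Obj}, (a ⟶ b) → (c ⟶ d) → (tensorObj a c ⟶ tensorObj b d)
  tensorHom_id : ∀ a b : Obj, tensorHom (𝟙 a) (𝟙 b) = 𝟙 (tensorObj a b)
  tensorHom_comp : ∀ {a b c a' b' c' : Obj} (f : a ⟶ b) (g : b ⟶ c) (f' : a' ⟶ b') (g' : b' ⟶ c'),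
    tensorHom (f ≫ g) (f' ≫ g') = tensorHom f f' ≫ tensorHom g g'
  unit : Obj
  /-- The associator, not assumed invertible. -/
  assoc : ∀ a b c : Obj, tensorObj (tensorObj a b) c ⟶ tensorObj a (tensorObj b c)
  /-- The left unit map, not assumed invertible. -/
  leftUnit : ∀ a : Obj, tensorObj unit a ⟶ a
  /-- The right unit map, not assumed invertible. -/
  rightUnit : ∀ a : Obj, a ⟶ tensorObj a unit
  assoc_natural : ∀ {a b c a' b' c' : Obj} (f : a ⟶ a') (g : b ⟶ b') (h : c ⟶ c'),
    tensorHom (tensorHom f g) h ≫ assoc a' b' c' = assoc a b c ≫ tensorHom f (tensorHom g h)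
  leftUnit_natural : ∀ {a b : Obj} (f : a ⟶ b),
    tensorHom (𝟙 unit) f ≫ leftUnit b = leftUnit a ≫ f
  rightUnit_natural : ∀ {a b : Obj} (f : a ⟶ b),
    f ≫ rightUnit b = rightUnit a ≫ tensorHom f (𝟙 unit)
  pentagon : ∀ a b c d : Obj,
    assoc (tensorObj a b) c d ≫ assoc a b (tensorObj c d) =
      tensorHom (assoc a b c) (𝟙 d) ≫ assoc a (tensorObj b c) d ≫ tensorHom (𝟙 a) (assoc b c d)
  unit_left : ∀ a b : Obj,
    assoc unit a b ≫ leftUnit (tensorObj a b) = tensorHom (leftUnit a) (𝟙 b)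
  unit_right : ∀ a b : Obj,
    rightUnit (tensorObj a b) ≫ assoc a b unit = tensorHom (𝟙 a) (rightUnit b)
  unit_middle : ∀ a b : Obj,
    tensorHom (rightUnit a) (𝟙 b) ≫ assoc a unit b ≫ tensorHom (𝟙 a) (leftUnit b) =
      𝟙 (tensorObj a b)
  unit_unit : rightUnit unit ≫ leftUnit unit = 𝟙 unit

attribute [instance] SkewMonoidalCategory.cat

/-- A lax monoidal functor between skew monoidal categories. -/
@[ext]
structure LaxMonoidalFunctor (C D : SkewMonoidalCategory.{v, u}) where
  F : C.Obj ⥤ D.Obj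
  f₀ : D.unit ⟶ F.obj C.unit
  f₂ : ∀ a b : C.Obj, D.tensorObj (F.obj a) (F.obj b) ⟶ F.obj (C.tensorObj a b)
  f₂_natural : ∀ {a b a' b' : C.Obj} (p : a ⟶ a') (q : b ⟶ b'),
    D.tensorHom (F.map p) (F.map q) ≫ f₂ a' b' = f₂ a b ≫ F.map (C.tensorHom p q)
  map_assoc : ∀ a b c : C.Obj,
    D.tensorHom (f₂ a b) (𝟙 (F.obj c)) ≫ f₂ (C.tensorObj a b) c ≫ F.map (C.assoc a b c) =
      D.assoc (F.obj a) (F.obj b) (F.obj c) ≫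
        D.tensorHom (𝟙 (F.obj a)) (f₂ b c) ≫ f₂ a (C.tensorObj b c)
  map_leftUnit : ∀ a : C.Obj,
    D.tensorHom f₀ (𝟙 (F.obj a)) ≫ f₂ C.unit a ≫ F.map (C.leftUnit a) = D.leftUnit (F.obj a)
  map_rightUnit : ∀ a : C.Obj,
    D.rightUnit (F.obj a) ≫ D.tensorHom (𝟙 (F.obj a)) f₀ ≫ f₂ a C.unit = F.map (C.rightUnit a)

namespace LaxMonoidalFunctor

/-- The identity lax monoidal functor. -/
def id (C : SkewMonoidalCategory.{v, u}) : LaxMonoidalFunctor C C where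
  F := 𝟭 C.Obj
  f₀ := 𝟙 _
  f₂ _ _ := 𝟙 _
  f₂_natural p q := by simp
  map_assoc a b c := by simp [C.tensorHom_id]
  map_leftUnit a := by simp [C.tensorHom_id]
  map_rightUnit a := by simp [C.tensorHom_id]

/-- Composition of lax monoidal functors. -/
def comp {C D E : SkewMonoidalCategory.{v, u}} (S : LaxMonoidalFunctor C D)
    (T : LaxMonoidalFunctor D E) : LaxMonoidalFunctor C E where
  F := S.F ⋙ T.F
  f₀ := T.f₀ ≫ T.F.map S.f₀
  f₂ a b := T.f₂ _ _ ≫ T.F.map (S.f₂ a b)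
  f₂_natural p q := by
    dsimp only [Functor.comp_obj, Functor.comp_map]
    rw [← Category.assoc, T.f₂_natural, Category.assoc, Category.assoc, ← T.F.map_comp,
      ← T.F.map_comp, S.f₂_natural]
  map_assoc a b c := by
    dsimp only [Functor.comp_obj, Functor.comp_map]
    have e1 : E.tensorHom (T.f₂ (S.F.obj a) (S.F.obj b) ≫ T.F.map (S.f₂ a b))
        (𝟙 (T.F.obj (S.F.obj c))) =
        E.tensorHom (T.f₂ _ _) (𝟙 _) ≫ E.tensorHom (T.F.map (S.f₂ a b)) (T.F.map (𝟙 _)) := by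
      rw [← E.tensorHom_comp]; simp
    have e2 : E.tensorHom (𝟙 (T.F.obj (S.F.obj a)))
        (T.f₂ (S.F.obj b) (S.F.obj c) ≫ T.F.map (S.f₂ b c)) =
        E.tensorHom (𝟙 _) (T.f₂ _ _) ≫ E.tensorHom (T.F.map (𝟙 _)) (T.F.map (S.f₂ b c)) := by
      rw [← E.tensorHom_comp]; simp
    have n1 := T.f₂_natural (S.f₂ a b) (𝟙 (S.F.obj c))
    have n2 := T.f₂_natural (𝟙 (S.F.obj a)) (S.f₂ b c)
    have m := congrArg T.F.map (S.map_assoc a b c)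
    simp only [T.F.map_comp] at m
    rw [e1, e2]
    simp only [Category.assoc]
    rw [reassoc_of% n1, reassoc_of% n2, m, reassoc_of% (T.map_assoc)]
  map_leftUnit a := by
    dsimp only [Functor.comp_obj, Functor.comp_map]
    have e1 : E.tensorHom (T.f₀ ≫ T.F.map S.f₀) (𝟙 (T.F.obj (S.F.obj a))) =
        E.tensorHom T.f₀ (𝟙 _) ≫ E.tensorHom (T.F.map S.f₀) (T.F.map (𝟙 _)) := by
      rw [← E.tensorHom_comp]; simp
    have n1 := T.f₂_natural S.f₀ (𝟙 (S.F.obj a))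
    rw [e1, ← T.map_leftUnit, ← S.map_leftUnit]
    simp only [Category.assoc, T.F.map_comp]
    rw [reassoc_of% n1]
  map_rightUnit a := by
    dsimp only [Functor.comp_obj, Functor.comp_map]
    have e1 : E.tensorHom (𝟙 (T.F.obj (S.F.obj a))) (T.f₀ ≫ T.F.map S.f₀) =
        E.tensorHom (𝟙 _) T.f₀ ≫ E.tensorHom (T.F.map (𝟙 _)) (T.F.map S.f₀) := by
      rw [← E.tensorHom_comp]; simp
    have n1 := T.f₂_natural (𝟙 (S.F.obj a)) S.f₀
    rw [e1, ← S.map_rightUnit]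
    simp only [Category.assoc, T.F.map_comp]
    rw [reassoc_of% n1, ← T.map_rightUnit]
    simp only [Category.assoc]

end LaxMonoidalFunctor

/-- The category of skew monoidal categories and lax monoidal functors. -/
instance : Category SkewMonoidalCategory.{v, u} where
  Hom := LaxMonoidalFunctor
  id := LaxMonoidalFunctor.id
  comp := LaxMonoidalFunctor.comp
  id_comp S := LaxMonoidalFunctor.ext rfl
    (heq_of_eq (by simp [LaxMonoidalFunctor.comp, LaxMonoidalFunctor.id]))
    (heq_of_eq (by funext a b; simp [LaxMonoidalFunctor.comp, LaxMonoidalFunctor.id]))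
  comp_id S := LaxMonoidalFunctor.ext rfl
    (heq_of_eq (by simp [LaxMonoidalFunctor.comp, LaxMonoidalFunctor.id]))
    (heq_of_eq (by funext a b; simp [LaxMonoidalFunctor.comp, LaxMonoidalFunctor.id]))
  assoc S T U := LaxMonoidalFunctor.ext rfl
    (heq_of_eq (by simp [LaxMonoidalFunctor.comp]))
    (heq_of_eq (by funext a b; simp [LaxMonoidalFunctor.comp]))

/-! ### Short skew multicategories -/

/-- A functor `C ⥤ Type`, presented as a family of sets of nullary multimaps with an action of the
morphisms of `C`. -/
structure MultiHom₀ (C : Type u) [Category.{v} C] where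
  Hom : C → Type v
  act : ∀ {b b' : C}, (b ⟶ b') → Hom b → Hom b'
  act_id : ∀ {b : C} (m : Hom b), act (𝟙 b) m = m
  act_comp : ∀ {b b' b'' : C} (q : b ⟶ b') (q' : b' ⟶ b'') (m : Hom b),
    act q' (act q m) = act (q ≫ q') m

/-- A functor `Cᵒᵖ × C ⥤ Type`, presented as a family of sets of unary multimaps with an action of
the morphisms of `C`. -/
structure MultiHom₁ (C : Type u) [Category.{v} C] where
  Hom : C → C → Type v
  act : ∀ {a a' b b' : C}, (a' ⟶ a) → (b ⟶ b') → Hom a b → Hom a' b'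
  act_id : ∀ {a b : C} (m : Hom a b), act (𝟙 a) (𝟙 b) m = m
  act_comp : ∀ {a a' a'' b b' b'' : C} (p : a' ⟶ a) (p' : a'' ⟶ a')
    (q : b ⟶ b') (q' : b' ⟶ b'') (m : Hom a b),
    act p' q' (act p q m) = act (p' ≫ p) (q ≫ q') m

/-- A functor `(C²)ᵒᵖ × C ⥤ Type`, presented as a family of sets of binary multimaps with an action
of the morphisms of `C`. -/
structure MultiHom₂ (C : Type u) [Category.{v} C] where
  Hom : C → C → C → Type v
  act : ∀ {a₁ a₁' a₂ a₂' b b' : C}, (a₁' ⟶ a₁) → (a₂' ⟶ a₂) → (b ⟶ b') →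
    Hom a₁ a₂ b → Hom a₁' a₂' b'
  act_id : ∀ {a₁ a₂ b : C} (m : Hom a₁ a₂ b), act (𝟙 a₁) (𝟙 a₂) (𝟙 b) m = m
  act_comp : ∀ {a₁ a₁' a₁'' a₂ a₂' a₂'' b b' b'' : C} (p₁ : a₁' ⟶ a₁) (p₁' : a₁'' ⟶ a₁')
    (p₂ : a₂' ⟶ a₂) (p₂' : a₂'' ⟶ a₂') (q : b ⟶ b') (q' : b' ⟶ b'') (m : Hom a₁ a₂ b),
    act p₁' p₂' q' (act p₁ p₂ q m) = act (p₁' ≫ p₁) (p₂' ≫ p₂) (q ≫ q') m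

/-- A functor `(C³)ᵒᵖ × C ⥤ Type`, presented as a family of sets of ternary multimaps with an action
of the morphisms of `C`. -/
structure MultiHom₃ (C : Type u) [Category.{v} C] where
  Hom : C → C → C → C → Type v
  act : ∀ {a₁ a₁' a₂ a₂' a₃ a₃' b b' : C}, (a₁' ⟶ a₁) → (a₂' ⟶ a₂) → (a₃' ⟶ a₃) → (b ⟶ b') →
    Hom a₁ a₂ a₃ b → Hom a₁' a₂' a₃' b'
  act_id : ∀ {a₁ a₂ a₃ b : C} (m : Hom a₁ a₂ a₃ b), act (𝟙 a₁) (𝟙 a₂) (𝟙 a₃) (𝟙 b) m = m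
  act_comp : ∀ {a₁ a₁' a₁'' a₂ a₂' a₂'' a₃ a₃' a₃'' b b' b'' : C}
    (p₁ : a₁' ⟶ a₁) (p₁' : a₁'' ⟶ a₁') (p₂ : a₂' ⟶ a₂) (p₂' : a₂'' ⟶ a₂')
    (p₃ : a₃' ⟶ a₃) (p₃' : a₃'' ⟶ a₃') (q : b ⟶ b') (q' : b' ⟶ b'') (m : Hom a₁ a₂ a₃ b),
    act p₁' p₂' p₃' q' (act p₁ p₂ p₃ q m) =
      act (p₁' ≫ p₁) (p₂' ≫ p₂) (p₃' ≫ p₃) (q ≫ q') m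

/-- A functor `(C⁴)ᵒᵖ × C ⥤ Type`, presented as a family of sets of 4-ary multimaps with an action
of the morphisms of `C`. -/
structure MultiHom₄ (C : Type u) [Category.{v} C] where
  Hom : C → C → C → C → C → Type v
  act : ∀ {a₁ a₁' a₂ a₂' a₃ a₃' a₄ a₄' b b' : C}, (a₁' ⟶ a₁) → (a₂' ⟶ a₂) → (a₃' ⟶ a₃) →
    (a₄' ⟶ a₄) → (b ⟶ b') → Hom a₁ a₂ a₃ a₄ b → Hom a₁' a₂' a₃' a₄' b'
  act_id : ∀ {a₁ a₂ a₃ a₄ b : C} (m : Hom a₁ a₂ a₃ a₄ b),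
    act (𝟙 a₁) (𝟙 a₂) (𝟙 a₃) (𝟙 a₄) (𝟙 b) m = m
  act_comp : ∀ {a₁ a₁' a₁'' a₂ a₂' a₂'' a₃ a₃' a₃'' a₄ a₄' a₄'' b b' b'' : C}
    (p₁ : a₁' ⟶ a₁) (p₁' : a₁'' ⟶ a₁') (p₂ : a₂' ⟶ a₂) (p₂' : a₂'' ⟶ a₂')
    (p₃ : a₃' ⟶ a₃) (p₃' : a₃'' ⟶ a₃') (p₄ : a₄' ⟶ a₄) (p₄' : a₄'' ⟶ a₄')
    (q : b ⟶ b') (q' : b' ⟶ b'') (m : Hom a₁ a₂ a₃ a₄ b),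
    act p₁' p₂' p₃' p₄' q' (act p₁ p₂ p₃ p₄ q m) =
      act (p₁' ≫ p₁) (p₂' ≫ p₂) (p₃' ≫ p₃) (p₄' ≫ p₄) (q ≫ q') m

/-- The data of a short skew multicategory: tight multimaps of arity 1 to 4 (the tight unary ones
being the morphisms of the underlying category), loose multimaps of arity 0 to 2, comparisons
viewing tight multimaps as loose, and substitutions. The name `subXYᵢ` stands for the substitution
`g ∘ᵢ f` with `g` of kind `X` and `f` of kind `Y`; here `2` and `3` stand for tight multimaps
of that arity, `0` for nullary maps and `l` for loose unary maps. -/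
structure ShortSkewData where
  Obj : Type u
  [cat : Category.{v} Obj]
  T₂ : MultiHom₂.{v, u} Obj
  T₃ : MultiHom₃.{v, u} Obj
  T₄ : MultiHom₄.{v, u} Obj
  L₀ : MultiHom₀.{v, u} Obj
  L₁ : MultiHom₁.{v, u} Obj
  L₂ : MultiHom₂.{v, u} Obj
  j₁ : ∀ {a b : Obj}, (a ⟶ b) → L₁.Hom a b
  j₂ : ∀ {a₁ a₂ b : Obj}, T₂.Hom a₁ a₂ b → L₂.Hom a₁ a₂ b
  sub22₁ : ∀ {a₁ a₂ b₁ b₂ c : Obj}, T₂.Hom b₁ b₂ c → T₂.Hom a₁ a₂ b₁ → T₃.Hom a₁ a₂ b₂ c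
  sub22₂ : ∀ {a₁ a₂ b₁ b₂ c : Obj}, T₂.Hom b₁ b₂ c → T₂.Hom a₁ a₂ b₂ → T₃.Hom b₁ a₁ a₂ c
  sub32₁ : ∀ {a₁ a₂ b₁ b₂ b₃ c : Obj},
    T₃.Hom b₁ b₂ b₃ c → T₂.Hom a₁ a₂ b₁ → T₄.Hom a₁ a₂ b₂ b₃ c
  sub32₂ : ∀ {a₁ a₂ b₁ b₂ b₃ c : Obj},
    T₃.Hom b₁ b₂ b₃ c → T₂.Hom a₁ a₂ b₂ → T₄.Hom b₁ a₁ a₂ b₃ c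
  sub32₃ : ∀ {a₁ a₂ b₁ b₂ b₃ c : Obj},
    T₃.Hom b₁ b₂ b₃ c → T₂.Hom a₁ a₂ b₃ → T₄.Hom b₁ b₂ a₁ a₂ c
  sub23₁ : ∀ {a₁ a₂ a₃ b₁ b₂ c : Obj},
    T₂.Hom b₁ b₂ c → T₃.Hom a₁ a₂ a₃ b₁ → T₄.Hom a₁ a₂ a₃ b₂ c
  sub23₂ : ∀ {a₁ a₂ a₃ b₁ b₂ c : Obj},
    T₂.Hom b₁ b₂ c → T₃.Hom a₁ a₂ a₃ b₂ → T₄.Hom b₁ a₁ a₂ a₃ c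
  sub20₁ : ∀ {b₁ b₂ c : Obj}, T₂.Hom b₁ b₂ c → L₀.Hom b₁ → L₁.Hom b₂ c
  sub20₂ : ∀ {b₁ b₂ c : Obj}, T₂.Hom b₁ b₂ c → L₀.Hom b₂ → (b₁ ⟶ c)
  sub30₁ : ∀ {b₁ b₂ b₃ c : Obj}, T₃.Hom b₁ b₂ b₃ c → L₀.Hom b₁ → L₂.Hom b₂ b₃ c
  sub30₂ : ∀ {b₁ b₂ b₃ c : Obj}, T₃.Hom b₁ b₂ b₃ c → L₀.Hom b₂ → T₂.Hom b₁ b₃ c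
  sub30₃ : ∀ {b₁ b₂ b₃ c : Obj}, T₃.Hom b₁ b₂ b₃ c → L₀.Hom b₃ → T₂.Hom b₁ b₂ c
  subl0 : ∀ {b c : Obj}, L₁.Hom b c → L₀.Hom b → L₀.Hom c
  sub2l₁ : ∀ {a b₁ b₂ c : Obj}, T₂.Hom b₁ b₂ c → L₁.Hom a b₁ → L₂.Hom a b₂ c
  sub2l₂ : ∀ {a b₁ b₂ c : Obj}, T₂.Hom b₁ b₂ c → L₁.Hom a b₂ → T₂.Hom b₁ a c
  subl2 : ∀ {a₁ a₂ b c : Obj}, L₁.Hom b c → T₂.Hom a₁ a₂ b → L₂.Hom a₁ a₂ c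

attribute [instance] ShortSkewData.cat

/-- A short skew multicategory. -/
structure ShortSkewMulticategory extends ShortSkewData.{v, u} where
  -- naturality of the comparisons
  j₁_natural : ∀ {a a' b b' : Obj} (p : a' ⟶ a) (q : b ⟶ b') (f : a ⟶ b),
    L₁.act p q (j₁ f) = j₁ (p ≫ f ≫ q)
  j₂_natural : ∀ {a₁ a₁' a₂ a₂' b b' : Obj} (p₁ : a₁' ⟶ a₁) (p₂ : a₂' ⟶ a₂) (q : b ⟶ b')
    (f : T₂.Hom a₁ a₂ b), L₂.act p₁ p₂ q (j₂ f) = j₂ (T₂.act p₁ p₂ q f)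
  -- compatibility of the comparisons with substitution of, and into, loose unary maps
  sub2l₁_j : ∀ {a b₁ b₂ c : Obj} (g : T₂.Hom b₁ b₂ c) (p : a ⟶ b₁),
    sub2l₁ g (j₁ p) = j₂ (T₂.act p (𝟙 _) (𝟙 _) g)
  sub2l₂_j : ∀ {a b₁ b₂ c : Obj} (g : T₂.Hom b₁ b₂ c) (p : a ⟶ b₂),
    sub2l₂ g (j₁ p) = T₂.act (𝟙 _) p (𝟙 _) g
  subl2_j : ∀ {a₁ a₂ b c : Obj} (p : b ⟶ c) (g : T₂.Hom a₁ a₂ b),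
    subl2 (j₁ p) g = j₂ (T₂.act (𝟙 _) (𝟙 _) p g)
  subl0_j : ∀ {b c : Obj} (p : b ⟶ c) (w : L₀.Hom b), subl0 (j₁ p) w = L₀.act p w
  -- naturality and dinaturality of the substitutions
  sub22₁_natural : ∀ {a₁ a₁' a₂ a₂' b₁ b₂ b₂' c c' : Obj} (p₁ : a₁' ⟶ a₁) (p₂ : a₂' ⟶ a₂)
    (q₂ : b₂' ⟶ b₂) (h : c ⟶ c') (g : T₂.Hom b₁ b₂ c) (f : T₂.Hom a₁ a₂ b₁),
    T₃.act p₁ p₂ q₂ h (sub22₁ g f) = sub22₁ (T₂.act (𝟙 _) q₂ h g) (T₂.act p₁ p₂ (𝟙 _) f)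
  sub22₁_dinatural : ∀ {a₁ a₂ b₁ b₁' b₂ c : Obj} (k : b₁ ⟶ b₁') (g : T₂.Hom b₁' b₂ c)
    (f : T₂.Hom a₁ a₂ b₁),
    sub22₁ (T₂.act k (𝟙 _) (𝟙 _) g) f = sub22₁ g (T₂.act (𝟙 _) (𝟙 _) k f)
  sub22₂_natural : ∀ {a₁ a₁' a₂ a₂' b₁ b₁' b₂ c c' : Obj} (q₁ : b₁' ⟶ b₁) (p₁ : a₁' ⟶ a₁)
    (p₂ : a₂' ⟶ a₂) (h : c ⟶ c') (g : T₂.Hom b₁ b₂ c) (f : T₂.Hom a₁ a₂ b₂),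
    T₃.act q₁ p₁ p₂ h (sub22₂ g f) = sub22₂ (T₂.act q₁ (𝟙 _) h g) (T₂.act p₁ p₂ (𝟙 _) f)
  sub22₂_dinatural : ∀ {a₁ a₂ b₁ b₂ b₂' c : Obj} (k : b₂ ⟶ b₂') (g : T₂.Hom b₁ b₂' c)
    (f : T₂.Hom a₁ a₂ b₂),
    sub22₂ (T₂.act (𝟙 _) k (𝟙 _) g) f = sub22₂ g (T₂.act (𝟙 _) (𝟙 _) k f)
  sub32₁_natural : ∀ {a₁ a₁' a₂ a₂' b₁ b₂ b₂' b₃ b₃' c c' : Obj} (p₁ : a₁' ⟶ a₁) (p₂ : a₂' ⟶ a₂)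
    (q₂ : b₂' ⟶ b₂) (q₃ : b₃' ⟶ b₃) (h : c ⟶ c') (g : T₃.Hom b₁ b₂ b₃ c) (f : T₂.Hom a₁ a₂ b₁),
    T₄.act p₁ p₂ q₂ q₃ h (sub32₁ g f) = sub32₁ (T₃.act (𝟙 _) q₂ q₃ h g) (T₂.act p₁ p₂ (𝟙 _) f)
  sub32₁_dinatural : ∀ {a₁ a₂ b₁ b₁' b₂ b₃ c : Obj} (k : b₁ ⟶ b₁') (g : T₃.Hom b₁' b₂ b₃ c)
    (f : T₂.Hom a₁ a₂ b₁),
    sub32₁ (T₃.act k (𝟙 _) (𝟙 _) (𝟙 _) g) f = sub32₁ g (T₂.act (𝟙 _) (𝟙 _) k f)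
  sub32₂_natural : ∀ {a₁ a₁' a₂ a₂' b₁ b₁' b₂ b₃ b₃' c c' : Obj} (q₁ : b₁' ⟶ b₁) (p₁ : a₁' ⟶ a₁)
    (p₂ : a₂' ⟶ a₂) (q₃ : b₃' ⟶ b₃) (h : c ⟶ c') (g : T₃.Hom b₁ b₂ b₃ c) (f : T₂.Hom a₁ a₂ b₂),
    T₄.act q₁ p₁ p₂ q₃ h (sub32₂ g f) = sub32₂ (T₃.act q₁ (𝟙 _) q₃ h g) (T₂.act p₁ p₂ (𝟙 _) f)
  sub32₂_dinatural : ∀ {a₁ a₂ b₁ b₂ b₂' b₃ c : Obj} (k : b₂ ⟶ b₂') (g : T₃.Hom b₁ b₂' b₃ c)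
    (f : T₂.Hom a₁ a₂ b₂),
    sub32₂ (T₃.act (𝟙 _) k (𝟙 _) (𝟙 _) g) f = sub32₂ g (T₂.act (𝟙 _) (𝟙 _) k f)
  sub32₃_natural : ∀ {a₁ a₁' a₂ a₂' b₁ b₁' b₂ b₂' b₃ c c' : Obj} (q₁ : b₁' ⟶ b₁) (q₂ : b₂' ⟶ b₂)
    (p₁ : a₁' ⟶ a₁) (p₂ : a₂' ⟶ a₂) (h : c ⟶ c') (g : T₃.Hom b₁ b₂ b₃ c) (f : T₂.Hom a₁ a₂ b₃),
    T₄.act q₁ q₂ p₁ p₂ h (sub32₃ g f) = sub32₃ (T₃.act q₁ q₂ (𝟙 _) h g) (T₂.act p₁ p₂ (𝟙 _) f)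
  sub32₃_dinatural : ∀ {a₁ a₂ b₁ b₂ b₃ b₃' c : Obj} (k : b₃ ⟶ b₃') (g : T₃.Hom b₁ b₂ b₃' c)
    (f : T₂.Hom a₁ a₂ b₃),
    sub32₃ (T₃.act (𝟙 _) (𝟙 _) k (𝟙 _) g) f = sub32₃ g (T₂.act (𝟙 _) (𝟙 _) k f)
  sub23₁_natural : ∀ {a₁ a₁' a₂ a₂' a₃ a₃' b₁ b₂ b₂' c c' : Obj} (p₁ : a₁' ⟶ a₁) (p₂ : a₂' ⟶ a₂)
    (p₃ : a₃' ⟶ a₃) (q₂ : b₂' ⟶ b₂) (h : c ⟶ c') (g : T₂.Hom b₁ b₂ c) (f : T₃.Hom a₁ a₂ a₃ b₁),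
    T₄.act p₁ p₂ p₃ q₂ h (sub23₁ g f) = sub23₁ (T₂.act (𝟙 _) q₂ h g) (T₃.act p₁ p₂ p₃ (𝟙 _) f)
  sub23₁_dinatural : ∀ {a₁ a₂ a₃ b₁ b₁' b₂ c : Obj} (k : b₁ ⟶ b₁') (g : T₂.Hom b₁' b₂ c)
    (f : T₃.Hom a₁ a₂ a₃ b₁),
    sub23₁ (T₂.act k (𝟙 _) (𝟙 _) g) f = sub23₁ g (T₃.act (𝟙 _) (𝟙 _) (𝟙 _) k f)
  sub23₂_natural : ∀ {a₁ a₁' a₂ a₂' a₃ a₃' b₁ b₁' b₂ c c' : Obj} (q₁ : b₁' ⟶ b₁) (p₁ : a₁' ⟶ a₁)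
    (p₂ : a₂' ⟶ a₂) (p₃ : a₃' ⟶ a₃) (h : c ⟶ c') (g : T₂.Hom b₁ b₂ c) (f : T₃.Hom a₁ a₂ a₃ b₂),
    T₄.act q₁ p₁ p₂ p₃ h (sub23₂ g f) = sub23₂ (T₂.act q₁ (𝟙 _) h g) (T₃.act p₁ p₂ p₃ (𝟙 _) f)
  sub23₂_dinatural : ∀ {a₁ a₂ a₃ b₁ b₂ b₂' c : Obj} (k : b₂ ⟶ b₂') (g : T₂.Hom b₁ b₂' c)
    (f : T₃.Hom a₁ a₂ a₃ b₂),
    sub23₂ (T₂.act (𝟙 _) k (𝟙 _) g) f = sub23₂ g (T₃.act (𝟙 _) (𝟙 _) (𝟙 _) k f)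
  sub20₁_natural : ∀ {b₁ b₂ b₂' c c' : Obj} (q₂ : b₂' ⟶ b₂) (h : c ⟶ c') (g : T₂.Hom b₁ b₂ c)
    (w : L₀.Hom b₁), L₁.act q₂ h (sub20₁ g w) = sub20₁ (T₂.act (𝟙 _) q₂ h g) w
  sub20₁_dinatural : ∀ {b₁ b₁' b₂ c : Obj} (k : b₁ ⟶ b₁') (g : T₂.Hom b₁' b₂ c) (w : L₀.Hom b₁),
    sub20₁ (T₂.act k (𝟙 _) (𝟙 _) g) w = sub20₁ g (L₀.act k w)
  sub20₂_natural : ∀ {b₁ b₁' b₂ c c' : Obj} (q₁ : b₁' ⟶ b₁) (h : c ⟶ c') (g : T₂.Hom b₁ b₂ c)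
    (w : L₀.Hom b₂), q₁ ≫ sub20₂ g w ≫ h = sub20₂ (T₂.act q₁ (𝟙 _) h g) w
  sub20₂_dinatural : ∀ {b₁ b₂ b₂' c : Obj} (k : b₂ ⟶ b₂') (g : T₂.Hom b₁ b₂' c) (w : L₀.Hom b₂),
    sub20₂ (T₂.act (𝟙 _) k (𝟙 _) g) w = sub20₂ g (L₀.act k w)
  sub30₁_natural : ∀ {b₁ b₂ b₂' b₃ b₃' c c' : Obj} (q₂ : b₂' ⟶ b₂) (q₃ : b₃' ⟶ b₃) (h : c ⟶ c')
    (g : T₃.Hom b₁ b₂ b₃ c) (w : L₀.Hom b₁),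
    L₂.act q₂ q₃ h (sub30₁ g w) = sub30₁ (T₃.act (𝟙 _) q₂ q₃ h g) w
  sub30₁_dinatural : ∀ {b₁ b₁' b₂ b₃ c : Obj} (k : b₁ ⟶ b₁') (g : T₃.Hom b₁' b₂ b₃ c)
    (w : L₀.Hom b₁), sub30₁ (T₃.act k (𝟙 _) (𝟙 _) (𝟙 _) g) w = sub30₁ g (L₀.act k w)
  sub30₂_natural : ∀ {b₁ b₁' b₂ b₃ b₃' c c' : Obj} (q₁ : b₁' ⟶ b₁) (q₃ : b₃' ⟶ b₃) (h : c ⟶ c')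
    (g : T₃.Hom b₁ b₂ b₃ c) (w : L₀.Hom b₂),
    T₂.act q₁ q₃ h (sub30₂ g w) = sub30₂ (T₃.act q₁ (𝟙 _) q₃ h g) w
  sub30₂_dinatural : ∀ {b₁ b₂ b₂' b₃ c : Obj} (k : b₂ ⟶ b₂') (g : T₃.Hom b₁ b₂' b₃ c)
    (w : L₀.Hom b₂), sub30₂ (T₃.act (𝟙 _) k (𝟙 _) (𝟙 _) g) w = sub30₂ g (L₀.act k w)
  sub30₃_natural : ∀ {b₁ b₁' b₂ b₂' b₃ c c' : Obj} (q₁ : b₁' ⟶ b₁) (q₂ : b₂' ⟶ b₂) (h : c ⟶ c')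
    (g : T₃.Hom b₁ b₂ b₃ c) (w : L₀.Hom b₃),
    T₂.act q₁ q₂ h (sub30₃ g w) = sub30₃ (T₃.act q₁ q₂ (𝟙 _) h g) w
  sub30₃_dinatural : ∀ {b₁ b₂ b₃ b₃' c : Obj} (k : b₃ ⟶ b₃') (g : T₃.Hom b₁ b₂ b₃' c)
    (w : L₀.Hom b₃), sub30₃ (T₃.act (𝟙 _) (𝟙 _) k (𝟙 _) g) w = sub30₃ g (L₀.act k w)
  subl0_natural : ∀ {b c c' : Obj} (h : c ⟶ c') (g : L₁.Hom b c) (w : L₀.Hom b),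
    L₀.act h (subl0 g w) = subl0 (L₁.act (𝟙 _) h g) w
  subl0_dinatural : ∀ {b b' c : Obj} (k : b ⟶ b') (g : L₁.Hom b' c) (w : L₀.Hom b),
    subl0 (L₁.act k (𝟙 _) g) w = subl0 g (L₀.act k w)
  sub2l₁_natural : ∀ {a a' b₁ b₂ b₂' c c' : Obj} (p : a' ⟶ a) (q₂ : b₂' ⟶ b₂) (h : c ⟶ c')
    (g : T₂.Hom b₁ b₂ c) (f : L₁.Hom a b₁),
    L₂.act p q₂ h (sub2l₁ g f) = sub2l₁ (T₂.act (𝟙 _) q₂ h g) (L₁.act p (𝟙 _) f)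
  sub2l₁_dinatural : ∀ {a b₁ b₁' b₂ c : Obj} (k : b₁ ⟶ b₁') (g : T₂.Hom b₁' b₂ c)
    (f : L₁.Hom a b₁), sub2l₁ (T₂.act k (𝟙 _) (𝟙 _) g) f = sub2l₁ g (L₁.act (𝟙 _) k f)
  sub2l₂_natural : ∀ {a a' b₁ b₁' b₂ c c' : Obj} (q₁ : b₁' ⟶ b₁) (p : a' ⟶ a) (h : c ⟶ c')
    (g : T₂.Hom b₁ b₂ c) (f : L₁.Hom a b₂),
    T₂.act q₁ p h (sub2l₂ g f) = sub2l₂ (T₂.act q₁ (𝟙 _) h g) (L₁.act p (𝟙 _) f)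
  sub2l₂_dinatural : ∀ {a b₁ b₂ b₂' c : Obj} (k : b₂ ⟶ b₂') (g : T₂.Hom b₁ b₂' c)
    (f : L₁.Hom a b₂), sub2l₂ (T₂.act (𝟙 _) k (𝟙 _) g) f = sub2l₂ g (L₁.act (𝟙 _) k f)
  subl2_natural : ∀ {a₁ a₁' a₂ a₂' b c c' : Obj} (p₁ : a₁' ⟶ a₁) (p₂ : a₂' ⟶ a₂) (h : c ⟶ c')
    (g : L₁.Hom b c) (f : T₂.Hom a₁ a₂ b),
    L₂.act p₁ p₂ h (subl2 g f) = subl2 (L₁.act (𝟙 _) h g) (T₂.act p₁ p₂ (𝟙 _) f)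
  subl2_dinatural : ∀ {a₁ a₂ b b' c : Obj} (k : b ⟶ b') (g : L₁.Hom b' c) (f : T₂.Hom a₁ a₂ b),
    subl2 (L₁.act k (𝟙 _) g) f = subl2 g (T₂.act (𝟙 _) (𝟙 _) k f)
  -- associativity: `f`, `g` and `h` tight binary
  assoc22₁₁ : ∀ {a₁ a₂ b₁ b₂ c₁ c₂ d : Obj} (f : T₂.Hom c₁ c₂ d) (g : T₂.Hom b₁ b₂ c₁)
    (h : T₂.Hom a₁ a₂ b₁), sub23₁ f (sub22₁ g h) = sub32₁ (sub22₁ f g) h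
  assoc22₁₂ : ∀ {a₁ a₂ b₁ b₂ c₁ c₂ d : Obj} (f : T₂.Hom c₁ c₂ d) (g : T₂.Hom b₁ b₂ c₁)
    (h : T₂.Hom a₁ a₂ b₂), sub23₁ f (sub22₂ g h) = sub32₂ (sub22₁ f g) h
  assoc22₂₁ : ∀ {a₁ a₂ b₁ b₂ c₁ c₂ d : Obj} (f : T₂.Hom c₁ c₂ d) (g : T₂.Hom b₁ b₂ c₂)
    (h : T₂.Hom a₁ a₂ b₁), sub23₂ f (sub22₁ g h) = sub32₂ (sub22₂ f g) h
  assoc22₂₂ : ∀ {a₁ a₂ b₁ b₂ c₁ c₂ d : Obj} (f : T₂.Hom c₁ c₂ d) (g : T₂.Hom b₁ b₂ c₂)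
    (h : T₂.Hom a₁ a₂ b₂), sub23₂ f (sub22₂ g h) = sub32₃ (sub22₂ f g) h
  comm22 : ∀ {a₁ a₂ b₁ b₂ c₁ c₂ d : Obj} (f : T₂.Hom c₁ c₂ d) (g : T₂.Hom a₁ a₂ c₁)
    (h : T₂.Hom b₁ b₂ c₂), sub32₃ (sub22₁ f g) h = sub32₁ (sub22₂ f h) g
  -- associativity: `f` and `g` tight binary, `h` nullary
  assoc20₁₁ : ∀ {b₁ b₂ c₁ c₂ d : Obj} (f : T₂.Hom c₁ c₂ d) (g : T₂.Hom b₁ b₂ c₁) (h : L₀.Hom b₁),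
    sub2l₁ f (sub20₁ g h) = sub30₁ (sub22₁ f g) h
  assoc20₁₂ : ∀ {b₁ b₂ c₁ c₂ d : Obj} (f : T₂.Hom c₁ c₂ d) (g : T₂.Hom b₁ b₂ c₁) (h : L₀.Hom b₂),
    T₂.act (sub20₂ g h) (𝟙 _) (𝟙 _) f = sub30₂ (sub22₁ f g) h
  assoc20₂₁ : ∀ {b₁ b₂ c₁ c₂ d : Obj} (f : T₂.Hom c₁ c₂ d) (g : T₂.Hom b₁ b₂ c₂) (h : L₀.Hom b₁),
    sub2l₂ f (sub20₁ g h) = sub30₂ (sub22₂ f g) h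
  assoc20₂₂ : ∀ {b₁ b₂ c₁ c₂ d : Obj} (f : T₂.Hom c₁ c₂ d) (g : T₂.Hom b₁ b₂ c₂) (h : L₀.Hom b₂),
    T₂.act (𝟙 _) (sub20₂ g h) (𝟙 _) f = sub30₃ (sub22₂ f g) h
  comm20 : ∀ {a₁ a₂ c₁ c₂ d : Obj} (f : T₂.Hom c₁ c₂ d) (g : T₂.Hom a₁ a₂ c₁) (h : L₀.Hom c₂),
    sub30₃ (sub22₁ f g) h = T₂.act (𝟙 _) (𝟙 _) (sub20₂ f h) g
  -- associativity: `f` and `h` tight binary, `g` nullary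
  comm02 : ∀ {b₁ b₂ c₁ c₂ d : Obj} (f : T₂.Hom c₁ c₂ d) (g : L₀.Hom c₁) (h : T₂.Hom b₁ b₂ c₂),
    subl2 (sub20₁ f g) h = sub30₁ (sub22₂ f h) g
  -- associativity: `f` tight binary, `g` and `h` nullary
  comm00 : ∀ {c₁ c₂ d : Obj} (f : T₂.Hom c₁ c₂ d) (g : L₀.Hom c₁) (h : L₀.Hom c₂),
    subl0 (sub20₁ f g) h = L₀.act (sub20₂ f h) g

/-- A morphism of short skew multicategories. -/
@[ext]
structure ShortSkewMultifunctor (M N : ShortSkewMulticategory.{v, u}) where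
  F : M.Obj ⥤ N.Obj
  T₂ : ∀ {a₁ a₂ b : M.Obj}, M.T₂.Hom a₁ a₂ b → N.T₂.Hom (F.obj a₁) (F.obj a₂) (F.obj b)
  T₃ : ∀ {a₁ a₂ a₃ b : M.Obj}, M.T₃.Hom a₁ a₂ a₃ b →
    N.T₃.Hom (F.obj a₁) (F.obj a₂) (F.obj a₃) (F.obj b)
  T₄ : ∀ {a₁ a₂ a₃ a₄ b : M.Obj}, M.T₄.Hom a₁ a₂ a₃ a₄ b →
    N.T₄.Hom (F.obj a₁) (F.obj a₂) (F.obj a₃) (F.obj a₄) (F.obj b)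
  L₀ : ∀ {b : M.Obj}, M.L₀.Hom b → N.L₀.Hom (F.obj b)
  L₁ : ∀ {a b : M.Obj}, M.L₁.Hom a b → N.L₁.Hom (F.obj a) (F.obj b)
  L₂ : ∀ {a₁ a₂ b : M.Obj}, M.L₂.Hom a₁ a₂ b → N.L₂.Hom (F.obj a₁) (F.obj a₂) (F.obj b)
  T₂_natural : ∀ {a₁ a₁' a₂ a₂' b b' : M.Obj} (p₁ : a₁' ⟶ a₁) (p₂ : a₂' ⟶ a₂) (q : b ⟶ b')
    (f : M.T₂.Hom a₁ a₂ b),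
    T₂ (M.T₂.act p₁ p₂ q f) = N.T₂.act (F.map p₁) (F.map p₂) (F.map q) (T₂ f)
  T₃_natural : ∀ {a₁ a₁' a₂ a₂' a₃ a₃' b b' : M.Obj} (p₁ : a₁' ⟶ a₁) (p₂ : a₂' ⟶ a₂)
    (p₃ : a₃' ⟶ a₃) (q : b ⟶ b') (f : M.T₃.Hom a₁ a₂ a₃ b),
    T₃ (M.T₃.act p₁ p₂ p₃ q f) = N.T₃.act (F.map p₁) (F.map p₂) (F.map p₃) (F.map q) (T₃ f)
  T₄_natural : ∀ {a₁ a₁' a₂ a₂' a₃ a₃' a₄ a₄' b b' : M.Obj} (p₁ : a₁' ⟶ a₁) (p₂ : a₂' ⟶ a₂)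
    (p₃ : a₃' ⟶ a₃) (p₄ : a₄' ⟶ a₄) (q : b ⟶ b') (f : M.T₄.Hom a₁ a₂ a₃ a₄ b),
    T₄ (M.T₄.act p₁ p₂ p₃ p₄ q f) =
      N.T₄.act (F.map p₁) (F.map p₂) (F.map p₃) (F.map p₄) (F.map q) (T₄ f)
  L₀_natural : ∀ {b b' : M.Obj} (q : b ⟶ b') (f : M.L₀.Hom b),
    L₀ (M.L₀.act q f) = N.L₀.act (F.map q) (L₀ f)
  L₁_natural : ∀ {a a' b b' : M.Obj} (p : a' ⟶ a) (q : b ⟶ b') (f : M.L₁.Hom a b),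
    L₁ (M.L₁.act p q f) = N.L₁.act (F.map p) (F.map q) (L₁ f)
  L₂_natural : ∀ {a₁ a₁' a₂ a₂' b b' : M.Obj} (p₁ : a₁' ⟶ a₁) (p₂ : a₂' ⟶ a₂) (q : b ⟶ b')
    (f : M.L₂.Hom a₁ a₂ b),
    L₂ (M.L₂.act p₁ p₂ q f) = N.L₂.act (F.map p₁) (F.map p₂) (F.map q) (L₂ f)
  map_j₁ : ∀ {a b : M.Obj} (f : a ⟶ b), L₁ (M.j₁ f) = N.j₁ (F.map f)
  map_j₂ : ∀ {a₁ a₂ b : M.Obj} (f : M.T₂.Hom a₁ a₂ b), L₂ (M.j₂ f) = N.j₂ (T₂ f)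
  map_sub22₁ : ∀ {a₁ a₂ b₁ b₂ c : M.Obj} (g : M.T₂.Hom b₁ b₂ c) (f : M.T₂.Hom a₁ a₂ b₁),
    T₃ (M.sub22₁ g f) = N.sub22₁ (T₂ g) (T₂ f)
  map_sub22₂ : ∀ {a₁ a₂ b₁ b₂ c : M.Obj} (g : M.T₂.Hom b₁ b₂ c) (f : M.T₂.Hom a₁ a₂ b₂),
    T₃ (M.sub22₂ g f) = N.sub22₂ (T₂ g) (T₂ f)
  map_sub32₁ : ∀ {a₁ a₂ b₁ b₂ b₃ c : M.Obj} (g : M.T₃.Hom b₁ b₂ b₃ c) (f : M.T₂.Hom a₁ a₂ b₁),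
    T₄ (M.sub32₁ g f) = N.sub32₁ (T₃ g) (T₂ f)
  map_sub32₂ : ∀ {a₁ a₂ b₁ b₂ b₃ c : M.Obj} (g : M.T₃.Hom b₁ b₂ b₃ c) (f : M.T₂.Hom a₁ a₂ b₂),
    T₄ (M.sub32₂ g f) = N.sub32₂ (T₃ g) (T₂ f)
  map_sub32₃ : ∀ {a₁ a₂ b₁ b₂ b₃ c : M.Obj} (g : M.T₃.Hom b₁ b₂ b₃ c) (f : M.T₂.Hom a₁ a₂ b₃),
    T₄ (M.sub32₃ g f) = N.sub32₃ (T₃ g) (T₂ f)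
  map_sub23₁ : ∀ {a₁ a₂ a₃ b₁ b₂ c : M.Obj} (g : M.T₂.Hom b₁ b₂ c) (f : M.T₃.Hom a₁ a₂ a₃ b₁),
    T₄ (M.sub23₁ g f) = N.sub23₁ (T₂ g) (T₃ f)
  map_sub23₂ : ∀ {a₁ a₂ a₃ b₁ b₂ c : M.Obj} (g : M.T₂.Hom b₁ b₂ c) (f : M.T₃.Hom a₁ a₂ a₃ b₂),
    T₄ (M.sub23₂ g f) = N.sub23₂ (T₂ g) (T₃ f)
  map_sub20₁ : ∀ {b₁ b₂ c : M.Obj} (g : M.T₂.Hom b₁ b₂ c) (w : M.L₀.Hom b₁),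
    L₁ (M.sub20₁ g w) = N.sub20₁ (T₂ g) (L₀ w)
  map_sub20₂ : ∀ {b₁ b₂ c : M.Obj} (g : M.T₂.Hom b₁ b₂ c) (w : M.L₀.Hom b₂),
    F.map (M.sub20₂ g w) = N.sub20₂ (T₂ g) (L₀ w)
  map_sub30₁ : ∀ {b₁ b₂ b₃ c : M.Obj} (g : M.T₃.Hom b₁ b₂ b₃ c) (w : M.L₀.Hom b₁),
    L₂ (M.sub30₁ g w) = N.sub30₁ (T₃ g) (L₀ w)
  map_sub30₂ : ∀ {b₁ b₂ b₃ c : M.Obj} (g : M.T₃.Hom b₁ b₂ b₃ c) (w : M.L₀.Hom b₂),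
    T₂ (M.sub30₂ g w) = N.sub30₂ (T₃ g) (L₀ w)
  map_sub30₃ : ∀ {b₁ b₂ b₃ c : M.Obj} (g : M.T₃.Hom b₁ b₂ b₃ c) (w : M.L₀.Hom b₃),
    T₂ (M.sub30₃ g w) = N.sub30₃ (T₃ g) (L₀ w)
  map_subl0 : ∀ {b c : M.Obj} (g : M.L₁.Hom b c) (w : M.L₀.Hom b),
    L₀ (M.subl0 g w) = N.subl0 (L₁ g) (L₀ w)
  map_sub2l₁ : ∀ {a b₁ b₂ c : M.Obj} (g : M.T₂.Hom b₁ b₂ c) (f : M.L₁.Hom a b₁),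
    L₂ (M.sub2l₁ g f) = N.sub2l₁ (T₂ g) (L₁ f)
  map_sub2l₂ : ∀ {a b₁ b₂ c : M.Obj} (g : M.T₂.Hom b₁ b₂ c) (f : M.L₁.Hom a b₂),
    T₂ (M.sub2l₂ g f) = N.sub2l₂ (T₂ g) (L₁ f)
  map_subl2 : ∀ {a₁ a₂ b c : M.Obj} (g : M.L₁.Hom b c) (f : M.T₂.Hom a₁ a₂ b),
    L₂ (M.subl2 g f) = N.subl2 (L₁ g) (T₂ f)

namespace ShortSkewMultifunctor

/-- The identity morphism. -/
def id (M : ShortSkewMulticategory.{v, u}) : ShortSkewMultifunctor M M where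
  F := 𝟭 M.Obj
  T₂ f := f
  T₃ f := f
  T₄ f := f
  L₀ f := f
  L₁ f := f
  L₂ f := f
  T₂_natural _ _ _ _ := rfl
  T₃_natural _ _ _ _ _ := rfl
  T₄_natural _ _ _ _ _ _ := rfl
  L₀_natural _ _ := rfl
  L₁_natural _ _ _ := rfl
  L₂_natural _ _ _ _ := rfl
  map_j₁ _ := rfl
  map_j₂ _ := rfl
  map_sub22₁ _ _ := rfl
  map_sub22₂ _ _ := rfl
  map_sub32₁ _ _ := rfl
  map_sub32₂ _ _ := rfl
  map_sub32₃ _ _ := rfl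
  map_sub23₁ _ _ := rfl
  map_sub23₂ _ _ := rfl
  map_sub20₁ _ _ := rfl
  map_sub20₂ _ _ := rfl
  map_sub30₁ _ _ := rfl
  map_sub30₂ _ _ := rfl
  map_sub30₃ _ _ := rfl
  map_subl0 _ _ := rfl
  map_sub2l₁ _ _ := rfl
  map_sub2l₂ _ _ := rfl
  map_subl2 _ _ := rfl

/-- Composition of morphisms. -/
def comp {M N P : ShortSkewMulticategory.{v, u}} (S : ShortSkewMultifunctor M N)
    (T : ShortSkewMultifunctor N P) : ShortSkewMultifunctor M P where
  F := S.F ⋙ T.F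
  T₂ f := T.T₂ (S.T₂ f)
  T₃ f := T.T₃ (S.T₃ f)
  T₄ f := T.T₄ (S.T₄ f)
  L₀ f := T.L₀ (S.L₀ f)
  L₁ f := T.L₁ (S.L₁ f)
  L₂ f := T.L₂ (S.L₂ f)
  T₂_natural _ _ _ _ := by rw [S.T₂_natural, T.T₂_natural]; rfl
  T₃_natural _ _ _ _ _ := by rw [S.T₃_natural, T.T₃_natural]; rfl
  T₄_natural _ _ _ _ _ _ := by rw [S.T₄_natural, T.T₄_natural]; rfl
  L₀_natural _ _ := by rw [S.L₀_natural, T.L₀_natural]; rfl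
  L₁_natural _ _ _ := by rw [S.L₁_natural, T.L₁_natural]; rfl
  L₂_natural _ _ _ _ := by rw [S.L₂_natural, T.L₂_natural]; rfl
  map_j₁ _ := by rw [S.map_j₁, T.map_j₁]; rfl
  map_j₂ _ := by rw [S.map_j₂, T.map_j₂]
  map_sub22₁ _ _ := by rw [S.map_sub22₁, T.map_sub22₁]
  map_sub22₂ _ _ := by rw [S.map_sub22₂, T.map_sub22₂]
  map_sub32₁ _ _ := by rw [S.map_sub32₁, T.map_sub32₁]
  map_sub32₂ _ _ := by rw [S.map_sub32₂, T.map_sub32₂]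
  map_sub32₃ _ _ := by rw [S.map_sub32₃, T.map_sub32₃]
  map_sub23₁ _ _ := by rw [S.map_sub23₁, T.map_sub23₁]
  map_sub23₂ _ _ := by rw [S.map_sub23₂, T.map_sub23₂]
  map_sub20₁ _ _ := by rw [S.map_sub20₁, T.map_sub20₁]
  map_sub20₂ _ _ := by rw [Functor.comp_map, S.map_sub20₂, T.map_sub20₂]
  map_sub30₁ _ _ := by rw [S.map_sub30₁, T.map_sub30₁]
  map_sub30₂ _ _ := by rw [S.map_sub30₂, T.map_sub30₂]
  map_sub30₃ _ _ := by rw [S.map_sub30₃, T.map_sub30₃]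
  map_subl0 _ _ := by rw [S.map_subl0, T.map_subl0]
  map_sub2l₁ _ _ := by rw [S.map_sub2l₁, T.map_sub2l₁]
  map_sub2l₂ _ _ := by rw [S.map_sub2l₂, T.map_sub2l₂]
  map_subl2 _ _ := by rw [S.map_subl2, T.map_subl2]

end ShortSkewMultifunctor

/-- The category of short skew multicategories. -/
instance : Category ShortSkewMulticategory.{v, u} where
  Hom := ShortSkewMultifunctor
  id := ShortSkewMultifunctor.id
  comp := ShortSkewMultifunctor.comp
  id_comp _ := rfl
  comp_id _ := rfl
  assoc _ _ _ := rfl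

namespace ShortSkewMulticategory

variable (M : ShortSkewMulticategory.{v, u})

/-- A tight binary map `θ : a, b → ab` is a left universal tight binary map classifier. -/
structure IsLeftUniversal₂ {a b ab : M.Obj} (θ : M.T₂.Hom a b ab) : Prop where
  bij₁ : ∀ d : M.Obj, Function.Bijective
    (fun f : ab ⟶ d => M.T₂.act (𝟙 a) (𝟙 b) f θ)
  bij₂ : ∀ x d : M.Obj, Function.Bijective
    (fun f : M.T₂.Hom ab x d => M.sub22₁ f θ)
  bij₃ : ∀ x y d : M.Obj, Function.Bijective
    (fun f : M.T₃.Hom ab x y d => M.sub32₁ f θ)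

/-- A nullary map `w : ⋄ → i` is a left universal nullary map classifier. -/
structure IsLeftUniversal₀ {i : M.Obj} (w : M.L₀.Hom i) : Prop where
  bij₀ : ∀ d : M.Obj, Function.Bijective (fun f : i ⟶ d => M.L₀.act f w)
  bij₁ : ∀ x d : M.Obj, Function.Bijective (fun f : M.T₂.Hom i x d => M.sub20₁ f w)
  bij₂ : ∀ x y d : M.Obj, Function.Bijective (fun f : M.T₃.Hom i x y d => M.sub30₁ f w)

end ShortSkewMulticategory

/-- A short skew multicategory is left representable if it admits left universal nullary and tight
binary map classifiers. -/
def IsLeftRepresentableShort : ObjectProperty ShortSkewMulticategory.{v, u} := fun M =>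
  (∃ (i : M.Obj) (w : M.L₀.Hom i), M.IsLeftUniversal₀ w) ∧
    ∀ a b : M.Obj, ∃ (ab : M.Obj) (θ : M.T₂.Hom a b ab), M.IsLeftUniversal₂ θ

/-! ### From left representable short skew multicategories to skew monoidal categories -/

/-- A choice of left universal nullary and tight binary map classifiers. -/
structure LeftRepresentation (M : ShortSkewMulticategory.{v, u}) where
  i : M.Obj
  w : M.L₀.Hom i
  w_univ : M.IsLeftUniversal₀ w
  m : M.Obj → M.Obj → M.Obj
  θ : ∀ a b : M.Obj, M.T₂.Hom a b (m a b)
  θ_univ : ∀ a b : M.Obj, M.IsLeftUniversal₂ (θ a b)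

/-- A left representable short skew multicategory has a choice of classifiers. -/
def LeftRepresentation.choose {M : ShortSkewMulticategory.{v, u}}
    (h : IsLeftRepresentableShort M) : LeftRepresentation M where
  i := h.1.choose
  w := h.1.choose_spec.choose
  w_univ := h.1.choose_spec.choose_spec
  m a b := (h.2 a b).choose
  θ a b := (h.2 a b).choose_spec.choose
  θ_univ a b := (h.2 a b).choose_spec.choose_spec

namespace LeftRepresentation

variable {M : ShortSkewMulticategory.{v, u}} (R : LeftRepresentation M)

/-- The unique tight unary map whose composite with `θ` is the given tight binary map. -/
def desc {a b d : M.Obj} (f : M.T₂.Hom a b d) : R.m a b ⟶ d :=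
  (((R.θ_univ a b).bij₁ d).2 f).choose

theorem desc_spec {a b d : M.Obj} (f : M.T₂.Hom a b d) :
    M.T₂.act (𝟙 a) (𝟙 b) (R.desc f) (R.θ a b) = f :=
  (((R.θ_univ a b).bij₁ d).2 f).choose_spec

/-- The inverse of `- ∘₁ θ` on tight ternary maps. -/
def desc₃ {a b x d : M.Obj} (f : M.T₃.Hom a b x d) : M.T₂.Hom (R.m a b) x d :=
  (((R.θ_univ a b).bij₂ x d).2 f).choose

theorem desc₃_spec {a b x d : M.Obj} (f : M.T₃.Hom a b x d) :
    M.sub22₁ (R.desc₃ f) (R.θ a b) = f :=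
  (((R.θ_univ a b).bij₂ x d).2 f).choose_spec

/-- The inverse of `- ∘₁ w` on loose unary maps. -/
def desc₁ {x d : M.Obj} (f : M.L₁.Hom x d) : M.T₂.Hom R.i x d :=
  ((R.w_univ.bij₁ x d).2 f).choose

theorem desc₁_spec {x d : M.Obj} (f : M.L₁.Hom x d) : M.sub20₁ (R.desc₁ f) R.w = f :=
  ((R.w_univ.bij₁ x d).2 f).choose_spec

/-- The unique tight unary map whose composite with `w` is the given nullary map. -/
def desc₀ {d : M.Obj} (f : M.L₀.Hom d) : R.i ⟶ d :=
  ((R.w_univ.bij₀ d).2 f).choose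

theorem desc₀_spec {d : M.Obj} (f : M.L₀.Hom d) : M.L₀.act (R.desc₀ f) R.w = f :=
  ((R.w_univ.bij₀ d).2 f).choose_spec

theorem hom_ext {a b d : M.Obj} {f g : R.m a b ⟶ d}
    (h : M.T₂.act (𝟙 a) (𝟙 b) f (R.θ a b) = M.T₂.act (𝟙 a) (𝟙 b) g (R.θ a b)) : f = g :=
  ((R.θ_univ a b).bij₁ d).1 h

theorem hom_ext₃ {a b x d : M.Obj} {f g : M.T₂.Hom (R.m a b) x d}
    (h : M.sub22₁ f (R.θ a b) = M.sub22₁ g (R.θ a b)) : f = g :=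
  ((R.θ_univ a b).bij₂ x d).1 h

theorem hom_ext₄ {a b x y d : M.Obj} {f g : M.T₃.Hom (R.m a b) x y d}
    (h : M.sub32₁ f (R.θ a b) = M.sub32₁ g (R.θ a b)) : f = g :=
  ((R.θ_univ a b).bij₃ x y d).1 h

theorem hom_ext₀ {d : M.Obj} {f g : R.i ⟶ d}
    (h : M.L₀.act f R.w = M.L₀.act g R.w) : f = g :=
  (R.w_univ.bij₀ d).1 h

theorem hom_ext₁ {x d : M.Obj} {f g : M.T₂.Hom R.i x d}
    (h : M.sub20₁ f R.w = M.sub20₁ g R.w) : f = g :=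
  (R.w_univ.bij₁ x d).1 h

theorem hom_ext₂ {x y d : M.Obj} {f g : M.T₃.Hom R.i x y d}
    (h : M.sub30₁ f R.w = M.sub30₁ g R.w) : f = g :=
  (R.w_univ.bij₂ x y d).1 h

/-- Equality of maps out of `(ab)c` is checked on ternary maps. -/
theorem hom_ext_assoc {a b c d : M.Obj} {f g : R.m (R.m a b) c ⟶ d}
    (h : M.sub22₁ (M.T₂.act (𝟙 _) (𝟙 _) f (R.θ (R.m a b) c)) (R.θ a b) =
      M.sub22₁ (M.T₂.act (𝟙 _) (𝟙 _) g (R.θ (R.m a b) c)) (R.θ a b)) : f = g :=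
  R.hom_ext (R.hom_ext₃ h)

/-- The tensor product of two tight unary maps. -/
def tensorHom {a b c d : M.Obj} (f : a ⟶ b) (g : c ⟶ d) : R.m a c ⟶ R.m b d :=
  R.desc (M.T₂.act f g (𝟙 _) (R.θ b d))

/-- The associator. -/
def assoc (a b c : M.Obj) : R.m (R.m a b) c ⟶ R.m a (R.m b c) :=
  R.desc (R.desc₃ (M.sub22₂ (R.θ a (R.m b c)) (R.θ b c)))

/-- The left unit map. -/
def leftUnit (a : M.Obj) : R.m R.i a ⟶ a := R.desc (R.desc₁ (M.j₁ (𝟙 a)))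

/-- The right unit map. -/
def rightUnit (a : M.Obj) : a ⟶ R.m a R.i := M.sub20₂ (R.θ a R.i) R.w

theorem tensorHom_spec {a b c d : M.Obj} (f : a ⟶ b) (g : c ⟶ d) :
    M.T₂.act (𝟙 a) (𝟙 c) (R.tensorHom f g) (R.θ a c) = M.T₂.act f g (𝟙 _) (R.θ b d) :=
  R.desc_spec _

theorem assoc_spec (a b c : M.Obj) :
    M.sub22₁ (M.T₂.act (𝟙 _) (𝟙 _) (R.assoc a b c) (R.θ (R.m a b) c)) (R.θ a b) =
      M.sub22₂ (R.θ a (R.m b c)) (R.θ b c) := by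
  rw [assoc, R.desc_spec, R.desc₃_spec]

theorem leftUnit_spec (a : M.Obj) :
    M.sub20₁ (M.T₂.act (𝟙 _) (𝟙 _) (R.leftUnit a) (R.θ R.i a)) R.w = M.j₁ (𝟙 a) := by
  rw [leftUnit, R.desc_spec, R.desc₁_spec]

/-- Postcomposition with a composite, on binary maps. -/
theorem post₂ {a b c d : M.Obj} (f : c ⟶ d) {e : M.Obj} (g : d ⟶ e) (t : M.T₂.Hom a b c) :
    M.T₂.act (𝟙 _) (𝟙 _) (f ≫ g) t = M.T₂.act (𝟙 _) (𝟙 _) g (M.T₂.act (𝟙 _) (𝟙 _) f t) := by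
  rw [M.T₂.act_comp]; simp

/-- A map `f g : ac → bd` followed by a map out of `bd`. -/
theorem tensorHom_post {a b c d e : M.Obj} (f : a ⟶ b) (g : c ⟶ d) (h : R.m b d ⟶ e) :
    M.T₂.act (𝟙 _) (𝟙 _) (R.tensorHom f g ≫ h) (R.θ a c) =
      M.T₂.act f g (𝟙 _) (M.T₂.act (𝟙 _) (𝟙 _) h (R.θ b d)) := by
  rw [post₂, tensorHom_spec, M.T₂.act_comp, M.T₂.act_comp]; simp

theorem sub22₁_post {a₁ a₂ b₁ b₂ c c' : M.Obj} (h : c ⟶ c') (g : M.T₂.Hom b₁ b₂ c)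
    (f : M.T₂.Hom a₁ a₂ b₁) :
    M.sub22₁ (M.T₂.act (𝟙 _) (𝟙 _) h g) f = M.T₃.act (𝟙 _) (𝟙 _) (𝟙 _) h (M.sub22₁ g f) := by
  rw [M.sub22₁_natural, M.T₂.act_id f]

theorem sub22₂_post {a₁ a₂ b₁ b₂ c c' : M.Obj} (h : c ⟶ c') (g : M.T₂.Hom b₁ b₂ c)
    (f : M.T₂.Hom a₁ a₂ b₂) :
    M.sub22₂ (M.T₂.act (𝟙 _) (𝟙 _) h g) f = M.T₃.act (𝟙 _) (𝟙 _) (𝟙 _) h (M.sub22₂ g f) := by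
  rw [M.sub22₂_natural, M.T₂.act_id f]

/-- Composites starting with the associator. -/
theorem assoc_post (a b c : M.Obj) {d : M.Obj} (h : R.m a (R.m b c) ⟶ d) :
    M.sub22₁ (M.T₂.act (𝟙 _) (𝟙 _) (R.assoc a b c ≫ h) (R.θ (R.m a b) c)) (R.θ a b) =
      M.sub22₂ (M.T₂.act (𝟙 _) (𝟙 _) h (R.θ a (R.m b c))) (R.θ b c) := by
  rw [post₂, sub22₁_post, assoc_spec, sub22₂_post]

theorem tensorHom_id (a b : M.Obj) : R.tensorHom (𝟙 a) (𝟙 b) = 𝟙 (R.m a b) :=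
  R.hom_ext (R.tensorHom_spec _ _)

theorem tensorHom_comp {a b c a' b' c' : M.Obj} (f : a ⟶ b) (g : b ⟶ c) (f' : a' ⟶ b')
    (g' : b' ⟶ c') : R.tensorHom (f ≫ g) (f' ≫ g') = R.tensorHom f f' ≫ R.tensorHom g g' := by
  apply R.hom_ext
  rw [tensorHom_post, tensorHom_spec, tensorHom_spec, M.T₂.act_comp]; simp

theorem assoc_natural {a b c a' b' c' : M.Obj} (f : a ⟶ a') (g : b ⟶ b') (h : c ⟶ c') :
    R.tensorHom (R.tensorHom f g) h ≫ R.assoc a' b' c' =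
      R.assoc a b c ≫ R.tensorHom f (R.tensorHom g h) := by
  apply R.hom_ext_assoc
  rw [assoc_post, tensorHom_post, tensorHom_spec]
  have e1 : M.T₂.act (R.tensorHom f g) h (𝟙 _)
      (M.T₂.act (𝟙 _) (𝟙 _) (R.assoc a' b' c') (R.θ (R.m a' b') c')) =
      M.T₂.act (R.tensorHom f g) (𝟙 _) (𝟙 _) (M.T₂.act (𝟙 _) h (𝟙 _)
      (M.T₂.act (𝟙 _) (𝟙 _) (R.assoc a' b' c') (R.θ (R.m a' b') c'))) := by
    simp only [M.T₂.act_comp]; simp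
  have e2 : M.T₂.act f (R.tensorHom g h) (𝟙 _) (R.θ a' (R.m b' c')) =
      M.T₂.act (𝟙 _) (R.tensorHom g h) (𝟙 _)
        (M.T₂.act f (𝟙 _) (𝟙 _) (R.θ a' (R.m b' c'))) := by
    simp only [M.T₂.act_comp]; simp
  rw [e1, M.sub22₁_dinatural, tensorHom_spec, ← M.sub22₁_natural, assoc_spec,
    e2, M.sub22₂_dinatural, tensorHom_spec, ← M.sub22₂_natural]

theorem leftUnit_post {a b : M.Obj} (f : a ⟶ b) :
    M.sub20₁ (M.T₂.act (𝟙 _) (𝟙 _) (R.leftUnit a ≫ f) (R.θ R.i a)) R.w = M.j₁ f := by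
  rw [post₂, ← M.sub20₁_natural, leftUnit_spec, M.j₁_natural]; simp

theorem leftUnit_natural {a b : M.Obj} (f : a ⟶ b) :
    R.tensorHom (𝟙 R.i) f ≫ R.leftUnit b = R.leftUnit a ≫ f := by
  apply R.hom_ext
  apply R.hom_ext₁
  rw [leftUnit_post, tensorHom_post, ← M.sub20₁_natural, leftUnit_spec, M.j₁_natural]; simp

theorem rightUnit_post (a : M.Obj) {d : M.Obj} (f : R.m a R.i ⟶ d) :
    R.rightUnit a ≫ f = M.sub20₂ (M.T₂.act (𝟙 _) (𝟙 _) f (R.θ a R.i)) R.w := by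
  rw [← M.sub20₂_natural, rightUnit]; simp

theorem rightUnit_natural {a b : M.Obj} (f : a ⟶ b) :
    f ≫ R.rightUnit b = R.rightUnit a ≫ R.tensorHom f (𝟙 R.i) := by
  rw [rightUnit_post, tensorHom_spec, ← M.sub20₂_natural, rightUnit]; simp

theorem pentagon (a b c d : M.Obj) :
    R.assoc (R.m a b) c d ≫ R.assoc a b (R.m c d) =
      R.tensorHom (R.assoc a b c) (𝟙 d) ≫ R.assoc a (R.m b c) d ≫
        R.tensorHom (𝟙 a) (R.assoc b c d) := by
  apply R.hom_ext_assoc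
  apply R.hom_ext₄
  rw [assoc_post, ← M.comm22, assoc_spec, tensorHom_post]
  rw [M.sub22₁_dinatural, ← M.assoc22₁₁, assoc_spec, M.assoc22₁₂, assoc_post, tensorHom_spec,
    ← M.assoc22₂₁, M.sub23₂_dinatural, ← sub22₁_post, assoc_spec, M.assoc22₂₂]

theorem unit_left (a b : M.Obj) :
    R.assoc R.i a b ≫ R.leftUnit (R.m a b) = R.tensorHom (R.leftUnit a) (𝟙 b) := by
  apply R.hom_ext_assoc
  apply R.hom_ext₂
  rw [assoc_post, ← M.comm02, leftUnit_spec, M.subl2_j, tensorHom_spec, M.sub22₁_dinatural,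
    ← M.assoc20₁₁, leftUnit_spec, M.sub2l₁_j]

theorem unit_right (a b : M.Obj) :
    R.rightUnit (R.m a b) ≫ R.assoc a b R.i = R.tensorHom (𝟙 a) (R.rightUnit b) := by
  apply R.hom_ext
  rw [rightUnit_post, tensorHom_spec, ← M.comm20, assoc_spec, ← M.assoc20₂₂, rightUnit]

theorem unit_middle (a b : M.Obj) :
    R.tensorHom (R.rightUnit a) (𝟙 b) ≫ R.assoc a R.i b ≫ R.tensorHom (𝟙 a) (R.leftUnit b) =
      𝟙 (R.m a b) := by
  apply R.hom_ext
  rw [tensorHom_post, rightUnit, M.assoc20₁₂, assoc_post, tensorHom_spec, M.sub22₂_dinatural,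
    ← M.assoc20₂₁, leftUnit_spec, M.sub2l₂_j]

theorem unit_unit : R.rightUnit R.i ≫ R.leftUnit R.i = 𝟙 R.i := by
  apply R.hom_ext₀
  rw [rightUnit_post, ← M.comm00, leftUnit_spec, M.subl0_j]

/-- The skew monoidal category associated with a left representable short skew multicategory:
the tensor product is the tight binary map classifier and the unit is the nullary map
classifier. -/
def toSkewMonoidal : SkewMonoidalCategory.{v, u} where
  Obj := M.Obj
  tensorObj := R.m
  tensorHom := R.tensorHom
  tensorHom_id := R.tensorHom_id
  tensorHom_comp := R.tensorHom_comp
  unit := R.i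
  assoc := R.assoc
  leftUnit := R.leftUnit
  rightUnit := R.rightUnit
  assoc_natural := R.assoc_natural
  leftUnit_natural := R.leftUnit_natural
  rightUnit_natural := R.rightUnit_natural
  pentagon := R.pentagon
  unit_left := R.unit_left
  unit_right := R.unit_right
  unit_middle := R.unit_middle
  unit_unit := R.unit_unit

section Functoriality

variable {N : ShortSkewMulticategory.{v, u}} (S : LeftRepresentation N)
  (F : ShortSkewMultifunctor M N)

/-- The unique tight unary map `f₂ : Fa Fb → F(ab)` with `f₂ ∘ θ = F θ`. -/
def map₂ (a b : M.Obj) : S.m (F.F.obj a) (F.F.obj b) ⟶ F.F.obj (R.m a b) :=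
  S.desc (F.T₂ (R.θ a b))

/-- The unique tight unary map `f₀ : i → F i` with `f₀ ∘ w = F w`. -/
def map₀ : S.i ⟶ F.F.obj R.i := S.desc₀ (F.L₀ R.w)

theorem map₂_spec (a b : M.Obj) :
    N.T₂.act (𝟙 _) (𝟙 _) (R.map₂ S F a b) (S.θ (F.F.obj a) (F.F.obj b)) = F.T₂ (R.θ a b) :=
  S.desc_spec _

theorem map₀_spec : N.L₀.act (R.map₀ S F) S.w = F.L₀ R.w := S.desc₀_spec _

theorem map_act {a b c d : M.Obj} (f : c ⟶ d) (t : M.T₂.Hom a b c) :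
    N.T₂.act (𝟙 _) (𝟙 _) (F.F.map f) (F.T₂ t) = F.T₂ (M.T₂.act (𝟙 _) (𝟙 _) f t) := by
  rw [F.T₂_natural, F.F.map_id, F.F.map_id]

theorem map₂_post (a b : M.Obj) {d : M.Obj} (h : R.m a b ⟶ d) :
    N.T₂.act (𝟙 _) (𝟙 _) (R.map₂ S F a b ≫ F.F.map h) (S.θ (F.F.obj a) (F.F.obj b)) =
      F.T₂ (M.T₂.act (𝟙 _) (𝟙 _) h (R.θ a b)) := by
  rw [post₂, map₂_spec, map_act]

theorem map₂_natural {a b a' b' : M.Obj} (p : a ⟶ a') (q : b ⟶ b') :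
    S.tensorHom (F.F.map p) (F.F.map q) ≫ R.map₂ S F a' b' =
      R.map₂ S F a b ≫ F.F.map (R.tensorHom p q) := by
  apply S.hom_ext
  rw [map₂_post, tensorHom_post, map₂_spec, tensorHom_spec, F.T₂_natural, F.F.map_id]

theorem map₂_assoc (a b c : M.Obj) :
    S.tensorHom (R.map₂ S F a b) (𝟙 (F.F.obj c)) ≫ R.map₂ S F (R.m a b) c ≫
        F.F.map (R.assoc a b c) =
      S.assoc (F.F.obj a) (F.F.obj b) (F.F.obj c) ≫
        S.tensorHom (𝟙 (F.F.obj a)) (R.map₂ S F b c) ≫ R.map₂ S F a (R.m b c) := by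
  apply S.hom_ext_assoc
  rw [tensorHom_post, map₂_post, N.sub22₁_dinatural, map₂_spec, ← F.map_sub22₁, assoc_spec,
    assoc_post, tensorHom_post, map₂_spec, N.sub22₂_dinatural, map₂_spec, F.map_sub22₂]

theorem map₂_leftUnit (a : M.Obj) :
    S.tensorHom (R.map₀ S F) (𝟙 (F.F.obj a)) ≫ R.map₂ S F R.i a ≫ F.F.map (R.leftUnit a) =
      S.leftUnit (F.F.obj a) := by
  apply S.hom_ext
  apply S.hom_ext₁
  rw [leftUnit_spec, tensorHom_post, map₂_post, N.sub20₁_dinatural, map₀_spec, ← F.map_sub20₁,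
    leftUnit_spec, F.map_j₁, F.F.map_id]

theorem map₂_rightUnit (a : M.Obj) :
    S.rightUnit (F.F.obj a) ≫ S.tensorHom (𝟙 (F.F.obj a)) (R.map₀ S F) ≫ R.map₂ S F a R.i =
      F.F.map (R.rightUnit a) := by
  rw [rightUnit_post, tensorHom_post, map₂_spec, N.sub20₂_dinatural, map₀_spec, rightUnit,
    F.map_sub20₂]

/-- The lax monoidal functor associated with a morphism of left representable short skew
multicategories. -/
def toLaxMonoidalFunctor : LaxMonoidalFunctor R.toSkewMonoidal S.toSkewMonoidal where
  F := F.F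
  f₀ := R.map₀ S F
  f₂ := R.map₂ S F
  f₂_natural := R.map₂_natural S F
  map_assoc := R.map₂_assoc S F
  map_leftUnit := R.map₂_leftUnit S F
  map_rightUnit := R.map₂_rightUnit S F

theorem map₂_id (a b : M.Obj) :
    R.map₂ R (ShortSkewMultifunctor.id M) a b = 𝟙 (R.m a b) :=
  R.hom_ext (R.map₂_spec R (ShortSkewMultifunctor.id M) a b |>.trans (M.T₂.act_id _).symm)

theorem map₀_id : R.map₀ R (ShortSkewMultifunctor.id M) = 𝟙 R.i :=
  R.hom_ext₀ (R.map₀_spec R (ShortSkewMultifunctor.id M) |>.trans (M.L₀.act_id _).symm)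

variable {P : ShortSkewMulticategory.{v, u}} (T : LeftRepresentation P)
  (G : ShortSkewMultifunctor N P)

theorem map₂_comp (a b : M.Obj) : R.map₂ T (F.comp G) a b =
    S.map₂ T G (F.F.obj a) (F.F.obj b) ≫ G.F.map (R.map₂ S F a b) := by
  apply T.hom_ext
  exact (R.map₂_spec T (F.comp G) a b).trans
    ((S.map₂_post T G _ _ (R.map₂ S F a b)).trans (congrArg G.T₂ (R.map₂_spec S F a b))).symm

theorem map₀_comp : R.map₀ T (F.comp G) = S.map₀ T G ≫ G.F.map (R.map₀ S F) := by
  apply T.hom_ext₀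
  refine (R.map₀_spec T (F.comp G)).trans (Eq.symm ?_)
  refine (P.L₀.act_comp (S.map₀ T G) (G.F.map (R.map₀ S F)) T.w).symm.trans ?_
  rw [map₀_spec, ← G.L₀_natural, map₀_spec]
  rfl

end Functoriality

end LeftRepresentation

/-- The functor from left representable short skew multicategories to skew monoidal categories and
lax monoidal functors. -/
def toSkewMonoidalFunctor :
    IsLeftRepresentableShort.{v, u}.FullSubcategory ⥤ SkewMonoidalCategory.{v, u} where
  obj M := (LeftRepresentation.choose M.property).toSkewMonoidal
  map {M N} F := LeftRepresentation.toLaxMonoidalFunctor (LeftRepresentation.choose M.property)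
    (LeftRepresentation.choose N.property) F.hom
  map_id _ := LaxMonoidalFunctor.ext rfl
    (heq_of_eq (LeftRepresentation.map₀_id _))
    (heq_of_eq (funext fun a => funext fun b => LeftRepresentation.map₂_id _ a b))
  map_comp _ _ := LaxMonoidalFunctor.ext rfl
    (heq_of_eq (LeftRepresentation.map₀_comp _ _ _ _ _))
    (heq_of_eq (funext fun a => funext fun b => LeftRepresentation.map₂_comp _ _ _ _ _ a b))

/-! ### Skew multicategories -/

/-- The type of a multimap: tight or loose. -/
inductive Tightness
  | tight
  | loose

namespace Tightness

/-- The type `x ∘ᵢ y` of a substitution `g ∘ᵢ f`, where `l` is the list of the inputs of `g` before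
the `i`-th one: it is tight if `g` is tight and either `f` is tight or `i` is not the first
position, and it is loose otherwise. -/
def comp {α : Type u} : Tightness → List α → Tightness → Tightness
  | tight, [], y => y
  | tight, _ :: _, _ => tight
  | loose, _, _ => loose

/-- The order in which tight is below loose. -/
def Le (x y : Tightness) : Prop := x = loose → y = loose

/-- The map from multimaps of type `x` to multimaps of type `y`, for `x` below `y`, induced by a
comparison `j` from tight to loose multimaps: it is `j` from tight to loose and the identity
otherwise. -/
def lift {H : Tightness → Type v} (j : H tight → H loose) : ∀ {x y : Tightness}, x.Le y → H x → H y
  | tight, tight, _, f => f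
  | tight, loose, _, f => j f
  | loose, loose, _, f => f
  | loose, tight, h, _ => nomatch h rfl

theorem comp_tight {α : Type u} (x : Tightness) (l : List α) : x.comp l tight = x := by
  cases x <;> cases l <;> rfl

theorem comp_map {α β : Type u} (x : Tightness) (l : List α) (φ : α → β) (y : Tightness) :
    x.comp (l.map φ) y = x.comp l y := by
  cases x <;> cases l <;> rfl

end Tightness

/-- A skew multicategory.

The multimaps with list of inputs `as` and output `b` form the sets `Hom tight as b` and
`Hom loose as b`; all nullary maps are loose. For a multimap `g` whose list of inputs is
`l ++ b :: r` and a multimap `f : as → b`, the multimap `sub l r _ _ _ g f` is the substitution of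
`f` into `g` in the position of the displayed `b`; its list of inputs is `l ++ as ++ r`. So that no
transport along equalities of lists is needed, `sub` accepts any lists and any type provably equal
to the required ones. -/
structure SkewMulticategory where
  Obj : Type u
  Hom : Tightness → List Obj → Obj → Type v
  isEmpty_tight_nil : ∀ b : Obj, IsEmpty (Hom .tight [] b)
  id : ∀ a : Obj, Hom .tight [a] a
  j : ∀ {as : List Obj} {b : Obj}, Hom .tight as b → Hom .loose as b
  sub : ∀ {x y z : Tightness} {as bs cs : List Obj} {b c : Obj} (l r : List Obj),
    z = x.comp l y → bs = l ++ b :: r → cs = l ++ as ++ r →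
      Hom x bs c → Hom y as b → Hom z cs c
  /-- Substitution commutes with viewing tight multimaps as loose. -/
  sub_lift : ∀ {x x' y y' z z' : Tightness} {as bs cs : List Obj} {b c : Obj} (l r : List Obj)
    (hx : x.Le x') (hy : y.Le y') (hz : z.Le z') (e : z = x.comp l y) (e' : z' = x'.comp l y')
    (hb : bs = l ++ b :: r) (hc : cs = l ++ as ++ r) (g : Hom x bs c) (f : Hom y as b),
    sub l r e' hb hc (Tightness.lift (H := fun t => Hom t bs c) j hx g)
        (Tightness.lift (H := fun t => Hom t as b) j hy f) =
      Tightness.lift (H := fun t => Hom t cs c) j hz (sub l r e hb hc g f)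
  /-- Left unit law. -/
  id_sub : ∀ {x : Tightness} {as : List Obj} {b : Obj} (hz : x = Tightness.comp .tight [] x)
    (hb : [b] = [] ++ b :: []) (hc : as = [] ++ as ++ []) (f : Hom x as b),
    sub [] [] hz hb hc (id b) f = f
  /-- Right unit law. -/
  sub_id : ∀ {x : Tightness} {bs : List Obj} {b c : Obj} (l r : List Obj) (hz : x = x.comp l .tight)
    (hb : bs = l ++ b :: r) (hc : bs = l ++ [b] ++ r) (g : Hom x bs c),
    sub l r hz hb hc g (id b) = g
  /-- Associativity of nested substitutions. -/
  sub_assoc : ∀ {x y z xy yz w : Tightness} {as bs cs ds es fs : List Obj} {a b c : Obj}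
    (l₁ r₁ l₂ r₂ : List Obj) (e₁ : xy = x.comp l₁ y) (e₂ : w = xy.comp (l₁ ++ l₂) z)
    (e₃ : yz = y.comp l₂ z) (e₄ : w = x.comp l₁ yz) (hcs : cs = l₁ ++ b :: r₁)
    (hbs : bs = l₂ ++ a :: r₂) (hds : ds = l₁ ++ bs ++ r₁)
    (hds' : ds = (l₁ ++ l₂) ++ a :: (r₂ ++ r₁)) (hes : es = l₂ ++ as ++ r₂)
    (hfs : fs = l₁ ++ es ++ r₁) (hfs' : fs = (l₁ ++ l₂) ++ as ++ (r₂ ++ r₁))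
    (h : Hom x cs c) (g : Hom y bs b) (f : Hom z as a),
    sub l₁ r₁ e₄ hcs hfs h (sub l₂ r₂ e₃ hbs hes g f) =
      sub (l₁ ++ l₂) (r₂ ++ r₁) e₂ hds' hfs' (sub l₁ r₁ e₁ hcs hds h g) f
  /-- Commutativity of substitutions into two different positions. -/
  sub_comm : ∀ {x y z xy xz w : Tightness} {as bs cs ds es fs : List Obj} {a b c : Obj}
    (l m r : List Obj) (e₁ : xy = x.comp l y) (e₂ : w = xy.comp (l ++ as ++ m) z)
    (e₃ : xz = x.comp (l ++ a :: m) z) (e₄ : w = xz.comp l y)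
    (hcs : cs = l ++ a :: (m ++ b :: r)) (hds : ds = l ++ as ++ (m ++ b :: r))
    (hds' : ds = (l ++ as ++ m) ++ b :: r) (hfs : fs = (l ++ as ++ m) ++ bs ++ r)
    (hcs' : cs = (l ++ a :: m) ++ b :: r) (hes : es = (l ++ a :: m) ++ bs ++ r)
    (hes' : es = l ++ a :: (m ++ bs ++ r)) (hfs' : fs = l ++ as ++ (m ++ bs ++ r))
    (h : Hom x cs c) (g : Hom y as a) (f : Hom z bs b),
    sub (l ++ as ++ m) r e₂ hds' hfs (sub l (m ++ b :: r) e₁ hcs hds h g) f =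
      sub l (m ++ bs ++ r) e₄ hes' hfs' (sub (l ++ a :: m) r e₃ hcs' hes h f) g

/-- A skew multifunctor. -/
@[ext]
structure SkewMultifunctor (C D : SkewMulticategory.{v, u}) where
  obj : C.Obj → D.Obj
  map : ∀ {x : Tightness} {as : List C.Obj} {b : C.Obj},
    C.Hom x as b → D.Hom x (as.map obj) (obj b)
  map_id : ∀ a : C.Obj, map (C.id a) = D.id (obj a)
  map_j : ∀ {as : List C.Obj} {b : C.Obj} (f : C.Hom .tight as b), map (C.j f) = D.j (map f)
  map_sub : ∀ {x y z : Tightness} {as bs cs : List C.Obj} {b c : C.Obj} (l r : List C.Obj)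
    (hz : z = x.comp l y) (hb : bs = l ++ b :: r) (hc : cs = l ++ as ++ r)
    (hz' : z = x.comp (l.map obj) y) (hb' : bs.map obj = l.map obj ++ obj b :: r.map obj)
    (hc' : cs.map obj = l.map obj ++ as.map obj ++ r.map obj)
    (g : C.Hom x bs c) (f : C.Hom y as b),
    map (C.sub l r hz hb hc g f) = D.sub (l.map obj) (r.map obj) hz' hb' hc' (map g) (map f)

namespace SkewMulticategory

variable (C : SkewMulticategory.{v, u})

/-- Transport of multimaps along an equality of lists of inputs. -/
def castHom {x : Tightness} {as bs : List C.Obj} {b : C.Obj} (h : as = bs) (f : C.Hom x as b) :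
    C.Hom x bs b := h ▸ f

end SkewMulticategory

namespace SkewMultifunctor

/-- The identity skew multifunctor. -/
def id (C : SkewMulticategory.{v, u}) : SkewMultifunctor C C where
  obj a := a
  map f := C.castHom (List.map_id _).symm f
  map_id _ := rfl
  map_j {as b} f := by
    have key : ∀ (bs : List C.Obj) (h : as = bs), C.castHom h (C.j f) = C.j (C.castHom h f) := by
      rintro _ rfl; rfl
    exact key _ _
  map_sub {x y z as bs cs b c} l r hz hb hc hz' hb' hc' g f := by
    have key : ∀ (l' r' as' bs' cs' : List C.Obj) (_ : l = l') (_ : r = r') (ha : as = as')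
        (hbs : bs = bs') (hcs : cs = cs') (hz' : z = x.comp l' y) (hb' : bs' = l' ++ b :: r')
        (hc' : cs' = l' ++ as' ++ r'),
        C.castHom hcs (C.sub l r hz hb hc g f) =
          C.sub l' r' hz' hb' hc' (C.castHom hbs g) (C.castHom ha f) := by
      rintro _ _ _ _ _ rfl rfl rfl rfl rfl _ _ _; rfl
    exact key _ _ _ _ _ (List.map_id _).symm (List.map_id _).symm _ _ _ hz' hb' hc'

theorem map_castHom {C D : SkewMulticategory.{v, u}} (S : SkewMultifunctor C D) {x : Tightness}
    {as bs : List C.Obj} {b : C.Obj} (h : as = bs) (f : C.Hom x as b) :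
    S.map (C.castHom h f) = D.castHom (congrArg (List.map S.obj) h) (S.map f) := by
  subst h; rfl

/-- Composition of skew multifunctors. -/
def comp {C D E : SkewMulticategory.{v, u}} (S : SkewMultifunctor C D) (T : SkewMultifunctor D E) :
    SkewMultifunctor C E where
  obj a := T.obj (S.obj a)
  map f := E.castHom List.map_map (T.map (S.map f))
  map_id a := by rw [S.map_id]; exact T.map_id _
  map_j {as b} f := by
    rw [S.map_j, T.map_j]
    have key : ∀ (as bs : List E.Obj) (b : E.Obj) (f : E.Hom .tight as b) (h : as = bs),
        E.castHom h (E.j f) = E.j (E.castHom h f) := by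
      rintro _ _ _ _ rfl; rfl
    exact key _ _ _ _ _
  map_sub {x y z as bs cs b c} l r hz hb hc hz' hb' hc' g f := by
    have key : ∀ (l r as bs cs l' r' as' bs' cs' : List E.Obj) (b c : E.Obj) (_ : l = l')
        (_ : r = r') (ha : as = as')
        (hbs : bs = bs') (hcs : cs = cs') (hz : z = x.comp l y) (hb : bs = l ++ b :: r)
        (hc : cs = l ++ as ++ r) (hz' : z = x.comp l' y) (hb' : bs' = l' ++ b :: r')
        (hc' : cs' = l' ++ as' ++ r') (g : E.Hom x bs c) (f : E.Hom y as b),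
        E.castHom hcs (E.sub l r hz hb hc g f) =
          E.sub l' r' hz' hb' hc' (E.castHom hbs g) (E.castHom ha f) := by
      rintro _ _ _ _ _ _ _ _ _ _ _ _ rfl rfl rfl rfl rfl _ _ _ _ _ _ _ _; rfl
    have e : z = x.comp (l.map S.obj) y := by rw [Tightness.comp_map]; exact hz
    rw [S.map_sub l r hz hb hc e (by simp [hb]) (by simp [hc]) g f,
      T.map_sub _ _ e (by simp [hb]) (by simp [hc]) (by rw [Tightness.comp_map]; exact e)
        (by simp [hb]) (by simp [hc]) (S.map g) (S.map f)]
    exact key _ _ _ _ _ _ _ _ _ _ _ _ List.map_map List.map_map _ _ _ _ _ _ hz' hb' hc' _ _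

end SkewMultifunctor

theorem SkewMultifunctor.ext_of_map {C D : SkewMulticategory.{v, u}} {S T : SkewMultifunctor C D}
    (h : S.obj = T.obj)
    (h' : ∀ {x : Tightness} {as : List C.Obj} {b : C.Obj} (f : C.Hom x as b),
      HEq (S.map f) (T.map f)) : S = T := by
  obtain ⟨o, m, _, _, _⟩ := S
  obtain ⟨o', m', _, _, _⟩ := T
  dsimp only at h h'
  subst h
  have : @m = @m' := by
    funext x as b f
    exact eq_of_heq (h' f)
  subst this
  rfl

theorem SkewMulticategory.castHom_heq (C : SkewMulticategory.{v, u}) {x : Tightness}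
    {as bs : List C.Obj} {b : C.Obj} (h : as = bs) (f : C.Hom x as b) :
    HEq (C.castHom h f) f := by
  subst h; rfl

/-- The category of skew multicategories and skew multifunctors. -/
instance : Category SkewMulticategory.{v, u} where
  Hom := SkewMultifunctor
  id := SkewMultifunctor.id
  comp := SkewMultifunctor.comp
  id_comp {C D} S := SkewMultifunctor.ext_of_map rfl fun f =>
    (D.castHom_heq _ _).trans ((heq_of_eq (S.map_castHom _ f)).trans (D.castHom_heq _ _))
  comp_id {C D} S := SkewMultifunctor.ext_of_map rfl fun f =>
    (D.castHom_heq _ _).trans (D.castHom_heq _ _)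
  assoc {B C D E} S T U := SkewMultifunctor.ext_of_map rfl fun f =>
    (E.castHom_heq _ _).trans ((heq_of_eq (U.map_castHom _ _)).trans
      ((E.castHom_heq _ _).trans ((E.castHom_heq _ _).trans (E.castHom_heq _ _)).symm))

/-- A multimap `θ : as → m` is left universal if `- ∘₁ θ` is a bijection from the tight multimaps
with inputs `m, r` to the multimaps, of the type of `θ`, with inputs `as, r`. For empty `r` this
says that `θ` is a multimap classifier. -/
def SkewMulticategory.IsLeftUniversal (C : SkewMulticategory.{v, u}) {x : Tightness}
    {as : List C.Obj} {m : C.Obj} (θ : C.Hom x as m) : Prop :=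
  ∀ (r : List C.Obj) (b : C.Obj), Function.Bijective
    (fun g : C.Hom .tight (m :: r) b => (C.sub [] r rfl rfl rfl g θ : C.Hom x (as ++ r) b))

/-- A skew multicategory is left representable if it admits left universal tight classifiers of all
positive arities and left universal loose classifiers of all arities. -/
def IsLeftRepresentable : ObjectProperty SkewMulticategory.{v, u} := fun C =>
  ∀ (x : Tightness) (as : List C.Obj), (x = .tight → as ≠ []) →
    ∃ (m : C.Obj) (θ : C.Hom x as m), C.IsLeftUniversal θ

/-! ### The forgetful functor from skew multicategories to short skew multicategories -/

namespace SkewMulticategory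

variable (C : SkewMulticategory.{v, u})

/-- Associativity, with the positions given up to equality. -/
theorem sub_assoc' {x y z xy yz w : Tightness} {as bs cs ds es fs : List C.Obj} {a b c : C.Obj}
    {l₁ r₁ l₂ r₂ l r : List C.Obj} (hl : l = l₁ ++ l₂) (hr : r = r₂ ++ r₁)
    (e₁ : xy = x.comp l₁ y) (e₂ : w = xy.comp l z)
    (e₃ : yz = y.comp l₂ z) (e₄ : w = x.comp l₁ yz) (hcs : cs = l₁ ++ b :: r₁)
    (hbs : bs = l₂ ++ a :: r₂) (hds : ds = l₁ ++ bs ++ r₁)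
    (hds' : ds = l ++ a :: r) (hes : es = l₂ ++ as ++ r₂)
    (hfs : fs = l₁ ++ es ++ r₁) (hfs' : fs = l ++ as ++ r)
    (h : C.Hom x cs c) (g : C.Hom y bs b) (f : C.Hom z as a) :
    C.sub l₁ r₁ e₄ hcs hfs h (C.sub l₂ r₂ e₃ hbs hes g f) =
      C.sub l r e₂ hds' hfs' (C.sub l₁ r₁ e₁ hcs hds h g) f := by
  subst hl hr
  exact C.sub_assoc _ _ _ _ _ _ _ _ _ _ _ _ _ _ _ _ _ _

/-- The underlying category, whose morphisms are the tight unary maps. -/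
instance : Category.{v} C.Obj where
  Hom a b := C.Hom .tight [a] b
  id a := C.id a
  comp f g := C.sub [] [] rfl rfl rfl g f
  id_comp f := C.sub_id _ _ _ _ _ _
  comp_id f := C.id_sub _ _ _ _
  assoc f g h := C.sub_assoc [] [] [] [] rfl rfl rfl rfl rfl rfl rfl rfl rfl rfl rfl h g f

/-- Postcomposition with a tight unary map. -/
def post {x : Tightness} {as : List C.Obj} {b b' : C.Obj} (q : b ⟶ b') (g : C.Hom x as b) :
    C.Hom x as b' := C.sub [] [] rfl rfl (by simp) q g

/-- Precomposition with a tight unary map, in one position. -/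
def pre {x : Tightness} {as as' : List C.Obj} {a a' c : C.Obj} (l r : List C.Obj)
    (h : as = l ++ a :: r) (h' : as' = l ++ a' :: r) (p : a' ⟶ a) (g : C.Hom x as c) :
    C.Hom x as' c := C.sub l r (x.comp_tight l).symm h (by simp [h']) g p

theorem post_id {x : Tightness} {as : List C.Obj} {b : C.Obj} (g : C.Hom x as b) :
    C.post (𝟙 b) g = g := C.id_sub _ _ _ _

theorem pre_id {x : Tightness} {as : List C.Obj} {a c : C.Obj} (l r : List C.Obj)
    (h h' : as = l ++ a :: r) (g : C.Hom x as c) : C.pre l r h h' (𝟙 a) g = g :=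
  C.sub_id _ _ _ _ _ _

theorem post_post {x : Tightness} {as : List C.Obj} {b b' b'' : C.Obj} (q : b ⟶ b')
    (q' : b' ⟶ b'') (g : C.Hom x as b) : C.post q' (C.post q g) = C.post (q ≫ q') g :=
  C.sub_assoc [] [] [] [] rfl rfl rfl rfl rfl rfl rfl rfl _ _ _ q' q g

theorem post_sub {x y z : Tightness} {as bs cs : List C.Obj} {b c c' : C.Obj} (l r : List C.Obj)
    (hz : z = x.comp l y) (hb : bs = l ++ b :: r) (hc : cs = l ++ as ++ r) (h : c ⟶ c')
    (g : C.Hom x bs c) (f : C.Hom y as b) :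
    C.post h (C.sub l r hz hb hc g f) = C.sub l r hz hb hc (C.post h g) f :=
  C.sub_assoc' (by simp) (by simp) _ _ _ _ _ _ _ _ _ _ _ _ _ _

theorem post_pre {x : Tightness} {as as' : List C.Obj} {a a' c c' : C.Obj} (l r : List C.Obj)
    (h : as = l ++ a :: r) (h' : as' = l ++ a' :: r) (p : a' ⟶ a) (q : c ⟶ c')
    (g : C.Hom x as c) : C.post q (C.pre l r h h' p g) = C.pre l r h h' p (C.post q g) :=
  C.post_sub _ _ _ _ _ _ _ _

theorem sub_pre_same {x y z : Tightness} {as bs bs' cs : List C.Obj} {b b' c : C.Obj}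
    (l r : List C.Obj) (hz : z = x.comp l y) (hb : bs = l ++ b :: r) (hb' : bs' = l ++ b' :: r)
    (hc : cs = l ++ as ++ r) (k : b ⟶ b') (g : C.Hom x bs' c) (f : C.Hom y as b) :
    C.sub l r hz hb hc (C.pre l r hb' hb k g) f = C.sub l r hz hb' hc g (C.post k f) :=
  (C.sub_assoc' (by simp) (by simp) _ _ _ _ _ _ _ _ _ _ _ _ _ _).symm

theorem pre_sub_inner {x y z : Tightness} {as as' bs cs cs' : List C.Obj} {a a' b c : C.Obj}
    {l r l₂ r₂ L R : List C.Obj} (hL : L = l ++ l₂) (hR : R = r₂ ++ r)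
    (hz : z = x.comp l y) (hb : bs = l ++ b :: r) (hc : cs = l ++ as ++ r)
    (hc' : cs' = l ++ as' ++ r) (h : cs = L ++ a :: R) (h' : cs' = L ++ a' :: R)
    (ha : as = l₂ ++ a :: r₂) (ha' : as' = l₂ ++ a' :: r₂) (p : a' ⟶ a)
    (g : C.Hom x bs c) (f : C.Hom y as b) :
    C.pre L R h h' p (C.sub l r hz hb hc g f) =
      C.sub l r hz hb hc' g (C.pre l₂ r₂ ha ha' p f) :=
  (C.sub_assoc' hL hR _ _ _ _ _ _ _ _ _ _ _ _ _ _).symm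

theorem pre_sub_right {x y z : Tightness} {as bs bs' cs cs' : List C.Obj} {a b b' c : C.Obj}
    (l m r : List C.Obj) (hz : z = x.comp l y) (hb : bs = l ++ a :: (m ++ b :: r))
    (hc : cs = l ++ as ++ (m ++ b :: r)) (h : cs = (l ++ as ++ m) ++ b :: r)
    (h' : cs' = (l ++ as ++ m) ++ b' :: r) (hb₁ : bs = (l ++ a :: m) ++ b :: r)
    (hb₂ : bs' = (l ++ a :: m) ++ b' :: r)
    (hb' : bs' = l ++ a :: (m ++ b' :: r)) (hc' : cs' = l ++ as ++ (m ++ b' :: r)) (p : b' ⟶ b)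
    (g : C.Hom x bs c) (f : C.Hom y as a) :
    C.pre (l ++ as ++ m) r h h' p (C.sub l (m ++ b :: r) hz hb hc g f) =
      C.sub l (m ++ b' :: r) hz hb' hc' (C.pre (l ++ a :: m) r hb₁ hb₂ p g) f := by
  have e : m ++ [b'] ++ r = m ++ b' :: r := by simp
  have := C.sub_comm l m r hz (Tightness.comp_tight z _).symm (Tightness.comp_tight x _).symm hz
    hb hc h (fs := cs') (by simp [h']) hb₁ (es := bs') (by simp [hb₂]) (by simp [hb₂]) (by simp [h'])
    g f p
  refine this.trans ?_
  have key : ∀ (R : List C.Obj) (hR : R = m ++ b' :: r) (h₁ : bs' = l ++ a :: R)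
      (h₂ : cs' = l ++ as ++ R) (g' : C.Hom x bs' c), C.sub l R hz h₁ h₂ g' f =
      C.sub l (m ++ b' :: r) hz hb' hc' g' f := by
    rintro _ rfl _ _ _; rfl
  exact key _ e _ _ _

theorem pre_sub_left {x y z : Tightness} {as bs bs' cs cs' : List C.Obj} {a b b' c : C.Obj}
    (l m r : List C.Obj) (hz : z = x.comp (l ++ b :: m) y) (hz' : z = x.comp (l ++ b' :: m) y)
    (hb : bs = (l ++ b :: m) ++ a :: r)
    (hc : cs = (l ++ b :: m) ++ as ++ r) (h : cs = l ++ b :: (m ++ as ++ r))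
    (h' : cs' = l ++ b' :: (m ++ as ++ r)) (hb₁ : bs = l ++ b :: (m ++ a :: r))
    (hb₂ : bs' = l ++ b' :: (m ++ a :: r)) (hb' : bs' = (l ++ b' :: m) ++ a :: r)
    (hc' : cs' = (l ++ b' :: m) ++ as ++ r) (p : b' ⟶ b)
    (g : C.Hom x bs c) (f : C.Hom y as a) :
    C.pre l (m ++ as ++ r) h h' p (C.sub (l ++ b :: m) r hz hb hc g f) =
      C.sub (l ++ b' :: m) r hz' hb' hc' (C.pre l (m ++ a :: r) hb₁ hb₂ p g) f := by
  have e : l ++ [b'] ++ m = l ++ b' :: m := by simp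
  have key : ∀ (L : List C.Obj) (hL : L = l ++ b' :: m) (h₀ : z = x.comp L y)
      (h₁ : bs' = L ++ a :: r)
      (h₂ : cs' = L ++ as ++ r) (g' : C.Hom x bs' c), C.sub L r h₀ h₁ h₂ g' f =
      C.sub (l ++ b' :: m) r hz' hb' hc' g' f := by
    rintro _ rfl _ _ _ _; rfl
  refine Eq.trans ?_ (key _ e (by rw [e]; exact hz') (by rw [e]; exact hb')
    (by rw [e]; exact hc') _)
  exact (C.sub_comm l m r (Tightness.comp_tight x _).symm (by rw [e]; exact hz') hz
    (Tightness.comp_tight z _).symm hb₁ (by simp [hb₂]) (by simp [hb₂]) (by simp [h']) hb hc h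
    (by simp [h']) g p f).symm

theorem pre_sub_right' {x y z : Tightness} {as bs bs' cs cs' : List C.Obj} {a b b' c : C.Obj}
    (l m r : List C.Obj) {M N R R' : List C.Obj} (hM : M = l ++ as ++ m) (hN : N = l ++ a :: m)
    (hR : R = m ++ b :: r) (hR' : R' = m ++ b' :: r) (hz : z = x.comp l y) (hb : bs = l ++ a :: R)
    (hc : cs = l ++ as ++ R) (h : cs = M ++ b :: r) (h' : cs' = M ++ b' :: r)
    (hb₁ : bs = N ++ b :: r) (hb₂ : bs' = N ++ b' :: r) (hb' : bs' = l ++ a :: R')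
    (hc' : cs' = l ++ as ++ R') (p : b' ⟶ b) (g : C.Hom x bs c) (f : C.Hom y as a) :
    C.pre M r h h' p (C.sub l R hz hb hc g f) =
      C.sub l R' hz hb' hc' (C.pre N r hb₁ hb₂ p g) f := by
  subst hM hN hR hR'
  exact C.pre_sub_right _ _ _ _ _ _ _ _ _ _ _ _ _ _ _

theorem pre_sub_left' {x y z : Tightness} {as bs bs' cs cs' : List C.Obj} {a b b' c : C.Obj}
    (l m r : List C.Obj) {L L' R : List C.Obj} (hL : L = l ++ b :: m) (hL' : L' = l ++ b' :: m)
    (hR : R = m ++ as ++ r) (hz : z = x.comp L y) (hz' : z = x.comp L' y)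
    (hb : bs = L ++ a :: r) (hc : cs = L ++ as ++ r) (h : cs = l ++ b :: R)
    (h' : cs' = l ++ b' :: R) (hb₁ : bs = l ++ b :: (m ++ a :: r))
    (hb₂ : bs' = l ++ b' :: (m ++ a :: r)) (hb' : bs' = L' ++ a :: r)
    (hc' : cs' = L' ++ as ++ r) (p : b' ⟶ b) (g : C.Hom x bs c) (f : C.Hom y as a) :
    C.pre l R h h' p (C.sub L r hz hb hc g f) =
      C.sub L' r hz' hb' hc' (C.pre l (m ++ a :: r) hb₁ hb₂ p g) f := by
  subst hL hL' hR
  exact C.pre_sub_left _ _ _ _ _ _ _ _ _ _ _ _ _ _ _ _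

/-- A list of tight unary maps. -/
inductive HomList : List C.Obj → List C.Obj → Type (max u v)
  | nil : HomList [] []
  | cons {a' a : C.Obj} {as' as : List C.Obj} (p : a' ⟶ a) (ps : HomList as' as) :
      HomList (a' :: as') (a :: as)

variable {C}

theorem comp_of_length {x y : Tightness} {l l' : List C.Obj} (h : l.length = l'.length) :
    x.comp l y = x.comp l' y := by
  cases x <;> cases l <;> cases l' <;> first | rfl | simp at h

/-- Composition of lists of tight unary maps. -/
def HomList.comp : ∀ {as'' as' as : List C.Obj}, C.HomList as'' as' → C.HomList as' as →
    C.HomList as'' as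
  | _, _, _, .nil, .nil => .nil
  | _, _, _, .cons p' ps', .cons p ps => .cons (p' ≫ p) (HomList.comp ps' ps)

variable (C)

/-- Simultaneous precomposition, in consecutive positions, with a list of tight unary maps. -/
def act {x : Tightness} {c : C.Obj} : ∀ {as' as : List C.Obj}, C.HomList as' as →
    ∀ (l r : List C.Obj) {bs bs' : List C.Obj},
      bs = l ++ (as ++ r) → bs' = l ++ (as' ++ r) → C.Hom x bs c → C.Hom x bs' c
  | _, _, .nil, _, _, _, _, h, h', g => C.castHom (h.trans h'.symm) g
  | a' :: _, _ :: as, .cons p ps, l, r, _, _, h, h', g =>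
    act ps (l ++ [a']) r (bs := l ++ a' :: (as ++ r)) (by simp) (by simpa using h')
      (C.pre l (as ++ r) h rfl p g)

theorem post_castHom {x : Tightness} {as bs : List C.Obj} {c d : C.Obj} (q : c ⟶ d) (h : as = bs)
    (g : C.Hom x as c) : C.post q (C.castHom h g) = C.castHom h (C.post q g) := by
  subst h; rfl

theorem pre_pre_same {x : Tightness} {as as' as'' : List C.Obj} {a a' a'' c : C.Obj}
    (l r : List C.Obj) (h : as = l ++ a :: r) (h' : as' = l ++ a' :: r) (h'' : as'' = l ++ a'' :: r)
    (p : a' ⟶ a) (p' : a'' ⟶ a') (g : C.Hom x as c) :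
    C.pre l r h' h'' p' (C.pre l r h h' p g) = C.pre l r h h'' (p' ≫ p) g :=
  C.sub_pre_same _ _ _ _ _ _ _ _ _

/-- Precompositions in different positions commute. -/
theorem pre_pre {x : Tightness} {c a a' b b' : C.Obj} (l m r : List C.Obj)
    {s₁ s₂ s₃ s₄ : List C.Obj} {L R L' R' : List C.Obj} (hL : L = l ++ a :: m)
    (hR : R = m ++ b :: r) (hL' : L' = l ++ a' :: m) (hR' : R' = m ++ b' :: r)
    (h₁ : s₁ = l ++ a :: R) (h₂ : s₂ = l ++ a' :: R) (h₃ : s₂ = L' ++ b :: r)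
    (h₄ : s₃ = L' ++ b' :: r) (k₁ : s₁ = L ++ b :: r) (k₂ : s₄ = L ++ b' :: r)
    (k₃ : s₄ = l ++ a :: R') (k₄ : s₃ = l ++ a' :: R') (p : a' ⟶ a) (q : b' ⟶ b)
    (g : C.Hom x s₁ c) :
    C.pre L' r h₃ h₄ q (C.pre l R h₁ h₂ p g) = C.pre l R' k₃ k₄ p (C.pre L r k₁ k₂ q g) := by
  have e : l ++ [a'] ++ m = L' := by simp [hL']
  have e' : m ++ [b'] ++ r = R' := by simp [hR']
  subst hL hR
  have key : ∀ (L'' R'' : List C.Obj) (_ : L'' = L') (_ : R'' = R') (z₁ z₂)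
      (t₁ : s₂ = L'' ++ b :: r) (t₂ : s₃ = L'' ++ [b'] ++ r) (t₃ : s₄ = l ++ a :: R'')
      (t₄ : s₃ = l ++ [a'] ++ R''),
      C.sub (x := x) (z := x) L'' r z₁ t₁ t₂ (C.pre l (m ++ b :: r) h₁ h₂ p g) q =
        C.sub (x := x) (z := x) l R'' z₂ t₃ t₄ (C.pre (l ++ a :: m) r k₁ k₂ q g) p →
      C.pre L' r h₃ h₄ q (C.pre l (m ++ b :: r) h₁ h₂ p g) =
        C.pre l R' k₃ k₄ p (C.pre (l ++ a :: m) r k₁ k₂ q g) := by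
    rintro _ _ rfl rfl _ _ _ _ _ _ h; exact h
  refine key _ _ e e' (Tightness.comp_tight x _).symm (Tightness.comp_tight x _).symm
    (by simp [h₂]) (by simp [h₄, ← e]) (by simp [k₂]) (by simp [k₄, ← e']) ?_
  exact C.sub_comm l m r (Tightness.comp_tight x _).symm (Tightness.comp_tight x _).symm
    (Tightness.comp_tight x _).symm (Tightness.comp_tight x _).symm _ (by simp [h₂]) _ _ _
    (by simp [k₂]) _ _ g p q

/-- Precomposition commutes with simultaneous precomposition in later positions. -/
theorem act_pre {x : Tightness} {c : C.Obj} {as' as : List C.Obj}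
    (ps : C.HomList as' as) : ∀ (l m r : List C.Obj) {a a' : C.Obj} (p : a' ⟶ a)
    {s₁ s₂ s₃ s₄ : List C.Obj} {L L' R R' : List C.Obj} (hL : L = l ++ a :: m)
    (hL' : L' = l ++ a' :: m) (hR : R = m ++ (as ++ r)) (hR' : R' = m ++ (as' ++ r))
    (h₁ : s₁ = l ++ a :: R) (h₂ : s₂ = l ++ a' :: R) (h₃ : s₂ = L' ++ (as ++ r))
    (h₄ : s₃ = L' ++ (as' ++ r)) (k₁ : s₁ = L ++ (as ++ r)) (k₂ : s₄ = L ++ (as' ++ r))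
    (k₃ : s₄ = l ++ a :: R') (k₄ : s₃ = l ++ a' :: R') (g : C.Hom x s₁ c),
    C.act ps L' r h₃ h₄ (C.pre l R h₁ h₂ p g) = C.pre l R' k₃ k₄ p (C.act ps L r k₁ k₂ g) := by
  induction ps with
  | nil =>
    intro l m r a a' p s₁ s₂ s₃ s₄ L L' R R' hL hL' hR hR' h₁ h₂ h₃ h₄ k₁ k₂ k₃ k₄ g
    obtain rfl : R' = R := hR'.trans hR.symm
    obtain rfl : s₁ = s₄ := k₁.trans k₂.symm
    obtain rfl : s₂ = s₃ := h₃.trans h₄.symm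
    rfl
  | @cons d' d ds' ds q ps ih =>
    intro l m r a a' p s₁ s₂ s₃ s₄ L L' R R' hL hL' hR hR' h₁ h₂ h₃ h₄ k₁ k₂ k₃ k₄ g
    refine Eq.trans (congrArg (C.act ps (L' ++ [d']) r _ _)
      (C.pre_pre l m (ds ++ r) hL hR hL' (R' := m ++ d' :: (ds ++ r)) rfl h₁ h₂ h₃ rfl k₁ rfl
        (by simp [hL]) (by simp [hL']) p q g)) ?_
    exact ih l (m ++ [d']) r p (by simp [hL]) (by simp [hL']) (by simp) (by simp [hR']) _ _ _ _ _
      _ _ _ _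

theorem act_act {x : Tightness} {c : C.Obj} {as' as : List C.Obj} (ps : C.HomList as' as) :
    ∀ {as'' : List C.Obj} (ps' : C.HomList as'' as') (l r : List C.Obj) {bs bs' bs'' : List C.Obj}
    (h : bs = l ++ (as ++ r)) (h' : bs' = l ++ (as' ++ r)) (h'' : bs'' = l ++ (as'' ++ r))
    (g : C.Hom x bs c),
    C.act ps' l r h' h'' (C.act ps l r h h' g) = C.act (ps'.comp ps) l r h h'' g := by
  induction ps with
  | nil =>
    intro as'' ps' l r bs bs' bs'' h h' h'' g
    cases ps'
    subst h h' h''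
    rfl
  | @cons a' a as' as p ps ih =>
    intro as'' ps' l r bs bs' bs'' h h' h'' g
    cases ps' with
    | @cons a'' _ as'' _ p' ps' =>
      refine Eq.trans (congrArg (C.act ps' (l ++ [a'']) r _ _)
        (C.act_pre ps l [] r p' (s₂ := l ++ a'' :: (as ++ r)) rfl rfl rfl rfl rfl rfl
          (by simp) (by simp) (by simp) (by simpa using h') (by simpa using h') rfl
          (C.pre l (as ++ r) h rfl p g)).symm) ?_
      exact (ih ps' _ _ _ _ _ _).trans
        (congrArg (C.act (ps'.comp ps) (l ++ [a'']) r _ _) (C.pre_pre_same _ _ _ _ _ _ _ _))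

/-- Naturality of substitution in the inputs after the position of substitution. -/
theorem act_sub_right {x y z : Tightness} {c b : C.Obj} {as : List C.Obj} {r' r : List C.Obj}
    (ps : C.HomList r' r) : ∀ (l m : List C.Obj) {bs bs' cs cs' M N R R' : List C.Obj}
    (_ : M = l ++ as ++ m) (_ : N = l ++ b :: m) (_ : R = m ++ r) (_ : R' = m ++ r')
    (hz : z = x.comp l y) (hb : bs = l ++ b :: R) (hc : cs = l ++ as ++ R)
    (hb' : bs' = l ++ b :: R') (hc' : cs' = l ++ as ++ R')
    (h₁ : cs = M ++ (r ++ [])) (h₂ : cs' = M ++ (r' ++ [])) (h₃ : bs = N ++ (r ++ []))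
    (h₄ : bs' = N ++ (r' ++ [])) (g : C.Hom x bs c) (f : C.Hom y as b),
    C.act ps M [] h₁ h₂ (C.sub l R hz hb hc g f) =
      C.sub l R' hz hb' hc' (C.act ps N [] h₃ h₄ g) f := by
  induction ps with
  | nil =>
    intro l m bs bs' cs cs' M N R R' hM hN hR hR' hz hb hc hb' hc' h₁ h₂ h₃ h₄ g f
    obtain rfl : R' = R := hR'.trans hR.symm
    obtain rfl : cs = cs' := h₁.trans h₂.symm
    obtain rfl : bs = bs' := h₃.trans h₄.symm
    rfl
  | @cons d' d ds' ds q ps ih =>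
    intro l m bs bs' cs cs' M N R R' hM hN hR hR' hz hb hc hb' hc' h₁ h₂ h₃ h₄ g f
    refine Eq.trans (congrArg (C.act ps (M ++ [d']) [] _ _)
      (C.pre_sub_right' (b := d) (b' := d') (R' := m ++ d' :: ds) l m (ds ++ []) hM hN (by simp [hR]) (by simp)
        hz hb hc (by simpa using h₁) rfl (by simpa using h₃) rfl (by simp [hN]) (by simp [hM])
        q g f)) ?_
    exact ih l (m ++ [d']) (by simp [hM]) (by simp [hN]) (by simp) (by simp [hR'])
      _ _ _ _ _ _ _ _ _ _ _

/-- Naturality of substitution in the inputs of the map substituted. -/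
theorem act_sub_inner {x y z : Tightness} {c b : C.Obj} {s' s : List C.Obj}
    (ps : C.HomList s' s) : ∀ (l r l₂ : List C.Obj) {as as' bs cs cs' L : List C.Obj}
    (_ : L = l ++ l₂)
    (hz : z = x.comp l y) (hb : bs = l ++ b :: r) (hc : cs = l ++ as ++ r)
    (hc' : cs' = l ++ as' ++ r) (h₁ : cs = L ++ (s ++ r)) (h₂ : cs' = L ++ (s' ++ r))
    (h₃ : as = l₂ ++ (s ++ [])) (h₄ : as' = l₂ ++ (s' ++ []))
    (g : C.Hom x bs c) (f : C.Hom y as b),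
    C.act ps L r h₁ h₂ (C.sub l r hz hb hc g f) =
      C.sub l r hz hb hc' g (C.act ps l₂ [] h₃ h₄ f) := by
  induction ps with
  | nil =>
    intro l r l₂ as as' bs cs cs' L hL hz hb hc hc' h₁ h₂ h₃ h₄ g f
    obtain rfl : cs = cs' := h₁.trans h₂.symm
    obtain rfl : as = as' := h₃.trans h₄.symm
    rfl
  | @cons d' d ds' ds q ps ih =>
    intro l r l₂ as as' bs cs cs' L hL hz hb hc hc' h₁ h₂ h₃ h₄ g f
    refine Eq.trans (congrArg (C.act ps (L ++ [d']) r _ _)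
      (C.pre_sub_inner (a := d) (a' := d') (as' := l₂ ++ d' :: (ds ++ [])) hL (r₂ := ds ++ []) (by simp) hz hb hc
        (by simp [hL]) h₁ rfl (by simpa using h₃) rfl q g f)) ?_
    exact ih l r (l₂ ++ [d']) (by simp [hL]) _ _ _ _ _ _ _ _ _ _

/-- Naturality of substitution in the inputs before the position of substitution. -/
theorem act_sub_left {x y z : Tightness} {c b : C.Obj} {as : List C.Obj} {s' s : List C.Obj}
    (ps : C.HomList s' s) : ∀ (l r : List C.Obj) {bs bs' cs cs' L L' R : List C.Obj}
    (_ : L = l ++ s) (_ : L' = l ++ s') (_ : R = as ++ r)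
    (hz : z = x.comp L y) (hz' : z = x.comp L' y) (hb : bs = L ++ b :: r)
    (hc : cs = L ++ as ++ r) (hb' : bs' = L' ++ b :: r) (hc' : cs' = L' ++ as ++ r)
    (h₁ : cs = l ++ (s ++ R)) (h₂ : cs' = l ++ (s' ++ R)) (h₃ : bs = l ++ (s ++ b :: r))
    (h₄ : bs' = l ++ (s' ++ b :: r)) (g : C.Hom x bs c) (f : C.Hom y as b),
    C.act ps l R h₁ h₂ (C.sub L r hz hb hc g f) =
      C.sub L' r hz' hb' hc' (C.act ps l (b :: r) h₃ h₄ g) f := by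
  induction ps with
  | nil =>
    intro l r bs bs' cs cs' L L' R hL hL' hR hz hz' hb hc hb' hc' h₁ h₂ h₃ h₄ g f
    obtain rfl : L' = L := hL'.trans hL.symm
    obtain rfl : cs = cs' := h₁.trans h₂.symm
    obtain rfl : bs = bs' := h₃.trans h₄.symm
    rfl
  | @cons d' d ds' ds q ps ih =>
    intro l r bs bs' cs cs' L L' R hL hL' hR hz hz' hb hc hb' hc' h₁ h₂ h₃ h₄ g f
    have e : z = x.comp (l ++ d' :: ds) y :=
      hz.trans (comp_of_length (by simp [hL]))
    refine Eq.trans (congrArg (C.act ps (l ++ [d']) R _ _)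
      (C.pre_sub_left' l ds r hL rfl (R := ds ++ R) (by simp [hR]) hz e hb hc h₁ rfl h₃ rfl
        (by simp) (by simp [hR]) q g f)) ?_
    exact ih (l ++ [d']) r (by simp) (by simp [hL']) hR _ _ _ _ _ _ _ _ _ _ _ _

end SkewMulticategory

namespace SkewMulticategory

variable (C : SkewMulticategory.{v, u})

/-- Nullary multimaps, with the action of tight unary maps. -/
def multiHom₀ (x : Tightness) : MultiHom₀.{v, u} C.Obj where
  Hom b := C.Hom x [] b
  act q g := C.post q g
  act_id g := C.post_id g
  act_comp q q' g := C.post_post q q' g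

/-- Unary multimaps, with the action of tight unary maps. -/
def multiHom₁ (x : Tightness) : MultiHom₁.{v, u} C.Obj where
  Hom a b := C.Hom x [a] b
  act p q g := C.post q (C.pre [] [] rfl rfl p g)
  act_id g := by rw [pre_id, post_id]
  act_comp p p' q q' g := by
    rw [← post_pre, post_post, pre_pre_same]

/-- Binary multimaps, with the action of tight unary maps. -/
def multiHom₂ (x : Tightness) : MultiHom₂.{v, u} C.Obj where
  Hom a₁ a₂ b := C.Hom x [a₁, a₂] b
  act {_ a₁' a₂ _ _ _} p₁ p₂ q g :=
    C.post q (C.pre [a₁'] [] rfl rfl p₂ (C.pre [] [a₂] rfl rfl p₁ g))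
  act_id g := by rw [pre_id, pre_id, post_id]
  act_comp p₁ p₁' p₂ p₂' q q' g := by
    simp only [← post_pre, post_post]
    exact congrArg _ (C.act_act (.cons p₁ (.cons p₂ .nil)) (.cons p₁' (.cons p₂' .nil)) [] []
      rfl rfl rfl g)

/-- Ternary multimaps, with the action of tight unary maps. -/
def multiHom₃ (x : Tightness) : MultiHom₃.{v, u} C.Obj where
  Hom a₁ a₂ a₃ b := C.Hom x [a₁, a₂, a₃] b
  act {_ a₁' a₂ a₂' a₃ _ _ _} p₁ p₂ p₃ q g :=
    C.post q (C.pre [a₁', a₂'] [] rfl rfl p₃ (C.pre [a₁'] [a₃] rfl rfl p₂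
      (C.pre [] [a₂, a₃] rfl rfl p₁ g)))
  act_id g := by rw [pre_id, pre_id, pre_id, post_id]
  act_comp p₁ p₁' p₂ p₂' p₃ p₃' q q' g := by
    simp only [← post_pre, post_post]
    exact congrArg _ (C.act_act (.cons p₁ (.cons p₂ (.cons p₃ .nil)))
      (.cons p₁' (.cons p₂' (.cons p₃' .nil))) [] [] rfl rfl rfl g)

/-- 4-ary multimaps, with the action of tight unary maps. -/
def multiHom₄ (x : Tightness) : MultiHom₄.{v, u} C.Obj where
  Hom a₁ a₂ a₃ a₄ b := C.Hom x [a₁, a₂, a₃, a₄] b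
  act {_ a₁' a₂ a₂' a₃ a₃' a₄ _ _ _} p₁ p₂ p₃ p₄ q g :=
    C.post q (C.pre [a₁', a₂', a₃'] [] rfl rfl p₄ (C.pre [a₁', a₂'] [a₄] rfl rfl p₃
      (C.pre [a₁'] [a₃, a₄] rfl rfl p₂ (C.pre [] [a₂, a₃, a₄] rfl rfl p₁ g))))
  act_id g := by rw [pre_id, pre_id, pre_id, pre_id, post_id]
  act_comp p₁ p₁' p₂ p₂' p₃ p₃' p₄ p₄' q q' g := by
    simp only [← post_pre, post_post]
    exact congrArg _ (C.act_act (.cons p₁ (.cons p₂ (.cons p₃ (.cons p₄ .nil))))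
      (.cons p₁' (.cons p₂' (.cons p₃' (.cons p₄' .nil)))) [] [] rfl rfl rfl g)

/-- The data of the short skew multicategory underlying a skew multicategory. -/
def toShortData : ShortSkewData.{v, u} where
  Obj := C.Obj
  T₂ := C.multiHom₂ .tight
  T₃ := C.multiHom₃ .tight
  T₄ := C.multiHom₄ .tight
  L₀ := C.multiHom₀ .loose
  L₁ := C.multiHom₁ .loose
  L₂ := C.multiHom₂ .loose
  j₁ f := C.j f
  j₂ f := C.j f
  sub22₁ {_ _ _ b₂ _} g f := C.sub [] [b₂] rfl rfl rfl g f
  sub22₂ {_ _ b₁ _ _} g f := C.sub [b₁] [] rfl rfl rfl g f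
  sub32₁ {_ _ _ b₂ b₃ _} g f := C.sub [] [b₂, b₃] rfl rfl rfl g f
  sub32₂ {_ _ b₁ _ b₃ _} g f := C.sub [b₁] [b₃] rfl rfl rfl g f
  sub32₃ {_ _ b₁ b₂ _ _} g f := C.sub [b₁, b₂] [] rfl rfl rfl g f
  sub23₁ {_ _ _ _ b₂ _} g f := C.sub [] [b₂] rfl rfl rfl g f
  sub23₂ {_ _ _ b₁ _ _} g f := C.sub [b₁] [] rfl rfl rfl g f
  sub20₁ {_ b₂ _} g f := C.sub [] [b₂] rfl rfl rfl g f
  sub20₂ {b₁ _ _} g f := C.sub [b₁] [] rfl rfl rfl g f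
  sub30₁ {_ b₂ b₃ _} g f := C.sub [] [b₂, b₃] rfl rfl rfl g f
  sub30₂ {b₁ _ b₃ _} g f := C.sub [b₁] [b₃] rfl rfl rfl g f
  sub30₃ {b₁ b₂ _ _} g f := C.sub [b₁, b₂] [] rfl rfl rfl g f
  subl0 g f := C.sub [] [] rfl rfl rfl g f
  sub2l₁ {_ _ b₂ _} g f := C.sub [] [b₂] rfl rfl rfl g f
  sub2l₂ {_ b₁ _ _} g f := C.sub [b₁] [] rfl rfl rfl g f
  subl2 g f := C.sub [] [] rfl rfl rfl g f

theorem multiHom₁_post {x : Tightness} {a b b' : C.Obj} (q : b ⟶ b') (f : C.Hom x [a] b) :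
    (C.multiHom₁ x).act (𝟙 a) q f = C.post q f := congrArg _ (C.pre_id _ _ _ _ _)

theorem multiHom₂_post {x : Tightness} {a₁ a₂ b b' : C.Obj} (q : b ⟶ b')
    (f : C.Hom x [a₁, a₂] b) : (C.multiHom₂ x).act (𝟙 a₁) (𝟙 a₂) q f = C.post q f :=
  congrArg _ ((C.pre_id _ _ _ _ _).trans (C.pre_id _ _ _ _ _))

theorem multiHom₃_post {x : Tightness} {a₁ a₂ a₃ b b' : C.Obj} (q : b ⟶ b')
    (f : C.Hom x [a₁, a₂, a₃] b) :
    (C.multiHom₃ x).act (𝟙 a₁) (𝟙 a₂) (𝟙 a₃) q f = C.post q f :=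
  congrArg _ ((C.pre_id _ _ _ _ _).trans ((C.pre_id _ _ _ _ _).trans (C.pre_id _ _ _ _ _)))

theorem multiHom₁_pre {x : Tightness} {a a' b : C.Obj} (p : a' ⟶ a) (f : C.Hom x [a] b) :
    (C.multiHom₁ x).act p (𝟙 b) f = C.pre [] [] rfl rfl p f := C.post_id _

theorem multiHom₂_pre₁ {x : Tightness} {a₁ a₁' a₂ b : C.Obj} (p : a₁' ⟶ a₁)
    (f : C.Hom x [a₁, a₂] b) :
    (C.multiHom₂ x).act p (𝟙 a₂) (𝟙 b) f = C.pre [] [a₂] rfl rfl p f :=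
  (C.post_id _).trans (C.pre_id _ _ _ _ _)

theorem multiHom₂_pre₂ {x : Tightness} {a₁ a₂ a₂' b : C.Obj} (p : a₂' ⟶ a₂)
    (f : C.Hom x [a₁, a₂] b) :
    (C.multiHom₂ x).act (𝟙 a₁) p (𝟙 b) f = C.pre [a₁] [] rfl rfl p f :=
  (C.post_id _).trans (congrArg _ (C.pre_id _ _ _ _ _))

theorem multiHom₃_pre₁ {x : Tightness} {a₁ a₁' a₂ a₃ b : C.Obj} (p : a₁' ⟶ a₁)
    (f : C.Hom x [a₁, a₂, a₃] b) :
    (C.multiHom₃ x).act p (𝟙 a₂) (𝟙 a₃) (𝟙 b) f = C.pre [] [a₂, a₃] rfl rfl p f :=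
  (C.post_id _).trans ((C.pre_id _ _ _ _ _).trans (C.pre_id _ _ _ _ _))

theorem multiHom₃_pre₂ {x : Tightness} {a₁ a₂ a₂' a₃ b : C.Obj} (p : a₂' ⟶ a₂)
    (f : C.Hom x [a₁, a₂, a₃] b) :
    (C.multiHom₃ x).act (𝟙 a₁) p (𝟙 a₃) (𝟙 b) f = C.pre [a₁] [a₃] rfl rfl p f :=
  (C.post_id _).trans ((C.pre_id _ _ _ _ _).trans (congrArg _ (C.pre_id _ _ _ _ _)))

theorem multiHom₃_pre₃ {x : Tightness} {a₁ a₂ a₃ a₃' b : C.Obj} (p : a₃' ⟶ a₃)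
    (f : C.Hom x [a₁, a₂, a₃] b) :
    (C.multiHom₃ x).act (𝟙 a₁) (𝟙 a₂) p (𝟙 b) f = C.pre [a₁, a₂] [] rfl rfl p f :=
  (C.post_id _).trans (congrArg _ ((C.pre_id _ _ _ _ _).trans (C.pre_id _ _ _ _ _)))

theorem act_cons_id {x : Tightness} {a c : C.Obj} {as' as : List C.Obj} (ps : C.HomList as' as)
    (l r : List C.Obj) {bs bs' : List C.Obj} (h : bs = l ++ (a :: as ++ r))
    (h' : bs' = l ++ (a :: as' ++ r)) (h₁ : bs = (l ++ [a]) ++ (as ++ r))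
    (h₂ : bs' = (l ++ [a]) ++ (as' ++ r)) (g : C.Hom x bs c) :
    C.act (.cons (𝟙 a) ps) l r h h' g = C.act ps (l ++ [a]) r h₁ h₂ g := by
  subst h
  exact congrArg (C.act ps (l ++ [a]) r _ _) (C.pre_id _ _ _ _ _)

/-- Naturality of substitution in all inputs and in the output. -/
theorem sub_natural {x y z : Tightness} {l l' as as' r r' : List C.Obj} {b c c' : C.Obj}
    (psl : C.HomList l' l) (psa : C.HomList as' as) (psr : C.HomList r' r) (h : c ⟶ c')
    {bs bs₁ bs₂ cs cs₁ cs₂ cs₃ M R : List C.Obj} (hM : M = l' ++ as') (hR : R = as ++ r)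
    (hz : z = x.comp l y)
    (hz' : z = x.comp l' y) (hb : bs = l ++ b :: r) (hc : cs = l ++ as ++ r)
    (i₀ : cs = [] ++ (l ++ R)) (i₁ : cs₁ = [] ++ (l' ++ R))
    (i₁' : cs₁ = l' ++ (as ++ r)) (i₂ : cs₂ = l' ++ (as' ++ r))
    (i₃ : cs₂ = M ++ (r ++ [])) (i₄ : cs₃ = M ++ (r' ++ []))
    (k₀ : bs = [] ++ (l ++ b :: r)) (k₁ : bs₁ = [] ++ (l' ++ b :: r))
    (k₁' : bs₁ = l' ++ (b :: r ++ [])) (k₂ : bs₂ = l' ++ (b :: r' ++ []))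
    (m₀ : as = [] ++ (as ++ [])) (m₁ : as' = [] ++ (as' ++ []))
    (hb' : bs₂ = l' ++ b :: r') (hc' : cs₃ = l' ++ as' ++ r')
    (g : C.Hom x bs c) (f : C.Hom y as b) :
    C.post h (C.act psr M [] i₃ i₄ (C.act psa l' r i₁' i₂ (C.act psl [] R i₀ i₁
        (C.sub l r hz hb hc g f)))) =
      C.sub l' r' hz' hb' hc'
        (C.post h (C.act (.cons (𝟙 b) psr) l' [] k₁' k₂ (C.act psl [] (b :: r) k₀ k₁ g)))
        (C.act psa [] [] m₀ m₁ f) := by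
  have e₁ := C.act_sub_left psl [] r (cs' := cs₁) (L := l) (L' := l') rfl rfl hR hz hz' hb hc
    (by simpa using k₁) (by simp [i₁, hR]) i₀ i₁ k₀ k₁ g f
  have e₂ := C.act_sub_inner psa l' r [] (L := l') (by simp) hz' (by simpa using k₁)
    (by simp [i₁, hR]) (by simp [i₂]) i₁' i₂ m₀ m₁ (C.act psl [] (b :: r) k₀ k₁ g) f
  have e₃ := C.act_sub_right psr l' [] (M := M) (N := l' ++ [b]) (R := r) (R' := r') (by simp [hM]) rfl rfl rfl hz'
    (by simpa using k₁) (by simp [i₂]) hb' hc' i₃ i₄ (by simpa using k₁') (by simpa using k₂)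
    (C.act psl [] (b :: r) k₀ k₁ g) (C.act psa [] [] m₀ m₁ f)
  rw [e₁, e₂, e₃, post_sub, C.act_cons_id psr l' [] k₁' k₂ (by simpa using k₁')
    (by simpa using k₂)]

/-- Dinaturality of substitution. -/
theorem sub_dinatural {x y z : Tightness} {as bs bs' cs : List C.Obj} {b b' c : C.Obj}
    (l r : List C.Obj) (hz : z = x.comp l y) (hb : bs = l ++ b :: r) (hb' : bs' = l ++ b' :: r)
    (hc : cs = l ++ as ++ r) (k : b ⟶ b') {g : C.Hom x bs' c} {f : C.Hom y as b}
    {g' : C.Hom x bs c} {f' : C.Hom y as b'} (hg : g' = C.pre l r hb' hb k g)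
    (hf : f' = C.post k f) :
    C.sub l r hz hb hc g' f = C.sub l r hz hb' hc g f' := by
  rw [hg, hf, sub_pre_same]

theorem j_post {as : List C.Obj} {b b' : C.Obj} (q : b ⟶ b') (g : C.Hom .tight as b) :
    C.post q (C.j g) = C.j (C.post q g) :=
  C.sub_lift (x := .tight) (x' := .tight) (y := .tight) (y' := .loose) (z := .tight) (z' := .loose)
    [] [] nofun nofun nofun rfl rfl rfl (by simp) q g

theorem j_pre {as as' : List C.Obj} {a a' c : C.Obj} (l r : List C.Obj)
    (h : as = l ++ a :: r) (h' : as' = l ++ a' :: r) (p : a' ⟶ a) (g : C.Hom .tight as c) :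
    C.pre l r h h' p (C.j g) = C.j (C.pre l r h h' p g) :=
  C.sub_lift (x := .tight) (x' := .loose) (y := .tight) (y' := .tight) (z := .tight) (z' := .loose)
    l r nofun nofun nofun (Tightness.comp_tight _ _).symm rfl h (by simp [h']) g p

theorem j_act₁ {a a' b b' : C.Obj} (p : a' ⟶ a) (q : b ⟶ b') (f : a ⟶ b) :
    (C.multiHom₁ .loose).act p q (C.j f) = C.j (p ≫ f ≫ q) := by
  refine Eq.trans (congrArg (C.post q) (C.j_pre [] [] rfl rfl p f)) ?_
  exact (C.j_post _ _).trans (congrArg C.j (C.post_pre [] [] rfl rfl p q f))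

theorem j_act₂ {a₁ a₁' a₂ a₂' b b' : C.Obj} (p₁ : a₁' ⟶ a₁) (p₂ : a₂' ⟶ a₂) (q : b ⟶ b')
    (f : C.Hom .tight [a₁, a₂] b) :
    (C.multiHom₂ .loose).act p₁ p₂ q (C.j f) = C.j ((C.multiHom₂ .tight).act p₁ p₂ q f) := by
  change C.post q (C.pre [a₁'] [] rfl rfl p₂ (C.pre [] [a₂] rfl rfl p₁ (C.j f))) = _
  rw [j_pre, j_pre, j_post]
  rfl

/-- The short skew multicategory underlying a skew multicategory. -/
def toShort : ShortSkewMulticategory.{v, u} where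
  toShortSkewData := C.toShortData
  j₁_natural p q f := C.j_act₁ p q f
  j₂_natural p₁ p₂ q f := C.j_act₂ p₁ p₂ q f
  sub2l₁_j {a b₁ b₂ c} g p := by
    refine Eq.trans (C.sub_lift (x := .tight) (x' := .tight) (y := .tight) (y' := .loose)
      (z := .tight) (z' := .loose) [] [b₂] nofun nofun nofun rfl rfl rfl rfl g p) ?_
    refine congrArg C.j (Eq.symm ?_)
    exact (C.post_id _).trans (C.pre_id [a] [] rfl rfl _)
  sub2l₂_j {a b₁ b₂ c} g p := by
    refine Eq.trans (C.sub_lift (x := .tight) (x' := .tight) (y := .tight) (y' := .loose)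
      (z := .tight) (z' := .tight) [b₁] [] nofun nofun nofun rfl rfl rfl rfl g p) ?_
    refine Eq.symm ((C.post_id _).trans ?_)
    exact congrArg (C.pre [b₁] [] rfl rfl p) (C.pre_id [] [b₂] rfl rfl g)
  subl2_j {a₁ a₂ b c} p g := by
    refine Eq.trans (C.sub_lift (x := .tight) (x' := .loose) (y := .tight) (y' := .tight)
      (z := .tight) (z' := .loose) [] [] nofun nofun nofun rfl rfl rfl rfl p g) ?_
    refine congrArg C.j (Eq.symm ?_)
    exact congrArg (C.post p) ((C.pre_id [a₁] [] rfl rfl _).trans (C.pre_id [] [a₂] rfl rfl g))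
  subl0_j p w := C.sub_lift (x := .tight) (x' := .loose) (y := .loose) (y' := .loose)
      (z := .loose) (z' := .loose) [] [] nofun (fun e => e) (fun e => e) rfl rfl rfl rfl p w
  sub22₁_natural p₁ p₂ q₂ h g f :=
    (C.sub_natural .nil (.cons p₁ (.cons p₂ .nil)) (.cons q₂ .nil) h rfl rfl rfl rfl rfl rfl rfl rfl rfl rfl rfl rfl rfl rfl rfl rfl rfl rfl rfl rfl g f).trans
      (congrArg (C.sub _ _ _ _ _ _) (C.post_id _).symm)
  sub22₁_dinatural k _ _ :=
    C.sub_dinatural _ _ _ _ _ _ k (C.multiHom₂_pre₁ _ _) (C.multiHom₂_post _ _)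
  sub22₂_natural q₁ p₁ p₂ h g f :=
    (C.sub_natural (.cons q₁ .nil) (.cons p₁ (.cons p₂ .nil)) .nil h rfl rfl rfl rfl rfl rfl rfl rfl rfl rfl rfl rfl rfl rfl rfl rfl rfl rfl rfl rfl g f).trans
      (congrArg (C.sub _ _ _ _ _ _) (C.post_id _).symm)
  sub22₂_dinatural k _ _ :=
    C.sub_dinatural _ _ _ _ _ _ k (C.multiHom₂_pre₂ _ _) (C.multiHom₂_post _ _)
  sub32₁_natural p₁ p₂ q₂ q₃ h g f :=
    (C.sub_natural .nil (.cons p₁ (.cons p₂ .nil)) (.cons q₂ (.cons q₃ .nil)) h rfl rfl rfl rfl rfl rfl rfl rfl rfl rfl rfl rfl rfl rfl rfl rfl rfl rfl rfl rfl g f).trans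
      (congrArg (C.sub _ _ _ _ _ _) (C.post_id _).symm)
  sub32₁_dinatural k _ _ :=
    C.sub_dinatural _ _ _ _ _ _ k (C.multiHom₃_pre₁ _ _) (C.multiHom₂_post _ _)
  sub32₂_natural q₁ p₁ p₂ q₃ h g f :=
    (C.sub_natural (.cons q₁ .nil) (.cons p₁ (.cons p₂ .nil)) (.cons q₃ .nil) h rfl rfl rfl rfl rfl rfl rfl rfl rfl rfl rfl rfl rfl rfl rfl rfl rfl rfl rfl rfl g f).trans
      (congrArg (C.sub _ _ _ _ _ _) (C.post_id _).symm)
  sub32₂_dinatural k _ _ :=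
    C.sub_dinatural _ _ _ _ _ _ k (C.multiHom₃_pre₂ _ _) (C.multiHom₂_post _ _)
  sub32₃_natural q₁ q₂ p₁ p₂ h g f :=
    (C.sub_natural (.cons q₁ (.cons q₂ .nil)) (.cons p₁ (.cons p₂ .nil)) .nil h rfl rfl rfl rfl rfl rfl rfl rfl rfl rfl rfl rfl rfl rfl rfl rfl rfl rfl rfl rfl g f).trans
      (congrArg (C.sub _ _ _ _ _ _) (C.post_id _).symm)
  sub32₃_dinatural k _ _ :=
    C.sub_dinatural _ _ _ _ _ _ k (C.multiHom₃_pre₃ _ _) (C.multiHom₂_post _ _)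
  sub23₁_natural p₁ p₂ p₃ q₂ h g f :=
    (C.sub_natural .nil (.cons p₁ (.cons p₂ (.cons p₃ .nil))) (.cons q₂ .nil) h rfl rfl rfl rfl rfl rfl rfl rfl rfl rfl rfl rfl rfl rfl rfl rfl rfl rfl rfl rfl g f).trans
      (congrArg (C.sub _ _ _ _ _ _) (C.post_id _).symm)
  sub23₁_dinatural k _ _ :=
    C.sub_dinatural _ _ _ _ _ _ k (C.multiHom₂_pre₁ _ _) (C.multiHom₃_post _ _)
  sub23₂_natural q₁ p₁ p₂ p₃ h g f :=
    (C.sub_natural (.cons q₁ .nil) (.cons p₁ (.cons p₂ (.cons p₃ .nil))) .nil h rfl rfl rfl rfl rfl rfl rfl rfl rfl rfl rfl rfl rfl rfl rfl rfl rfl rfl rfl rfl g f).trans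
      (congrArg (C.sub _ _ _ _ _ _) (C.post_id _).symm)
  sub23₂_dinatural k _ _ :=
    C.sub_dinatural _ _ _ _ _ _ k (C.multiHom₂_pre₂ _ _) (C.multiHom₃_post _ _)
  sub20₁_natural q₂ h g f :=
    C.sub_natural .nil .nil (.cons q₂ .nil) h rfl rfl rfl rfl rfl rfl rfl rfl rfl rfl rfl rfl rfl rfl rfl rfl rfl rfl rfl rfl g f
  sub20₁_dinatural k _ _ :=
    C.sub_dinatural _ _ _ _ _ _ k (C.multiHom₂_pre₁ _ _) rfl
  sub20₂_natural {b₁ b₁' b₂ c c'} q₁ h g f :=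
    (C.post_pre [] [] rfl rfl q₁ h (C.sub [b₁] [] rfl rfl rfl g f)).symm.trans
      (C.sub_natural (x := .tight) (y := .loose) (z := .tight) (.cons q₁ .nil) .nil .nil h
        rfl rfl rfl rfl rfl rfl rfl rfl rfl rfl rfl rfl rfl rfl rfl rfl rfl rfl rfl rfl g f)
  sub20₂_dinatural k _ _ :=
    C.sub_dinatural _ _ _ _ _ _ k (C.multiHom₂_pre₂ _ _) rfl
  sub30₁_natural q₂ q₃ h g f :=
    C.sub_natural .nil .nil (.cons q₂ (.cons q₃ .nil)) h rfl rfl rfl rfl rfl rfl rfl rfl rfl rfl rfl rfl rfl rfl rfl rfl rfl rfl rfl rfl g f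
  sub30₁_dinatural k _ _ :=
    C.sub_dinatural _ _ _ _ _ _ k (C.multiHom₃_pre₁ _ _) rfl
  sub30₂_natural q₁ q₃ h g f :=
    C.sub_natural (.cons q₁ .nil) .nil (.cons q₃ .nil) h rfl rfl rfl rfl rfl rfl rfl rfl rfl rfl rfl rfl rfl rfl rfl rfl rfl rfl rfl rfl g f
  sub30₂_dinatural k _ _ :=
    C.sub_dinatural _ _ _ _ _ _ k (C.multiHom₃_pre₂ _ _) rfl
  sub30₃_natural q₁ q₂ h g f :=
    C.sub_natural (.cons q₁ (.cons q₂ .nil)) .nil .nil h rfl rfl rfl rfl rfl rfl rfl rfl rfl rfl rfl rfl rfl rfl rfl rfl rfl rfl rfl rfl g f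
  sub30₃_dinatural k _ _ :=
    C.sub_dinatural _ _ _ _ _ _ k (C.multiHom₃_pre₃ _ _) rfl
  subl0_natural h g f :=
    C.sub_natural .nil .nil .nil h rfl rfl rfl rfl rfl rfl rfl rfl rfl rfl rfl rfl rfl rfl rfl rfl rfl rfl rfl rfl g f
  subl0_dinatural k _ _ :=
    C.sub_dinatural _ _ _ _ _ _ k (C.multiHom₁_pre _ _) rfl
  sub2l₁_natural p q₂ h g f :=
    (C.sub_natural .nil (.cons p .nil) (.cons q₂ .nil) h rfl rfl rfl rfl rfl rfl rfl rfl rfl rfl rfl rfl rfl rfl rfl rfl rfl rfl rfl rfl g f).trans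
      (congrArg (C.sub _ _ _ _ _ _) (C.post_id _).symm)
  sub2l₁_dinatural k _ _ :=
    C.sub_dinatural _ _ _ _ _ _ k (C.multiHom₂_pre₁ _ _) (C.multiHom₁_post _ _)
  sub2l₂_natural q₁ p h g f :=
    (C.sub_natural (.cons q₁ .nil) (.cons p .nil) .nil h rfl rfl rfl rfl rfl rfl rfl rfl rfl rfl rfl rfl rfl rfl rfl rfl rfl rfl rfl rfl g f).trans
      (congrArg (C.sub _ _ _ _ _ _) (C.post_id _).symm)
  sub2l₂_dinatural k _ _ :=
    C.sub_dinatural _ _ _ _ _ _ k (C.multiHom₂_pre₂ _ _) (C.multiHom₁_post _ _)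
  subl2_natural p₁ p₂ h g f :=
    (C.sub_natural .nil (.cons p₁ (.cons p₂ .nil)) .nil h rfl rfl rfl rfl rfl rfl rfl rfl rfl rfl rfl rfl rfl rfl rfl rfl rfl rfl rfl rfl g f).trans
      (congrArg (C.sub _ _ _ _ _ _) (C.post_id _).symm)
  subl2_dinatural k _ _ :=
    C.sub_dinatural _ _ _ _ _ _ k (C.multiHom₁_pre _ _) (C.multiHom₂_post _ _)
  assoc22₁₁ f g h := C.sub_assoc [] _ [] _ rfl rfl rfl rfl rfl rfl rfl rfl rfl rfl rfl f g h
  assoc22₁₂ {_ _ b₁ b₂ c₁ c₂ d} f g h :=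
    C.sub_assoc (as := [_, _]) [] [c₂] [b₁] [] rfl rfl rfl rfl rfl rfl rfl rfl rfl rfl rfl f g h
  assoc22₂₁ {_ _ b₁ b₂ c₁ c₂ d} f g h :=
    C.sub_assoc [c₁] [] [] [b₂] rfl rfl rfl rfl rfl rfl rfl rfl rfl rfl rfl f g h
  assoc22₂₂ {_ _ b₁ b₂ c₁ c₂ d} f g h :=
    C.sub_assoc (as := [_, _]) [c₁] [] [b₁] [] rfl rfl rfl rfl rfl rfl rfl rfl rfl rfl rfl f g h
  comm22 f g h := C.sub_comm (as := [_, _]) (bs := [_, _]) [] [] [] rfl rfl rfl rfl rfl rfl rfl rfl rfl rfl rfl rfl f g h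
  assoc20₁₁ {b₁ b₂ c₁ c₂ d} f g h :=
    C.sub_assoc [] [c₂] [] [b₂] rfl rfl rfl rfl rfl rfl rfl rfl rfl rfl rfl f g h
  assoc20₁₂ {b₁ b₂ c₁ c₂ d} f g h := by
    refine Eq.trans ((C.post_id _).trans (C.pre_id [b₁] [] rfl rfl _)) ?_
    exact C.sub_assoc [] [c₂] [b₁] [] rfl rfl rfl rfl rfl rfl rfl rfl rfl rfl rfl f g h
  assoc20₂₁ {b₁ b₂ c₁ c₂ d} f g h :=
    C.sub_assoc [c₁] [] [] [b₂] rfl rfl rfl rfl rfl rfl rfl rfl rfl rfl rfl f g h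
  assoc20₂₂ {b₁ b₂ c₁ c₂ d} f g h := by
    refine Eq.trans ((C.post_id _).trans
      (congrArg (C.pre [c₁] [] rfl rfl _) (C.pre_id [] [c₂] rfl rfl _))) ?_
    exact C.sub_assoc [c₁] [] [b₁] [] rfl rfl rfl rfl rfl rfl rfl rfl rfl rfl rfl f g h
  comm20 {a₁ a₂ c₁ c₂ d} f g h := by
    refine Eq.trans ?_ (congrArg (C.post (C.sub [c₁] [] rfl rfl rfl f h))
      ((C.pre_id [a₁] [] rfl rfl _).trans (C.pre_id [] [a₂] rfl rfl g))).symm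
    exact C.sub_comm (as := [_, _]) (bs := []) (y := .tight) (z := .loose) [] [] [] rfl rfl rfl rfl rfl rfl rfl rfl rfl rfl rfl rfl f g h
  comm02 f g h :=
    C.sub_comm (as := []) (bs := [_, _]) (y := .loose) (z := .tight) [] [] [] rfl rfl rfl rfl rfl rfl rfl rfl rfl rfl rfl rfl f g h
  comm00 f g h := C.sub_comm [] [] [] rfl rfl rfl rfl rfl rfl rfl rfl rfl rfl rfl rfl f g h

end SkewMulticategory

namespace SkewMultifunctor

variable {C D : SkewMulticategory.{v, u}} (S : SkewMultifunctor C D)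

theorem map_post {x : Tightness} {as : List C.Obj} {b b' : C.Obj} (q : b ⟶ b')
    (g : C.Hom x as b) :
    S.map (C.post q g) = D.post (b := S.obj b) (b' := S.obj b') (S.map q) (S.map g) :=
  S.map_sub [] [] _ _ _ _ _ _ _ _

theorem map_pre {x : Tightness} {as as' : List C.Obj} {a a' c : C.Obj} (l r : List C.Obj)
    (h : as = l ++ a :: r) (h' : as' = l ++ a' :: r)
    (k : as.map S.obj = l.map S.obj ++ S.obj a :: r.map S.obj)
    (k' : as'.map S.obj = l.map S.obj ++ S.obj a' :: r.map S.obj) (p : a' ⟶ a)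
    (g : C.Hom x as c) :
    S.map (C.pre l r h h' p g) =
      D.pre (a := S.obj a) (a' := S.obj a') (l.map S.obj) (r.map S.obj) k k' (S.map p) (S.map g) :=
  S.map_sub l r _ _ _ _ _ _ _ _

/-- The functor between underlying categories. -/
def toFunctor : C.Obj ⥤ D.Obj where
  obj := S.obj
  map f := S.map f
  map_id a := S.map_id a
  map_comp f g := S.map_sub [] [] rfl rfl rfl rfl rfl rfl g f

theorem map_act₁ {x : Tightness} {a a' b b' : C.Obj} (p : a' ⟶ a) (q : b ⟶ b')
    (f : C.Hom x [a] b) : S.map ((C.multiHom₁ x).act p q f) =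
      (D.multiHom₁ x).act (S.toFunctor.map p) (S.toFunctor.map q) (S.map f) :=
  (S.map_post q _).trans (congrArg (D.post _) (S.map_pre [] [] rfl rfl rfl rfl p f))

theorem map_act₂ {x : Tightness} {a₁ a₁' a₂ a₂' b b' : C.Obj} (p₁ : a₁' ⟶ a₁) (p₂ : a₂' ⟶ a₂)
    (q : b ⟶ b') (f : C.Hom x [a₁, a₂] b) : S.map ((C.multiHom₂ x).act p₁ p₂ q f) =
      (D.multiHom₂ x).act (S.toFunctor.map p₁) (S.toFunctor.map p₂) (S.toFunctor.map q)
        (S.map f) := by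
  refine (S.map_post q _).trans (congrArg (D.post _) ?_)
  refine (S.map_pre [a₁'] [] rfl rfl rfl rfl p₂ _).trans (congrArg (D.pre [_] [] _ _ _) ?_)
  exact S.map_pre [] [a₂] rfl rfl rfl rfl p₁ f

theorem map_act₃ {x : Tightness} {a₁ a₁' a₂ a₂' a₃ a₃' b b' : C.Obj} (p₁ : a₁' ⟶ a₁)
    (p₂ : a₂' ⟶ a₂) (p₃ : a₃' ⟶ a₃) (q : b ⟶ b') (f : C.Hom x [a₁, a₂, a₃] b) :
    S.map ((C.multiHom₃ x).act p₁ p₂ p₃ q f) =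
      (D.multiHom₃ x).act (S.toFunctor.map p₁) (S.toFunctor.map p₂) (S.toFunctor.map p₃)
        (S.toFunctor.map q) (S.map f) := by
  refine (S.map_post q _).trans (congrArg (D.post _) ?_)
  refine (S.map_pre [a₁', a₂'] [] rfl rfl rfl rfl p₃ _).trans
    (congrArg (D.pre [_, _] [] _ _ _) ?_)
  refine (S.map_pre [a₁'] [a₃] rfl rfl rfl rfl p₂ _).trans (congrArg (D.pre [_] [_] _ _ _) ?_)
  exact S.map_pre [] [a₂, a₃] rfl rfl rfl rfl p₁ f

theorem map_act₄ {x : Tightness} {a₁ a₁' a₂ a₂' a₃ a₃' a₄ a₄' b b' : C.Obj} (p₁ : a₁' ⟶ a₁)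
    (p₂ : a₂' ⟶ a₂) (p₃ : a₃' ⟶ a₃) (p₄ : a₄' ⟶ a₄) (q : b ⟶ b')
    (f : C.Hom x [a₁, a₂, a₃, a₄] b) :
    S.map ((C.multiHom₄ x).act p₁ p₂ p₃ p₄ q f) =
      (D.multiHom₄ x).act (S.toFunctor.map p₁) (S.toFunctor.map p₂) (S.toFunctor.map p₃)
        (S.toFunctor.map p₄) (S.toFunctor.map q) (S.map f) := by
  refine (S.map_post q _).trans (congrArg (D.post _) ?_)
  refine (S.map_pre [a₁', a₂', a₃'] [] rfl rfl rfl rfl p₄ _).trans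
    (congrArg (D.pre [_, _, _] [] _ _ _) ?_)
  refine (S.map_pre [a₁', a₂'] [a₄] rfl rfl rfl rfl p₃ _).trans
    (congrArg (D.pre [_, _] [_] _ _ _) ?_)
  refine (S.map_pre [a₁'] [a₃, a₄] rfl rfl rfl rfl p₂ _).trans
    (congrArg (D.pre [_] [_, _] _ _ _) ?_)
  exact S.map_pre [] [a₂, a₃, a₄] rfl rfl rfl rfl p₁ f

/-- The morphism of short skew multicategories underlying a skew multifunctor. -/
def toShort : ShortSkewMultifunctor C.toShort D.toShort where
  F := S.toFunctor
  T₂ f := S.map f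
  T₃ f := S.map f
  T₄ f := S.map f
  L₀ f := S.map f
  L₁ f := S.map f
  L₂ f := S.map f
  T₂_natural p₁ p₂ q f := S.map_act₂ p₁ p₂ q f
  T₃_natural p₁ p₂ p₃ q f := S.map_act₃ p₁ p₂ p₃ q f
  T₄_natural p₁ p₂ p₃ p₄ q f := S.map_act₄ p₁ p₂ p₃ p₄ q f
  L₀_natural q f := S.map_post q f
  L₁_natural p q f := S.map_act₁ p q f
  L₂_natural p₁ p₂ q f := S.map_act₂ p₁ p₂ q f
  map_j₁ f := S.map_j f
  map_j₂ f := S.map_j f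
  map_sub22₁ {_ _ _ b₂ _} g f := S.map_sub [] [b₂] rfl rfl rfl rfl rfl rfl g f
  map_sub22₂ {_ _ b₁ _ _} g f := S.map_sub [b₁] [] rfl rfl rfl rfl rfl rfl g f
  map_sub32₁ {_ _ _ b₂ b₃ _} g f := S.map_sub [] [b₂, b₃] rfl rfl rfl rfl rfl rfl g f
  map_sub32₂ {_ _ b₁ _ b₃ _} g f := S.map_sub [b₁] [b₃] rfl rfl rfl rfl rfl rfl g f
  map_sub32₃ {_ _ b₁ b₂ _ _} g f := S.map_sub [b₁, b₂] [] rfl rfl rfl rfl rfl rfl g f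
  map_sub23₁ {_ _ _ _ b₂ _} g f := S.map_sub [] [b₂] rfl rfl rfl rfl rfl rfl g f
  map_sub23₂ {_ _ _ b₁ _ _} g f := S.map_sub [b₁] [] rfl rfl rfl rfl rfl rfl g f
  map_sub20₁ {_ b₂ _} g f := S.map_sub [] [b₂] rfl rfl rfl rfl rfl rfl g f
  map_sub20₂ {b₁ _ _} g f := S.map_sub [b₁] [] rfl rfl rfl rfl rfl rfl g f
  map_sub30₁ {_ b₂ b₃ _} g f := S.map_sub [] [b₂, b₃] rfl rfl rfl rfl rfl rfl g f
  map_sub30₂ {b₁ _ b₃ _} g f := S.map_sub [b₁] [b₃] rfl rfl rfl rfl rfl rfl g f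
  map_sub30₃ {b₁ b₂ _ _} g f := S.map_sub [b₁, b₂] [] rfl rfl rfl rfl rfl rfl g f
  map_subl0 g f := S.map_sub [] [] rfl rfl rfl rfl rfl rfl g f
  map_sub2l₁ {_ _ b₂ _} g f := S.map_sub [] [b₂] rfl rfl rfl rfl rfl rfl g f
  map_sub2l₂ {_ b₁ _ _} g f := S.map_sub [b₁] [] rfl rfl rfl rfl rfl rfl g f
  map_subl2 g f := S.map_sub [] [] rfl rfl rfl rfl rfl rfl g f

end SkewMultifunctor

/-- The forgetful functor from skew multicategories to short skew multicategories. -/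
def forgetToShort : SkewMulticategory.{v, u} ⥤ ShortSkewMulticategory.{v, u} where
  obj C := C.toShort
  map S := SkewMultifunctor.toShort S
  map_id _ := rfl
  map_comp _ _ := rfl

/-- The short skew multicategory underlying a left representable skew multicategory is left
representable. -/
theorem isLeftRepresentableShort_toShort {C : SkewMulticategory.{v, u}}
    (hC : IsLeftRepresentable C) : IsLeftRepresentableShort C.toShort := by
  refine ⟨?_, fun a b => ?_⟩
  · obtain ⟨i, w, hw⟩ := hC .loose [] nofun
    exact ⟨i, w, hw [], fun x => hw [x], fun x y => hw [x, y]⟩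
  · obtain ⟨m, θ, hθ⟩ := hC .tight [a, b] (fun _ => nofun)
    refine ⟨m, θ, fun d => ?_, fun x => hθ [x], fun x y => hθ [x, y]⟩
    have : (fun f : m ⟶ d => (C.multiHom₂ .tight).act (𝟙 a) (𝟙 b) f θ) =
        fun f => C.sub [] [] rfl rfl rfl f θ := funext fun f => C.multiHom₂_post f θ
    exact this ▸ hθ [] d

/-- The forgetful functor from left representable skew multicategories to left representable short
skew multicategories. -/
def forgetToShortLeftRepresentable :
    IsLeftRepresentable.{v, u}.FullSubcategory ⥤ IsLeftRepresentableShort.{v, u}.FullSubcategory :=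
  IsLeftRepresentableShort.lift (IsLeftRepresentable.ι ⋙ forgetToShort)
    fun C => isLeftRepresentableShort_toShort C.property

end

end SkewMulti

/-! The theorem rests on one fact: in a left representable (short) skew multicategory every multimap
comes, in exactly one way, from tight unary maps by substituting classifiers in the first position.
A tight map of arity n ≥ 2 is `g ∘₁ θ` for a unique tight `g` of arity n - 1, and a loose map of
arity r is `g ∘₁ u` for a unique tight `g` of arity r + 1. A morphism is therefore determined by its
values on objects, tight unary maps, the `θ a b` and the nullary classifier
(`shortSkewMultifunctor_ext`, `skewMultifunctor_ext`). This makes both functors faithful.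

For fullness, values on these generators are extended to all multimaps along the factorizations, and
the extension must be shown to preserve substitution. Substitution in the first position is a matter
of associativity together with naturality of `θ`. Substitution in the second position reduces to
substituting a tight unary map, a `θ` or the nullary classifier into some `θ`; these three cases are
governed by naturality, the associator and the right unit map. Later positions, and substitution
into loose maps, reduce to these because substitutions in different positions commute. The
comparison `j` is governed by the left unit map, since `j f = f ∘₁ j 1` and `j 1 = (λ ∘ θ) ∘₁ u`.
For K^s the conditions on the generators are exactly the axioms of a lax monoidal functor
(`LaxData`). For U^s they involve only maps of arity at most three, so a morphism of short skew
multicategories supplies them (`ExtensionData`, `extensionData`).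

For essential surjectivity, let `A` be a skew monoidal category and adjoin a formal strict unit
`star`. A multimap of type x from a₁, …, aₙ to b is a morphism (…(e a₁)…)aₙ → b, where e is `star`
for tight maps and the unit of `A` for loose ones. Such a morphism is the same as a family (…(y
a₁)…)aₙ → y b that is natural in y and compatible with tensoring on the left: the family is built
from right units and associators (`ext`), the left unit recovers the morphism (`ext_leftUnit`), and
the two passages are mutually inverse (`ext_unique`). Substitution is composition of families
(`ext_sub`), so the axioms of a skew multicategory follow from those of a category and naturality.
The classifiers are identities of left-bracketed products, and K^s U^s gives back `A` up to
isomorphism (`isoRep`).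

Thus K^s and K^s U^s are both fully faithful and essentially surjective, and cancelling K^s shows
that U^s is an equivalence. -/

namespace SkewMulti

noncomputable section

set_option linter.unusedVariables false
set_option linter.checkUnivs false

/-! ### The functor to skew monoidal categories is fully faithful -/

namespace LeftRepresentation

variable {M : ShortSkewMulticategory.{v, u}} (R : LeftRepresentation M)

theorem desc_act {a b d : M.Obj} (h : R.m a b ⟶ d) :
    R.desc (M.T₂.act (𝟙 a) (𝟙 b) h (R.θ a b)) = h := R.hom_ext (R.desc_spec _)

theorem desc_θ (a b : M.Obj) : R.desc (R.θ a b) = 𝟙 _ :=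
  R.hom_ext (by rw [desc_spec, M.T₂.act_id])

theorem desc₃_sub {a b x d : M.Obj} (g : M.T₂.Hom (R.m a b) x d) :
    R.desc₃ (M.sub22₁ g (R.θ a b)) = g := R.hom_ext₃ (R.desc₃_spec _)

theorem desc₁_sub {x d : M.Obj} (g : M.T₂.Hom R.i x d) :
    R.desc₁ (M.sub20₁ g R.w) = g := R.hom_ext₁ (R.desc₁_spec _)

theorem desc₀_act {d : M.Obj} (h : R.i ⟶ d) : R.desc₀ (M.L₀.act h R.w) = h :=
  R.hom_ext₀ (R.desc₀_spec _)

/-- The inverse of `- ∘₁ θ` on tight 4-ary maps. -/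
def desc₄ {a b x y d : M.Obj} (f : M.T₄.Hom a b x y d) : M.T₃.Hom (R.m a b) x y d :=
  (((R.θ_univ a b).bij₃ x y d).2 f).choose

theorem desc₄_spec {a b x y d : M.Obj} (f : M.T₄.Hom a b x y d) :
    M.sub32₁ (R.desc₄ f) (R.θ a b) = f :=
  (((R.θ_univ a b).bij₃ x y d).2 f).choose_spec

theorem desc₄_sub {a b x y d : M.Obj} (g : M.T₃.Hom (R.m a b) x y d) :
    R.desc₄ (M.sub32₁ g (R.θ a b)) = g := R.hom_ext₄ (R.desc₄_spec _)

/-- The inverse of `- ∘₁ w` on loose binary maps. -/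
def desc₂ {x y d : M.Obj} (f : M.L₂.Hom x y d) : M.T₃.Hom R.i x y d :=
  ((R.w_univ.bij₂ x y d).2 f).choose

theorem desc₂_spec {x y d : M.Obj} (f : M.L₂.Hom x y d) : M.sub30₁ (R.desc₂ f) R.w = f :=
  ((R.w_univ.bij₂ x y d).2 f).choose_spec

theorem desc₂_sub {x y d : M.Obj} (g : M.T₃.Hom R.i x y d) :
    R.desc₂ (M.sub30₁ g R.w) = g := R.hom_ext₂ (R.desc₂_spec _)

/-- A morphism of short skew multicategories is determined by its action on objects, on tight unary
maps and on classifiers. -/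
theorem shortSkewMultifunctor_ext {N : ShortSkewMulticategory.{v, u}}
    {S T : ShortSkewMultifunctor M N} (hF : S.F = T.F)
    (hθ : ∀ a b, HEq (S.T₂ (R.θ a b)) (T.T₂ (R.θ a b))) (hw : HEq (S.L₀ R.w) (T.L₀ R.w)) :
    S = T := by
  have hT₂ : ∀ {a b d : M.Obj} (f : M.T₂.Hom a b d), HEq (S.T₂ f) (T.T₂ f) := by
    intro a b d f
    have hS := S.T₂_natural (𝟙 a) (𝟙 b) (R.desc f) (R.θ a b)
    have hT := T.T₂_natural (𝟙 a) (𝟙 b) (R.desc f) (R.θ a b)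
    rw [desc_spec] at hS hT
    rw [hS, hT]
    have := hθ a b
    -- The two values have types depending on `S.F` and `T.F`. Once they are generalized, `hF` can
    -- be rewritten everywhere and the heterogeneous equality becomes an equality.
    revert this
    generalize S.T₂ (R.θ a b) = s
    generalize T.T₂ (R.θ a b) = t
    revert s t
    rw [hF]
    rintro s t h
    rw [eq_of_heq h]
  have hL₀ : ∀ {d : M.Obj} (f : M.L₀.Hom d), HEq (S.L₀ f) (T.L₀ f) := by
    intro d f
    have hS := S.L₀_natural (R.desc₀ f) R.w
    have hT := T.L₀_natural (R.desc₀ f) R.w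
    rw [desc₀_spec] at hS hT
    rw [hS, hT]
    revert hw
    generalize S.L₀ R.w = s
    generalize T.L₀ R.w = t
    revert s t
    rw [hF]
    rintro s t h
    rw [eq_of_heq h]
  -- Here `s₁`, `s₂`, `s₃`, `s₄` are preservation of `sub22₁`, `sub32₁`, `sub20₁`, `sub30₁`. These
  -- present tight ternary, tight 4-ary, loose unary and loose binary maps as composites with
  -- classifiers, so equality propagates to those arities.
  obtain ⟨F, T₂, T₃, T₄, L₀, L₁, L₂, _, _, _, _, _, _, _, _, s₁, _, s₂, _, _, _, _, s₃, _, s₄, _⟩ := S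
  obtain ⟨F', T₂', T₃', T₄', L₀', L₁', L₂', _, _, _, _, _, _, _, _, s₁', _, s₂', _, _, _, _, s₃', _,
    s₄', _⟩ := T
  dsimp only at hF hT₂ hL₀ s₁ s₂ s₃ s₄ s₁' s₂' s₃' s₄'
  subst hF
  obtain rfl : @T₂ = @T₂' := by funext a b d f; exact eq_of_heq (hT₂ f)
  obtain rfl : @L₀ = @L₀' := by funext d f; exact eq_of_heq (hL₀ f)
  obtain rfl : @T₃ = @T₃' := by
    funext a b c d f
    rw [← R.desc₃_spec f, s₁, s₁']
  obtain rfl : @T₄ = @T₄' := by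
    funext a b c d e f
    rw [← R.desc₄_spec f, s₂, s₂']
  obtain rfl : @L₁ = @L₁' := by
    funext a b f
    rw [← R.desc₁_spec f, s₃, s₃']
  obtain rfl : @L₂ = @L₂' := by
    funext a b c f
    rw [← R.desc₂_spec f, s₄, s₄']
  rfl

/-- The components `f₂` and `f₀`, evaluated on the classifiers of `N`, are the images of `θ` and
`w`, and those determine the morphism. The equalities are heterogeneous because the types of the
components depend on the underlying functor. -/
theorem toLaxMonoidalFunctor_injective {N : ShortSkewMulticategory.{v, u}}
    (S : LeftRepresentation N) {F G : ShortSkewMultifunctor M N}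
    (h : R.toLaxMonoidalFunctor S F = R.toLaxMonoidalFunctor S G) : F = G := by
  have hF : F.F = G.F := congrArg LaxMonoidalFunctor.F h
  have h₀ : HEq (R.map₀ S F) (R.map₀ S G) := by
    have : HEq (R.toLaxMonoidalFunctor S F).f₀ (R.toLaxMonoidalFunctor S G).f₀ := by rw [h]
    exact this
  have h₂ : HEq (R.map₂ S F) (R.map₂ S G) := by
    have : HEq (R.toLaxMonoidalFunctor S F).f₂ (R.toLaxMonoidalFunctor S G).f₂ := by rw [h]
    exact this
  refine R.shortSkewMultifunctor_ext hF (fun a b => ?_) ?_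
  · rw [← R.map₂_spec S F, ← R.map₂_spec S G]
    revert h₂
    generalize R.map₂ S F = s
    generalize R.map₂ S G = t
    revert s t
    rw [hF]
    rintro s t h
    rw [eq_of_heq h]
  · rw [← R.map₀_spec S F, ← R.map₀_spec S G]
    revert h₀
    generalize R.map₀ S F = s
    generalize R.map₀ S G = t
    revert s t
    rw [hF]
    rintro s t h
    rw [eq_of_heq h]

/-- A functor together with images of the classifiers, satisfying the axioms of a lax monoidal
functor. -/
structure LaxData (N : ShortSkewMulticategory.{v, u}) where
  F : M.Obj ⥤ N.Obj
  θ : ∀ a b : M.Obj, N.T₂.Hom (F.obj a) (F.obj b) (F.obj (R.m a b))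
  w : N.L₀.Hom (F.obj R.i)
  -- The axioms are those of a lax monoidal functor after evaluation on classifiers: `θ a b` stands
  -- for `f₂ ∘ θ` and `w` for `f₀ ∘ w`. In this form no classifiers of `N` are mentioned.
  natural : ∀ {a b a' b' : M.Obj} (p : a ⟶ a') (q : b ⟶ b'),
    N.T₂.act (F.map p) (F.map q) (𝟙 _) (θ a' b') =
      N.T₂.act (𝟙 _) (𝟙 _) (F.map (R.tensorHom p q)) (θ a b)
  map_assoc : ∀ a b c : M.Obj,
    N.sub22₁ (N.T₂.act (𝟙 _) (𝟙 _) (F.map (R.assoc a b c)) (θ (R.m a b) c)) (θ a b) =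
      N.sub22₂ (θ a (R.m b c)) (θ b c)
  map_leftUnit : ∀ a : M.Obj,
    N.sub20₁ (N.T₂.act (𝟙 _) (𝟙 _) (F.map (R.leftUnit a)) (θ R.i a)) w = N.j₁ (𝟙 _)
  map_rightUnit : ∀ a : M.Obj, N.sub20₂ (θ a R.i) w = F.map (R.rightUnit a)

/-! ### Extension of lax data to a morphism of short skew multicategories. -/

namespace LaxData

variable {R} {N : ShortSkewMulticategory.{v, u}} (Φ : R.LaxData N)

/-- The action on tight binary maps. -/
def map₂ {a b d : M.Obj} (f : M.T₂.Hom a b d) : N.T₂.Hom (Φ.F.obj a) (Φ.F.obj b) (Φ.F.obj d) :=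
  N.T₂.act (𝟙 _) (𝟙 _) (Φ.F.map (R.desc f)) (Φ.θ a b)

/-- The action on tight ternary maps. -/
def map₃ {a b c d : M.Obj} (f : M.T₃.Hom a b c d) :
    N.T₃.Hom (Φ.F.obj a) (Φ.F.obj b) (Φ.F.obj c) (Φ.F.obj d) :=
  N.sub22₁ (Φ.map₂ (R.desc₃ f)) (Φ.θ a b)

/-- The action on tight 4-ary maps. -/
def map₄ {a b c d e : M.Obj} (f : M.T₄.Hom a b c d e) :
    N.T₄.Hom (Φ.F.obj a) (Φ.F.obj b) (Φ.F.obj c) (Φ.F.obj d) (Φ.F.obj e) :=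
  N.sub32₁ (Φ.map₃ (R.desc₄ f)) (Φ.θ a b)

/-- The action on nullary maps. -/
def mapl₀ {d : M.Obj} (f : M.L₀.Hom d) : N.L₀.Hom (Φ.F.obj d) :=
  N.L₀.act (Φ.F.map (R.desc₀ f)) Φ.w

/-- The action on loose unary maps. -/
def mapl₁ {a d : M.Obj} (f : M.L₁.Hom a d) : N.L₁.Hom (Φ.F.obj a) (Φ.F.obj d) :=
  N.sub20₁ (Φ.map₂ (R.desc₁ f)) Φ.w

/-- The action on loose binary maps. -/
def mapl₂ {a b d : M.Obj} (f : M.L₂.Hom a b d) :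
    N.L₂.Hom (Φ.F.obj a) (Φ.F.obj b) (Φ.F.obj d) :=
  N.sub30₁ (Φ.map₃ (R.desc₂ f)) Φ.w

/-- Computation rules, here and below, for maps already written as composites with classifiers. With
them the chosen inverses `desc`, `desc₃`, … rarely need unfolding. -/
theorem map₂_act {a b d : M.Obj} (h : R.m a b ⟶ d) :
    Φ.map₂ (M.T₂.act (𝟙 _) (𝟙 _) h (R.θ a b)) =
      N.T₂.act (𝟙 _) (𝟙 _) (Φ.F.map h) (Φ.θ a b) := by
  rw [map₂, desc_act]

theorem map₂_θ (a b : M.Obj) : Φ.map₂ (R.θ a b) = Φ.θ a b := by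
  rw [map₂, desc_θ, Φ.F.map_id, N.T₂.act_id]

theorem mapl₀_act {d : M.Obj} (h : R.i ⟶ d) :
    Φ.mapl₀ (M.L₀.act h R.w) = N.L₀.act (Φ.F.map h) Φ.w := by
  rw [mapl₀, desc₀_act]

theorem mapl₀_w : Φ.mapl₀ R.w = Φ.w := by
  conv_lhs => rw [← M.L₀.act_id R.w]
  rw [mapl₀_act, Φ.F.map_id, N.L₀.act_id]

theorem map₃_sub {a b x d : M.Obj} (g : M.T₂.Hom (R.m a b) x d) :
    Φ.map₃ (M.sub22₁ g (R.θ a b)) = N.sub22₁ (Φ.map₂ g) (Φ.θ a b) := by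
  rw [map₃, desc₃_sub]

theorem map₄_sub {a b x y d : M.Obj} (g : M.T₃.Hom (R.m a b) x y d) :
    Φ.map₄ (M.sub32₁ g (R.θ a b)) = N.sub32₁ (Φ.map₃ g) (Φ.θ a b) := by
  rw [map₄, desc₄_sub]

theorem mapl₁_sub {x d : M.Obj} (g : M.T₂.Hom R.i x d) :
    Φ.mapl₁ (M.sub20₁ g R.w) = N.sub20₁ (Φ.map₂ g) Φ.w := by
  rw [mapl₁, desc₁_sub]

theorem mapl₂_sub {x y d : M.Obj} (g : M.T₃.Hom R.i x y d) :
    Φ.mapl₂ (M.sub30₁ g R.w) = N.sub30₁ (Φ.map₃ g) Φ.w := by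
  rw [mapl₂, desc₂_sub]

/-- This moves an action on the inputs of a classifier to its output, which is the form needed to
compute `desc`. -/
theorem act_θ {a b a' b' d : M.Obj} (p : a ⟶ a') (q : b ⟶ b') (h : R.m a' b' ⟶ d) :
    M.T₂.act p q h (R.θ a' b') = M.T₂.act (𝟙 _) (𝟙 _) (R.tensorHom p q ≫ h) (R.θ a b) := by
  rw [R.tensorHom_post, M.T₂.act_comp]; simp

/-- Write `f` as `h ∘ θ`. Acting by `p₁`, `p₂` on the inputs amounts to precomposing `h` with
`tensorHom p₁ p₂`, and the naturality axiom of `Φ` says the same about the image of `θ`. -/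
theorem map₂_natural {a₁ a₁' a₂ a₂' b b' : M.Obj} (p₁ : a₁' ⟶ a₁) (p₂ : a₂' ⟶ a₂) (q : b ⟶ b')
    (f : M.T₂.Hom a₁ a₂ b) :
    Φ.map₂ (M.T₂.act p₁ p₂ q f) =
      N.T₂.act (Φ.F.map p₁) (Φ.F.map p₂) (Φ.F.map q) (Φ.map₂ f) := by
  have e : N.T₂.act (Φ.F.map p₁) (Φ.F.map p₂) (𝟙 _) (Φ.θ a₁ a₂) = _ := Φ.natural p₁ p₂
  have e' := congrArg (N.T₂.act (𝟙 _) (𝟙 _) (Φ.F.map (R.desc f ≫ q))) e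
  rw [N.T₂.act_comp, N.T₂.act_comp] at e'
  conv_lhs => rw [← R.desc_spec f, M.T₂.act_comp]
  conv_rhs => rw [map₂, N.T₂.act_comp]
  simp only [Category.id_comp, Category.comp_id, Functor.map_comp] at e' ⊢
  rw [e', act_θ, map₂_act]
  simp

/-- With `f = g ∘₁ θ`, the first two actions combine into `tensorHom p₁ p₂` on the first input of
`g`, by dinaturality; this reduces the claim to one arity lower. The 4-ary case is the same. -/
theorem map₃_natural {a₁ a₁' a₂ a₂' a₃ a₃' b b' : M.Obj} (p₁ : a₁' ⟶ a₁) (p₂ : a₂' ⟶ a₂)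
    (p₃ : a₃' ⟶ a₃) (q : b ⟶ b') (f : M.T₃.Hom a₁ a₂ a₃ b) :
    Φ.map₃ (M.T₃.act p₁ p₂ p₃ q f) =
      N.T₃.act (Φ.F.map p₁) (Φ.F.map p₂) (Φ.F.map p₃) (Φ.F.map q) (Φ.map₃ f) := by
  conv_rhs => rw [map₃, N.sub22₁_natural, Φ.natural, ← N.sub22₁_dinatural, N.T₂.act_comp]
  conv_lhs => rw [← R.desc₃_spec f, M.sub22₁_natural, ← R.tensorHom_spec, ← M.sub22₁_dinatural, M.T₂.act_comp,
    map₃_sub, map₂_natural]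
  simp

theorem map₄_natural {a₁ a₁' a₂ a₂' a₃ a₃' a₄ a₄' b b' : M.Obj} (p₁ : a₁' ⟶ a₁) (p₂ : a₂' ⟶ a₂)
    (p₃ : a₃' ⟶ a₃) (p₄ : a₄' ⟶ a₄) (q : b ⟶ b') (f : M.T₄.Hom a₁ a₂ a₃ a₄ b) :
    Φ.map₄ (M.T₄.act p₁ p₂ p₃ p₄ q f) =
      N.T₄.act (Φ.F.map p₁) (Φ.F.map p₂) (Φ.F.map p₃) (Φ.F.map p₄) (Φ.F.map q) (Φ.map₄ f) := by
  conv_rhs => rw [map₄, N.sub32₁_natural, Φ.natural, ← N.sub32₁_dinatural, N.T₃.act_comp]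
  conv_lhs => rw [← R.desc₄_spec f, M.sub32₁_natural, ← R.tensorHom_spec, ← M.sub32₁_dinatural, M.T₃.act_comp,
    map₄_sub, map₃_natural]
  simp

theorem mapl₀_natural {b b' : M.Obj} (q : b ⟶ b') (f : M.L₀.Hom b) :
    Φ.mapl₀ (M.L₀.act q f) = N.L₀.act (Φ.F.map q) (Φ.mapl₀ f) := by
  conv_lhs => rw [← R.desc₀_spec f, M.L₀.act_comp, mapl₀_act]
  rw [mapl₀, N.L₀.act_comp, Φ.F.map_comp]

theorem mapl₁_natural {a a' b b' : M.Obj} (p : a' ⟶ a) (q : b ⟶ b') (f : M.L₁.Hom a b) :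
    Φ.mapl₁ (M.L₁.act p q f) = N.L₁.act (Φ.F.map p) (Φ.F.map q) (Φ.mapl₁ f) := by
  conv_lhs => rw [← R.desc₁_spec f, M.sub20₁_natural, mapl₁_sub, map₂_natural]
  rw [mapl₁, N.sub20₁_natural, Φ.F.map_id]

theorem mapl₂_natural {a₁ a₁' a₂ a₂' b b' : M.Obj} (p₁ : a₁' ⟶ a₁) (p₂ : a₂' ⟶ a₂) (q : b ⟶ b')
    (f : M.L₂.Hom a₁ a₂ b) :
    Φ.mapl₂ (M.L₂.act p₁ p₂ q f) =
      N.L₂.act (Φ.F.map p₁) (Φ.F.map p₂) (Φ.F.map q) (Φ.mapl₂ f) := by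
  conv_lhs => rw [← R.desc₂_spec f, M.sub30₁_natural, mapl₂_sub, map₃_natural]
  rw [mapl₂, N.sub30₁_natural, Φ.F.map_id]

/-- The loose map `j f` is `f` after the left unit map, evaluated on `θ` and `w`, so its image is
dictated by the left unit axiom. -/
theorem map_j₁ {a b : M.Obj} (f : a ⟶ b) : Φ.mapl₁ (M.j₁ f) = N.j₁ (Φ.F.map f) := by
  rw [← R.leftUnit_post, mapl₁_sub, map₂_act, Φ.F.map_comp, post₂, ← N.sub20₁_natural,
    Φ.map_leftUnit, N.j₁_natural]
  simp

/-- Since `f` is `desc f ∘ θ`, dinaturality moves `desc f` into `g` and leaves a substitution of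
`θ`, for which the claim is the definition of `map₃`. The other substitutions in the first position
of a map with tight binary or nullary inner map follow the same pattern. -/
theorem map_sub22₁ {a₁ a₂ b₁ b₂ c : M.Obj} (g : M.T₂.Hom b₁ b₂ c) (f : M.T₂.Hom a₁ a₂ b₁) :
    Φ.map₃ (M.sub22₁ g f) = N.sub22₁ (Φ.map₂ g) (Φ.map₂ f) := by
  conv_lhs => rw [← R.desc_spec f, ← M.sub22₁_dinatural, map₃_sub, map₂_natural]
  rw [Φ.F.map_id, Φ.F.map_id, N.sub22₁_dinatural]
  rfl

/-- The associator is defined by expressing `θ ∘₂ θ` through `θ ∘₁ θ`; this is where the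
associativity axiom of the lax data enters. -/
theorem map_sub22₂_θ (a b c : M.Obj) : Φ.map₃ (M.sub22₂ (R.θ a (R.m b c)) (R.θ b c)) =
    N.sub22₂ (Φ.θ a (R.m b c)) (Φ.θ b c) := by
  rw [← R.assoc_spec, map₃_sub, map₂_act, Φ.map_assoc]

theorem map_sub22₂ {a₁ a₂ b₁ b₂ c : M.Obj} (g : M.T₂.Hom b₁ b₂ c) (f : M.T₂.Hom a₁ a₂ b₂) :
    Φ.map₃ (M.sub22₂ g f) = N.sub22₂ (Φ.map₂ g) (Φ.map₂ f) := by
  have e : ∀ {d : M.Obj} (h : R.m b₁ (R.m a₁ a₂) ⟶ d),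
      Φ.map₃ (M.sub22₂ (M.T₂.act (𝟙 _) (𝟙 _) h (R.θ b₁ (R.m a₁ a₂))) (R.θ a₁ a₂)) =
      N.sub22₂ (Φ.map₂ (M.T₂.act (𝟙 _) (𝟙 _) h (R.θ b₁ (R.m a₁ a₂)))) (Φ.θ a₁ a₂) := by
    intro d h
    rw [sub22₂_post, map₃_natural, map_sub22₂_θ, Φ.F.map_id, Φ.F.map_id, Φ.F.map_id,
      ← sub22₂_post, map₂_act]
  -- For general `f`, the map `desc f` is moved into the second input of `g`, so that the case of a
  -- substituted `θ` applies to the modified `g`.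
  have e' := e (R.desc (M.T₂.act (𝟙 _) (R.desc f) (𝟙 _) g))
  rw [desc_spec, M.sub22₂_dinatural, desc_spec, map₂_natural, Φ.F.map_id, Φ.F.map_id,
    N.sub22₂_dinatural] at e'
  exact e'

theorem map_sub32₁ {a₁ a₂ b₁ b₂ b₃ c : M.Obj} (g : M.T₃.Hom b₁ b₂ b₃ c)
    (f : M.T₂.Hom a₁ a₂ b₁) : Φ.map₄ (M.sub32₁ g f) = N.sub32₁ (Φ.map₃ g) (Φ.map₂ f) := by
  conv_lhs => rw [← R.desc_spec f, ← M.sub32₁_dinatural, map₄_sub, map₃_natural]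
  rw [Φ.F.map_id, Φ.F.map_id, Φ.F.map_id, N.sub32₁_dinatural]
  rfl

/-- Factoring `f` as `k ∘₁ θ`, associativity turns the claim into substitution of `θ` into the
ternary map `g ∘₁ k`. -/
theorem map_sub23₁ {a₁ a₂ a₃ b₁ b₂ c : M.Obj} (g : M.T₂.Hom b₁ b₂ c)
    (f : M.T₃.Hom a₁ a₂ a₃ b₁) : Φ.map₄ (M.sub23₁ g f) = N.sub23₁ (Φ.map₂ g) (Φ.map₃ f) := by
  rw [← R.desc₃_spec f, M.assoc22₁₁, map₄_sub, map_sub22₁, map₃_sub, N.assoc22₁₁]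

/-- Writing `f = k ∘₁ θ` gives `g ∘₂ f = (g ∘₂ k) ∘₂ θ`, a substitution into a ternary map. That is
reduced, as in `key`, by writing the ternary map as `k' ∘₁ θ` and using `(k' ∘₁ θ) ∘₂ f = k' ∘₁ (θ
∘₂ f)`. -/
theorem map_sub23₂ {a₁ a₂ a₃ b₁ b₂ c : M.Obj} (g : M.T₂.Hom b₁ b₂ c)
    (f : M.T₃.Hom a₁ a₂ a₃ b₂) : Φ.map₄ (M.sub23₂ g f) = N.sub23₂ (Φ.map₂ g) (Φ.map₃ f) := by
  have key : ∀ {b₁ b₂ c a₁ a₂ a₃ : M.Obj} (g : M.T₃.Hom b₁ b₂ a₃ c) (f : M.T₂.Hom a₁ a₂ b₂),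
      Φ.map₄ (M.sub32₂ g f) = N.sub32₂ (Φ.map₃ g) (Φ.map₂ f) := by
    intro b₁ b₂ c a₁ a₂ a₃ g f
    rw [← R.desc₃_spec g, ← M.assoc22₁₂, map_sub23₁, map_sub22₂, map_sub22₁, N.assoc22₁₂]
  rw [← R.desc₃_spec f, M.assoc22₂₁, key, map_sub22₂, map_sub22₁, N.assoc22₂₁]

theorem map_sub32₂ {a₁ a₂ b₁ b₂ b₃ c : M.Obj} (g : M.T₃.Hom b₁ b₂ b₃ c)
    (f : M.T₂.Hom a₁ a₂ b₂) : Φ.map₄ (M.sub32₂ g f) = N.sub32₂ (Φ.map₃ g) (Φ.map₂ f) := by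
  rw [← R.desc₃_spec g, ← M.assoc22₁₂, map_sub23₁, map_sub22₂, map_sub22₁, N.assoc22₁₂]

/-- If `g = k ∘₁ θ`, substitution in the third input of `g` is substitution in the second input of
`k` followed by substitution of `θ`. -/
theorem map_sub32₃ {a₁ a₂ b₁ b₂ b₃ c : M.Obj} (g : M.T₃.Hom b₁ b₂ b₃ c)
    (f : M.T₂.Hom a₁ a₂ b₃) : Φ.map₄ (M.sub32₃ g f) = N.sub32₃ (Φ.map₃ g) (Φ.map₂ f) := by
  rw [← R.desc₃_spec g, M.comm22, map_sub32₁, map_sub22₂, map_sub22₁, N.comm22]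

theorem map_sub20₁ {b₁ b₂ c : M.Obj} (g : M.T₂.Hom b₁ b₂ c) (w : M.L₀.Hom b₁) :
    Φ.mapl₁ (M.sub20₁ g w) = N.sub20₁ (Φ.map₂ g) (Φ.mapl₀ w) := by
  conv_lhs => rw [← R.desc₀_spec w, ← M.sub20₁_dinatural, mapl₁_sub, map₂_natural]
  rw [Φ.F.map_id, Φ.F.map_id, N.sub20₁_dinatural]
  rfl

/-- As for `map_sub22₂`, with the right unit axiom in place of the associativity axiom: the
composite `θ ∘₂ w` is the right unit map, and the general nullary map is moved into `g` by
dinaturality. -/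
theorem map_sub20₂ {b₁ b₂ c : M.Obj} (g : M.T₂.Hom b₁ b₂ c) (w : M.L₀.Hom b₂) :
    Φ.F.map (M.sub20₂ g w) = N.sub20₂ (Φ.map₂ g) (Φ.mapl₀ w) := by
  have e : ∀ {d : M.Obj} (h : R.m b₁ R.i ⟶ d),
      Φ.F.map (M.sub20₂ (M.T₂.act (𝟙 _) (𝟙 _) h (R.θ b₁ R.i)) R.w) =
      N.sub20₂ (Φ.map₂ (M.T₂.act (𝟙 _) (𝟙 _) h (R.θ b₁ R.i))) Φ.w := by
    intro d h
    rw [← R.rightUnit_post, map₂_act, ← N.sub20₂_natural, Φ.map_rightUnit]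
    simp
  have e' := e (R.desc (M.T₂.act (𝟙 _) (R.desc₀ w) (𝟙 _) g))
  rw [desc_spec, M.sub20₂_dinatural, desc₀_spec, map₂_natural, Φ.F.map_id, Φ.F.map_id,
    N.sub20₂_dinatural] at e'
  exact e'

theorem map_sub30₁ {b₁ b₂ b₃ c : M.Obj} (g : M.T₃.Hom b₁ b₂ b₃ c) (w : M.L₀.Hom b₁) :
    Φ.mapl₂ (M.sub30₁ g w) = N.sub30₁ (Φ.map₃ g) (Φ.mapl₀ w) := by
  conv_lhs => rw [← R.desc₀_spec w, ← M.sub30₁_dinatural, mapl₂_sub, map₃_natural]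
  rw [Φ.F.map_id, Φ.F.map_id, Φ.F.map_id, N.sub30₁_dinatural]
  rfl

/-- The remaining substitutions are rewritten, through the associativity equations with nullary
maps, in terms of those already treated, after factoring a ternary or loose unary map through a
classifier. -/
theorem map_sub30₂ {b₁ b₂ b₃ c : M.Obj} (g : M.T₃.Hom b₁ b₂ b₃ c) (w : M.L₀.Hom b₂) :
    Φ.map₂ (M.sub30₂ g w) = N.sub30₂ (Φ.map₃ g) (Φ.mapl₀ w) := by
  rw [← R.desc₃_spec g, ← M.assoc20₁₂, map₂_natural, map_sub20₂, map_sub22₁, ← N.assoc20₁₂,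
    Φ.F.map_id, Φ.F.map_id]

theorem map_sub30₃ {b₁ b₂ b₃ c : M.Obj} (g : M.T₃.Hom b₁ b₂ b₃ c) (w : M.L₀.Hom b₃) :
    Φ.map₂ (M.sub30₃ g w) = N.sub30₃ (Φ.map₃ g) (Φ.mapl₀ w) := by
  rw [← R.desc₃_spec g, M.comm20, map₂_natural, map_sub20₂, map_sub22₁, N.comm20,
    Φ.F.map_id, Φ.F.map_id]

theorem map_subl0 {b c : M.Obj} (g : M.L₁.Hom b c) (w : M.L₀.Hom b) :
    Φ.mapl₀ (M.subl0 g w) = N.subl0 (Φ.mapl₁ g) (Φ.mapl₀ w) := by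
  rw [← R.desc₁_spec g, M.comm00, mapl₀_natural, map_sub20₂, map_sub20₁, N.comm00]

theorem map_sub2l₁ {a b₁ b₂ c : M.Obj} (g : M.T₂.Hom b₁ b₂ c) (f : M.L₁.Hom a b₁) :
    Φ.mapl₂ (M.sub2l₁ g f) = N.sub2l₁ (Φ.map₂ g) (Φ.mapl₁ f) := by
  rw [← R.desc₁_spec f, M.assoc20₁₁, map_sub30₁, map_sub22₁, map_sub20₁, N.assoc20₁₁]

theorem map_sub2l₂ {a b₁ b₂ c : M.Obj} (g : M.T₂.Hom b₁ b₂ c) (f : M.L₁.Hom a b₂) :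
    Φ.map₂ (M.sub2l₂ g f) = N.sub2l₂ (Φ.map₂ g) (Φ.mapl₁ f) := by
  rw [← R.desc₁_spec f, M.assoc20₂₁, map_sub30₂, map_sub22₂, map_sub20₁, N.assoc20₂₁]

theorem map_subl2 {a₁ a₂ b c : M.Obj} (g : M.L₁.Hom b c) (f : M.T₂.Hom a₁ a₂ b) :
    Φ.mapl₂ (M.subl2 g f) = N.subl2 (Φ.mapl₁ g) (Φ.map₂ f) := by
  rw [← R.desc₁_spec g, M.comm02, map_sub30₁, map_sub22₂, map_sub20₁, N.comm02]

/-- A tight binary map is `desc f ∘ θ`, and `j` of it is the loose unary map `j (desc f)` with `θ`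
substituted. The claim thus follows from the unary comparison and from `map_subl2`. -/
theorem map_j₂ {a₁ a₂ b : M.Obj} (f : M.T₂.Hom a₁ a₂ b) :
    Φ.mapl₂ (M.j₂ f) = N.j₂ (Φ.map₂ f) := by
  rw [← R.desc_spec f, ← M.subl2_j, map_subl2, map_j₁, N.subl2_j, map₂_natural, Φ.F.map_id,
    Φ.F.map_id]

/-- The morphism of short skew multicategories with given values on classifiers. -/
def toShort : ShortSkewMultifunctor M N where
  F := Φ.F
  T₂ := Φ.map₂
  T₃ := Φ.map₃
  T₄ := Φ.map₄
  L₀ := Φ.mapl₀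
  L₁ := Φ.mapl₁
  L₂ := Φ.mapl₂
  T₂_natural := Φ.map₂_natural
  T₃_natural := Φ.map₃_natural
  T₄_natural := Φ.map₄_natural
  L₀_natural := Φ.mapl₀_natural
  L₁_natural := Φ.mapl₁_natural
  L₂_natural := Φ.mapl₂_natural
  map_j₁ := Φ.map_j₁
  map_j₂ := Φ.map_j₂
  map_sub22₁ := Φ.map_sub22₁
  map_sub22₂ := Φ.map_sub22₂
  map_sub32₁ := Φ.map_sub32₁
  map_sub32₂ := Φ.map_sub32₂
  map_sub32₃ := Φ.map_sub32₃
  map_sub23₁ := Φ.map_sub23₁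
  map_sub23₂ := Φ.map_sub23₂
  map_sub20₁ := Φ.map_sub20₁
  map_sub20₂ := Φ.map_sub20₂
  map_sub30₁ := Φ.map_sub30₁
  map_sub30₂ := Φ.map_sub30₂
  map_sub30₃ := Φ.map_sub30₃
  map_subl0 := Φ.map_subl0
  map_sub2l₁ := Φ.map_sub2l₁
  map_sub2l₂ := Φ.map_sub2l₂
  map_subl2 := Φ.map_subl2

end LaxData

/-! ### Lax monoidal functors as lax data. -/

variable {N : ShortSkewMulticategory.{v, u}} (S : LeftRepresentation N)

/-- The images of the classifiers under a functor with the structure of a lax monoidal functor. -/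
def laxDataMk (F : M.Obj ⥤ N.Obj) (f₀ : S.i ⟶ F.obj R.i)
    (f₂ : ∀ a b, S.m (F.obj a) (F.obj b) ⟶ F.obj (R.m a b))
    (hn : ∀ {a b a' b' : M.Obj} (p : a ⟶ a') (q : b ⟶ b'),
      S.tensorHom (F.map p) (F.map q) ≫ f₂ a' b' = f₂ a b ≫ F.map (R.tensorHom p q))
    (ha : ∀ a b c, S.tensorHom (f₂ a b) (𝟙 (F.obj c)) ≫ f₂ (R.m a b) c ≫ F.map (R.assoc a b c) =
      S.assoc (F.obj a) (F.obj b) (F.obj c) ≫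
        S.tensorHom (𝟙 (F.obj a)) (f₂ b c) ≫ f₂ a (R.m b c))
    (hl : ∀ a, S.tensorHom f₀ (𝟙 (F.obj a)) ≫ f₂ R.i a ≫ F.map (R.leftUnit a) =
      S.leftUnit (F.obj a))
    (hr : ∀ a, S.rightUnit (F.obj a) ≫ S.tensorHom (𝟙 (F.obj a)) f₀ ≫ f₂ a R.i =
      F.map (R.rightUnit a)) : R.LaxData N where
  F := F
  θ a b := N.T₂.act (𝟙 _) (𝟙 _) (f₂ a b) (S.θ (F.obj a) (F.obj b))
  w := N.L₀.act f₀ S.w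
  natural p q := by rw [← S.tensorHom_post, ← post₂, hn]
  map_assoc a b c := by
    -- Maps out of a product bracketed to the left correspond to ternary maps, so the axiom is
    -- evaluated on `θ ∘₁ θ`. The other axioms are evaluated in the same way on their classifiers.
    have := congrArg (fun h => N.sub22₁ (N.T₂.act (𝟙 _) (𝟙 _) h (S.θ _ _)) (S.θ _ _)) (ha a b c)
    rw [S.assoc_post, S.tensorHom_post, S.tensorHom_post, N.sub22₂_dinatural,
      N.sub22₁_dinatural] at this
    rw [← post₂]
    exact this
  map_leftUnit a := by
    have := congrArg (fun h => N.sub20₁ (N.T₂.act (𝟙 _) (𝟙 _) h (S.θ _ _)) S.w) (hl a)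
    rw [S.leftUnit_spec, S.tensorHom_post, N.sub20₁_dinatural] at this
    rw [← post₂]
    exact this
  map_rightUnit a := by
    have e := hr a
    rw [S.rightUnit_post, S.tensorHom_post, N.sub20₂_dinatural] at e
    exact e

/-- The images of the classifiers under a lax monoidal functor. -/
def laxData (Ψ : LaxMonoidalFunctor R.toSkewMonoidal S.toSkewMonoidal) : R.LaxData N :=
  -- Passing the fields separately turns the operations of `toSkewMonoidal` into those of `R` and
  -- `S` by definitional unfolding, so that the lemmas on representations can rewrite them.
  R.laxDataMk S Ψ.F Ψ.f₀ Ψ.f₂ Ψ.f₂_natural Ψ.map_assoc Ψ.map_leftUnit Ψ.map_rightUnit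

/-- The extension takes `θ` to `Ψ.f₂ ∘ θ` and `w` to `Ψ.f₀ ∘ w`, and these equations determine the
structure maps of the induced lax monoidal functor. -/
theorem toLaxMonoidalFunctor_surjective
    (Ψ : LaxMonoidalFunctor R.toSkewMonoidal S.toSkewMonoidal) :
    ∃ F : ShortSkewMultifunctor M N, R.toLaxMonoidalFunctor S F = Ψ := by
  refine ⟨(R.laxData S Ψ).toShort, LaxMonoidalFunctor.ext rfl (heq_of_eq ?_) (heq_of_eq ?_)⟩
  · exact S.hom_ext₀ ((R.map₀_spec S _).trans (LaxData.mapl₀_w (R.laxData S Ψ)))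
  · funext a b
    exact S.hom_ext ((R.map₂_spec S _ a b).trans (LaxData.map₂_θ (R.laxData S Ψ) a b))

end LeftRepresentation

instance faithful_toSkewMonoidalFunctor : toSkewMonoidalFunctor.{v, u}.Faithful where
  map_injective h := InducedCategory.hom_ext
    (LeftRepresentation.toLaxMonoidalFunctor_injective _ _ h)

instance full_toSkewMonoidalFunctor : toSkewMonoidalFunctor.{v, u}.Full where
  map_surjective Ψ := by
    obtain ⟨F, hF⟩ := LeftRepresentation.toLaxMonoidalFunctor_surjective _ _ Ψ
    exact ⟨⟨F⟩, hF⟩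

/-! ### The forgetful functor to short skew multicategories is fully faithful -/

namespace ShortSkewMultifunctor

variable {M N : ShortSkewMulticategory.{v, u}} (F : ShortSkewMultifunctor M N)

theorem map_post {a b c d : M.Obj} (f : c ⟶ d) (t : M.T₂.Hom a b c) :
    N.T₂.act (𝟙 _) (𝟙 _) (F.F.map f) (F.T₂ t) = F.T₂ (M.T₂.act (𝟙 _) (𝟙 _) f t) := by
  rw [F.T₂_natural, F.F.map_id, F.F.map_id]

theorem map_pre₁ {a a' b c : M.Obj} (f : a ⟶ a') (t : M.T₂.Hom a' b c) :
    N.T₂.act (F.F.map f) (𝟙 _) (𝟙 _) (F.T₂ t) = F.T₂ (M.T₂.act f (𝟙 _) (𝟙 _) t) := by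
  rw [F.T₂_natural, F.F.map_id, F.F.map_id]

theorem map_pre₂ {a b b' c : M.Obj} (f : b ⟶ b') (t : M.T₂.Hom a b' c) :
    N.T₂.act (𝟙 _) (F.F.map f) (𝟙 _) (F.T₂ t) = F.T₂ (M.T₂.act (𝟙 _) f (𝟙 _) t) := by
  rw [F.T₂_natural, F.F.map_id, F.F.map_id]

end ShortSkewMultifunctor

namespace SkewMulticategory

variable (C : SkewMulticategory.{v, u})

/-- Commutativity, with the positions given up to equality. -/
theorem sub_comm' {x y z xy xz w : Tightness} {as bs cs ds es fs : List C.Obj} {a b c : C.Obj}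
    {l m r L N R R' : List C.Obj} (hL : L = l ++ as ++ m) (hN : N = l ++ a :: m)
    (hR : R = m ++ b :: r) (hR' : R' = m ++ bs ++ r)
    (e₁ : xy = x.comp l y) (e₂ : w = xy.comp L z) (e₃ : xz = x.comp N z) (e₄ : w = xz.comp l y)
    (hcs : cs = l ++ a :: R) (hds : ds = l ++ as ++ R) (hds' : ds = L ++ b :: r)
    (hfs : fs = L ++ bs ++ r) (hcs' : cs = N ++ b :: r) (hes : es = N ++ bs ++ r)
    (hes' : es = l ++ a :: R') (hfs' : fs = l ++ as ++ R')
    (h : C.Hom x cs c) (g : C.Hom y as a) (f : C.Hom z bs b) :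
    C.sub L r e₂ hds' hfs (C.sub l R e₁ hcs hds h g) f =
      C.sub l R' e₄ hes' hfs' (C.sub N r e₃ hcs' hes h f) g := by
  subst hL hN hR hR'
  exact C.sub_comm _ _ _ _ _ _ _ _ _ _ _ _ _ _ _ _ _ _

/-- Choices of nullary and tight binary map classifiers of a skew multicategory. -/
structure Classifiers where
  i : C.Obj
  u : C.Hom .loose [] i
  u_univ : C.IsLeftUniversal u
  m : C.Obj → C.Obj → C.Obj
  θ : ∀ a b : C.Obj, C.Hom .tight [a, b] (m a b)
  θ_univ : ∀ a b : C.Obj, C.IsLeftUniversal (θ a b)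

theorem nonempty_classifiers (hC : IsLeftRepresentable C) : Nonempty C.Classifiers := by
  obtain ⟨i, u, hu⟩ := hC .loose [] nofun
  choose m θ hθ using fun a b : C.Obj => hC .tight [a, b] (fun _ => nofun)
  exact ⟨⟨i, u, hu, m, θ, hθ⟩⟩

/-! ### Generation of a skew multicategory by tight unary maps and classifiers. -/

namespace Classifiers

variable {C} (G : C.Classifiers)

/-- The inverse of `- ∘₁ θ`. -/
def desc {a b : C.Obj} {r : List C.Obj} {d : C.Obj} (f : C.Hom .tight (a :: b :: r) d) :
    C.Hom .tight (G.m a b :: r) d := ((G.θ_univ a b r d).2 f).choose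

theorem desc_spec {a b : C.Obj} {r : List C.Obj} {d : C.Obj} (f : C.Hom .tight (a :: b :: r) d) :
    C.sub [] r rfl rfl rfl (G.desc f) (G.θ a b) = f := ((G.θ_univ a b r d).2 f).choose_spec

theorem desc_sub {a b : C.Obj} {r : List C.Obj} {d : C.Obj} (g : C.Hom .tight (G.m a b :: r) d) :
    G.desc (C.sub [] r rfl rfl rfl g (G.θ a b)) = g := (G.θ_univ a b r d).1 (G.desc_spec _)

/-- The inverse of `- ∘₁ u`. -/
def descu {r : List C.Obj} {d : C.Obj} (f : C.Hom .loose r d) :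
    C.Hom .tight (G.i :: r) d := ((G.u_univ r d).2 f).choose

theorem descu_spec {r : List C.Obj} {d : C.Obj} (f : C.Hom .loose r d) :
    C.sub [] r rfl rfl rfl (G.descu f) G.u = f := ((G.u_univ r d).2 f).choose_spec

theorem descu_sub {r : List C.Obj} {d : C.Obj} (g : C.Hom .tight (G.i :: r) d) :
    G.descu (C.sub [] r rfl rfl rfl g G.u) = g := (G.u_univ r d).1 (G.descu_spec _)

/-- Factoring through `θ` merges the first two inputs, so the recursion is on the tail of the list
of inputs, with the first input left general. -/
theorem tight_induction {P : ∀ {a : C.Obj} {r : List C.Obj} {d : C.Obj},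
    C.Hom .tight (a :: r) d → Prop} (unary : ∀ {a d : C.Obj} (f : C.Hom .tight [a] d), P f)
    (step : ∀ {a b : C.Obj} {r : List C.Obj} {d : C.Obj} (g : C.Hom .tight (G.m a b :: r) d),
      P g → P (C.sub [] r rfl rfl rfl g (G.θ a b) : C.Hom .tight (a :: b :: r) d)) :
    ∀ {r : List C.Obj} {a : C.Obj} {d : C.Obj} (f : C.Hom .tight (a :: r) d), P f
  | [], _, _, f => unary f
  | _ :: _, _, _, f => G.desc_spec f ▸ step _ (tight_induction unary step (G.desc f))

/-- Every multimap is obtained from tight unary maps and classifiers by substitution in the first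
position. -/
theorem induction {P : ∀ {x : Tightness} {as : List C.Obj} {d : C.Obj}, C.Hom x as d → Prop}
    (unary : ∀ {a d : C.Obj} (f : C.Hom .tight [a] d), P f)
    (step : ∀ {a b : C.Obj} {r : List C.Obj} {d : C.Obj} (g : C.Hom .tight (G.m a b :: r) d),
      P g → P (C.sub [] r rfl rfl rfl g (G.θ a b) : C.Hom .tight (a :: b :: r) d))
    (loose : ∀ {r : List C.Obj} {d : C.Obj} (g : C.Hom .tight (G.i :: r) d),
      P g → P (C.sub [] r rfl rfl rfl g G.u : C.Hom .loose r d)) :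
    ∀ {x : Tightness} {as : List C.Obj} {d : C.Obj} (f : C.Hom x as d), P f
  | .tight, [], d, f => ((C.isEmpty_tight_nil d).false f).elim
  | .tight, _ :: _, _, f => G.tight_induction (P := fun f => P f) unary step f
  | .loose, _, _, f => G.descu_spec f ▸
      loose _ (G.tight_induction (P := fun f => P f) unary step (G.descu f))

/-- Values of a skew multifunctor on tight unary maps and on classifiers. -/
structure ExtensionData (D : SkewMulticategory.{v, u}) where
  obj : C.Obj → D.Obj
  map₁ : ∀ {a b : C.Obj}, C.Hom .tight [a] b → D.Hom .tight [obj a] (obj b)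
  map₁_id : ∀ a : C.Obj, map₁ (C.id a) = D.id (obj a)
  map₁_comp : ∀ {a b c : C.Obj} (g : C.Hom .tight [b] c) (f : C.Hom .tight [a] b),
    map₁ (C.sub [] [] rfl rfl rfl g f) = D.sub [] [] rfl rfl rfl (map₁ g) (map₁ f)
  θ : ∀ a b : C.Obj, D.Hom .tight [obj a, obj b] (obj (G.m a b))
  u : D.Hom .loose [] (obj G.i)
  -- The conditions are implications: if `q` satisfies the equation characterizing a tensored map,
  -- an associator or a left unit map in the source, its image satisfies the corresponding equation
  -- in the target. They involve arities at most three, so a morphism of short skew multicategories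
  -- transports them directly.
  natural₁ : ∀ {a a' b : C.Obj} (p : C.Hom .tight [a] a') (q : C.Hom .tight [G.m a b] (G.m a' b)),
    C.sub (cs := [a, b]) [] [b] rfl rfl rfl (G.θ a' b) p = C.sub [] [] rfl rfl rfl q (G.θ a b) →
    D.sub (z := .tight) (cs := [obj a, obj b]) [] [obj b] rfl rfl rfl (θ a' b) (map₁ p) =
      D.sub [] [] rfl rfl rfl (map₁ q) (θ a b)
  natural₂ : ∀ {a b b' : C.Obj} (p : C.Hom .tight [b] b') (q : C.Hom .tight [G.m a b] (G.m a b')),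
    C.sub (cs := [a, b]) [a] [] rfl rfl rfl (G.θ a b') p = C.sub [] [] rfl rfl rfl q (G.θ a b) →
    D.sub (z := .tight) (cs := [obj a, obj b]) [obj a] [] rfl rfl rfl (θ a b') (map₁ p) =
      D.sub [] [] rfl rfl rfl (map₁ q) (θ a b)
  assoc : ∀ {a b c : C.Obj} (q : C.Hom .tight [G.m (G.m a b) c] (G.m a (G.m b c))),
    C.sub (z := .tight) (cs := [a, b, c]) [a] [] rfl rfl rfl (G.θ a (G.m b c)) (G.θ b c) =
      C.sub [] [c] rfl rfl rfl (C.sub (z := .tight) (cs := [G.m a b, c]) [] [] rfl rfl rfl q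
        (G.θ (G.m a b) c)) (G.θ a b) →
    D.sub (z := .tight) (cs := [obj a, obj b, obj c]) [obj a] [] rfl rfl rfl (θ a (G.m b c))
        (θ b c) =
      D.sub [] [obj c] rfl rfl rfl (D.sub (z := .tight) (cs := [obj (G.m a b), obj c]) [] []
        rfl rfl rfl (map₁ q) (θ (G.m a b) c)) (θ a b)
  leftUnit : ∀ {a : C.Obj} (q : C.Hom .tight [G.m G.i a] a),
    C.sub [] [a] rfl rfl rfl (C.sub (z := .tight) (cs := [G.i, a]) [] [] rfl rfl rfl q (G.θ G.i a))
      G.u = C.j (C.id a) →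
    D.sub [] [obj a] rfl rfl rfl (D.sub (z := .tight) (cs := [obj G.i, obj a]) [] [] rfl rfl rfl
      (map₁ q) (θ G.i a)) u = D.j (D.id (obj a))
  rightUnit : ∀ a : C.Obj, map₁ (C.sub [a] [] rfl rfl rfl (G.θ a G.i) G.u) =
    D.sub [obj a] [] rfl rfl rfl (θ a G.i) u

/-! ### Extension of values on generators to a skew multifunctor. -/

namespace ExtensionData

variable {G} {D : SkewMulticategory.{v, u}} (E : G.ExtensionData D)

/-- The extension to tight multimaps. -/
def mapTight : ∀ {r : List C.Obj} {a d : C.Obj}, C.Hom .tight (a :: r) d →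
    D.Hom .tight (E.obj a :: r.map E.obj) (E.obj d)
  | [], _, _, f => E.map₁ f
  | b :: r, a, _, f => D.sub [] (r.map E.obj) rfl rfl rfl (mapTight (G.desc f)) (E.θ a b)

/-- The extension to multimaps. -/
def map : ∀ {x : Tightness} {as : List C.Obj} {d : C.Obj}, C.Hom x as d →
    D.Hom x (as.map E.obj) (E.obj d)
  | .tight, [], d, f => ((C.isEmpty_tight_nil d).false f).elim
  | .tight, _ :: _, _, f => E.mapTight f
  | .loose, as, _, f => D.sub [] (as.map E.obj) rfl rfl rfl (E.mapTight (G.descu f)) E.u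

theorem map_unary {a d : C.Obj} (f : C.Hom .tight [a] d) : E.map f = E.map₁ f := rfl

theorem map_sub_θ {a b : C.Obj} {r : List C.Obj} {d : C.Obj}
    (g : C.Hom .tight (G.m a b :: r) d) :
    E.map (C.sub [] r rfl rfl rfl g (G.θ a b) : C.Hom .tight (a :: b :: r) d) =
      D.sub [] (r.map E.obj) rfl rfl rfl (E.map g) (E.θ a b) := by
  refine Eq.trans (b := D.sub [] (r.map E.obj) rfl rfl rfl
    (E.mapTight (G.desc (C.sub [] r rfl rfl rfl g (G.θ a b)))) (E.θ a b)) rfl ?_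
  rw [desc_sub]
  rfl

theorem map_sub_u {r : List C.Obj} {d : C.Obj} (g : C.Hom .tight (G.i :: r) d) :
    E.map (C.sub [] r rfl rfl rfl g G.u : C.Hom .loose r d) =
      D.sub [] (r.map E.obj) rfl rfl rfl (E.map g) E.u := by
  refine Eq.trans (b := D.sub [] (r.map E.obj) rfl rfl rfl
    (E.mapTight (G.descu (C.sub [] r rfl rfl rfl g G.u))) E.u) rfl ?_
  rw [descu_sub]
  rfl

/-- The classifier is the identity with itself substituted, so its image is computed by `map_sub_θ`
and preservation of identities. -/
theorem map_θ (a b : C.Obj) : E.map (G.θ a b) = E.θ a b := by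
  have e : C.sub (z := .tight) (cs := [a, b]) [] [] rfl rfl rfl (C.id (G.m a b)) (G.θ a b) =
      G.θ a b := C.id_sub _ _ _ _
  refine (congrArg E.map e).symm.trans ((E.map_sub_θ (C.id (G.m a b))).trans ?_)
  rw [map_unary, E.map₁_id]
  exact D.id_sub _ _ _ _

theorem map_u : E.map G.u = E.u := by
  have e : C.sub (z := .loose) (cs := []) [] [] rfl rfl rfl (C.id G.i) G.u = G.u :=
    C.id_sub _ _ _ _
  refine (congrArg E.map e).symm.trans ((E.map_sub_u (C.id G.i)).trans ?_)
  rw [map_unary, E.map₁_id]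
  exact D.id_sub _ _ _ _

/-- The extension preserves a given substitution. -/
def Preserves {x y : Tightness} {as bs : List C.Obj} {b c : C.Obj} (l r : List C.Obj)
    (g : C.Hom x bs c) (f : C.Hom y as b) : Prop :=
  ∀ {z : Tightness} {cs : List C.Obj} (hz : z = x.comp l y) (hb : bs = l ++ b :: r)
    (hc : cs = l ++ as ++ r) (hz' : z = x.comp (l.map E.obj) y)
    (hb' : bs.map E.obj = l.map E.obj ++ E.obj b :: r.map E.obj)
    (hc' : cs.map E.obj = l.map E.obj ++ as.map E.obj ++ r.map E.obj),
    E.map (C.sub l r hz hb hc g f) =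
      D.sub (l.map E.obj) (r.map E.obj) hz' hb' hc' (E.map g) (E.map f)

/-- The induction is on `g`. Naturality of the classifier gives `θ ∘₁ p = q ∘ θ` with `q` tight
unary, hence `(g ∘₁ θ) ∘₁ p = (g ∘₁ q) ∘₁ θ`, and the induction hypothesis applies to `g` and `q`.
-/
theorem preserves_unary_first {r : List C.Obj} {a b c : C.Obj} (g : C.Hom .tight (b :: r) c)
    (p : C.Hom .tight [a] b) : E.Preserves [] r g p := by
  rintro z cs hz hb hc hz' hb' hc'
  subst hz hc
  refine G.tight_induction (P := fun {b r c} g => ∀ {a : C.Obj} (p : C.Hom .tight [a] b)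
    (hb : b :: r = [] ++ b :: r) (hz') (hb') (hc'),
      E.map (C.sub [] r rfl hb rfl g p) =
        D.sub [] (r.map E.obj) hz' hb' hc' (E.map g) (E.map p)) ?_ ?_ g p hb hz' hb' hc'
  · intro b c g a p _ _ _ _
    exact E.map₁_comp g p
  · intro b b' r c g ih a p _ _ _ _
    -- The map `q` is the tensor product of `p` with the identity of `b'`.
    obtain ⟨q, hq⟩ := (G.θ_univ a b' [] (G.m b b')).2 (C.sub [] [b'] rfl rfl rfl (G.θ b b') p)
    dsimp only at hq
    have e : C.sub (z := .tight) (cs := a :: b' :: r) [] (b' :: r) rfl rfl rfl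
        (C.sub [] r rfl rfl rfl g (G.θ b b')) p =
        C.sub [] r rfl rfl rfl (C.sub (z := .tight) (cs := G.m a b' :: r) [] r rfl rfl rfl g q)
          (G.θ a b') := by
      refine (C.sub_assoc (as := [a]) [] r [] [b'] rfl rfl rfl rfl rfl rfl rfl rfl rfl rfl rfl
        g (G.θ b b') p).symm.trans ?_
      refine (congrArg (fun k : C.Hom .tight [a, b'] (G.m b b') =>
        C.sub (z := .tight) (cs := a :: b' :: r) [] r rfl rfl rfl g k) hq.symm).trans ?_
      exact C.sub_assoc (as := [a, b']) [] r [] [] rfl rfl rfl rfl rfl rfl rfl rfl rfl rfl rfl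
        g q (G.θ a b')
    refine (congrArg E.map e).trans ?_
    refine (E.map_sub_θ _).trans ?_
    refine (congrArg (fun k => D.sub [] (r.map E.obj) rfl rfl rfl k (E.θ a b'))
      (ih q rfl rfl rfl rfl)).trans ?_
    refine Eq.trans ?_ (congrArg (fun k => D.sub [] (E.obj b' :: r.map E.obj) rfl rfl rfl k
      (E.map p)) (E.map_sub_θ g)).symm
    have e' := E.natural₁ p q hq.symm
    refine (D.sub_assoc (as := [E.obj a, E.obj b']) [] (r.map E.obj) [] [] rfl rfl rfl rfl rfl rfl
      rfl rfl rfl rfl rfl (E.map g) (E.map₁ q) (E.θ a b')).symm.trans ?_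
    refine (congrArg (fun k => D.sub (z := .tight) [] (r.map E.obj) rfl rfl rfl (E.map g) k)
      e'.symm).trans ?_
    exact D.sub_assoc (as := [E.obj a]) [] (r.map E.obj) [] [E.obj b'] rfl rfl rfl rfl rfl rfl
      rfl rfl rfl rfl rfl (E.map g) (E.θ b b') (E.map p)

/-- Induction on the inner map: associativity gives `g ∘₁ (f ∘₁ θ) = (g ∘₁ f) ∘₁ θ`, and similarly
for `u`, where the outer substitution is preserved by construction of `E.map`. The unary case is
`preserves_unary_first`. -/
theorem preserves_first {y : Tightness} {as bs r : List C.Obj} {b c : C.Obj}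
    (g : C.Hom .tight bs c) (f : C.Hom y as b) : E.Preserves [] r g f := by
  rintro z cs hz hb hc hz' hb' hc'
  -- At the first position of a tight map the type of the composite is that of the inner map, by
  -- definition.
  obtain rfl : z = y := hz
  subst hb hc
  refine G.induction (P := fun {y as b} f => ∀ {r : List C.Obj} {c : C.Obj}
    (g : C.Hom .tight (b :: r) c) (hz') (hb') (hc'),
      E.map (C.sub (z := y) (cs := as ++ r) [] r rfl rfl rfl g f) =
        D.sub [] (r.map E.obj) hz' hb' hc' (E.map g) (E.map f)) ?_ ?_ ?_ f g hz' hb' hc'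
  · intro a b p r c g hz' hb' hc'
    exact E.preserves_unary_first g p rfl rfl rfl hz' hb' hc'
  · intro a a' s b f ih r c g hz' hb' hc'
    have e : C.sub (z := .tight) (cs := a :: a' :: s ++ r) [] r rfl rfl rfl g
        (C.sub [] s rfl rfl rfl f (G.θ a a')) =
        C.sub [] (s ++ r) rfl rfl rfl (C.sub (z := .tight) (cs := G.m a a' :: (s ++ r)) [] r
          rfl rfl rfl g f) (G.θ a a') :=
      C.sub_assoc (as := [a, a']) [] r [] s rfl rfl rfl rfl rfl rfl rfl rfl rfl rfl rfl
        g f (G.θ a a')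
    refine (congrArg E.map e).trans ?_
    refine (E.map_sub_θ _).trans ?_
    refine (congrArg (fun k => D.sub [] ((s ++ r).map E.obj) rfl rfl rfl k (E.θ a a'))
      (ih g rfl rfl (by simp))).trans ?_
    rw [map_sub_θ]
    exact (D.sub_assoc' (l₁ := []) (r₁ := r.map E.obj) (l₂ := []) (r₂ := s.map E.obj) rfl (by simp)
      rfl rfl rfl rfl rfl rfl (by simp) (by simp) rfl (by simp) (by simp) (E.map g) (E.map f) (E.θ a a')).symm
  · intro s b f ih r c g hz' hb' hc'
    have e : C.sub (z := .loose) (cs := s ++ r) [] r rfl rfl rfl g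
        (C.sub [] s rfl rfl rfl f G.u) =
        C.sub [] (s ++ r) rfl rfl rfl (C.sub (z := .tight) (cs := G.i :: (s ++ r)) [] r
          rfl rfl rfl g f) G.u :=
      C.sub_assoc (as := []) [] r [] s rfl rfl rfl rfl rfl rfl rfl rfl rfl rfl rfl g f G.u
    refine (congrArg E.map e).trans ?_
    refine (E.map_sub_u _).trans ?_
    refine (congrArg (fun k => D.sub [] ((s ++ r).map E.obj) rfl rfl rfl k E.u)
      (ih g rfl rfl (by simp))).trans ?_
    rw [map_sub_u]
    exact (D.sub_assoc' (l₁ := []) (r₁ := r.map E.obj) (l₂ := []) (r₂ := s.map E.obj) rfl (by simp)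
      rfl rfl rfl rfl rfl rfl (by simp) (by simp) rfl (by simp) (by simp) (E.map g) (E.map f) E.u).symm

/-- Every tight `g` with at least two inputs is `k ∘₁ θ`, and `(k ∘₁ θ) ∘₂ f = k ∘₁ (θ ∘₂ f)`; the
outer substitution is covered by `preserves_first`. -/
theorem preserves_second_of_θ {y : Tightness} {as bs r : List C.Obj} {a b c : C.Obj}
    (g : C.Hom .tight bs c) (f : C.Hom y as b)
    (hf : E.Preserves [a] [] (G.θ a b) f) : E.Preserves [a] r g f := by
  rintro z cs hz hb hc hz' hb' hc'
  subst hz hb hc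
  obtain ⟨g, rfl⟩ := (G.θ_univ a b r c).2 g
  have e : C.sub (z := .tight) (cs := [a] ++ as ++ r) [a] r rfl rfl rfl
      (C.sub (z := .tight) (cs := a :: b :: r) [] r rfl rfl rfl g (G.θ a b)) f =
      C.sub [] r rfl rfl (by simp) g (C.sub (z := .tight) [a] [] rfl rfl rfl (G.θ a b) f) :=
    (C.sub_assoc' (by simp) (by simp) _ _ _ _ _ _ _ _ _ _ _ _ _ _).symm
  refine (congrArg E.map e).trans ?_
  refine (E.preserves_first g _ rfl rfl (by simp) rfl rfl (by simp)).trans ?_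
  refine (congrArg (fun k => D.sub [] (r.map E.obj) rfl rfl (by simp) (E.map g) k)
    (hf rfl rfl rfl rfl rfl (by simp))).trans ?_
  refine Eq.trans ?_ (congrArg (fun k => D.sub [E.obj a] (r.map E.obj) rfl rfl (by simp) k
    (E.map f)) (E.map_sub_θ g)).symm
  rw [map_θ]
  exact D.sub_assoc' (by simp) (by simp) _ _ _ _ _ _ _ _ _ _ _ _ _ _

theorem preserves_second_unary {bs r : List C.Obj} {a b b' c : C.Obj}
    (g : C.Hom .tight bs c) (p : C.Hom .tight [b] b') : E.Preserves [a] r g p := by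
  refine E.preserves_second_of_θ g p ?_
  rintro z cs hz hb hc hz' hb' hc'
  subst hz hc
  -- The map `q` is the tensor product of the identity of `a` with `p`.
  obtain ⟨q, hq⟩ := (G.θ_univ a b [] (G.m a b')).2 (C.sub [a] [] rfl rfl rfl (G.θ a b') p)
  dsimp only at hq
  refine (congrArg E.map hq.symm).trans ((E.map_sub_θ q).trans ?_)
  rw [map_θ]
  exact (E.natural₂ p q hq.symm).symm

theorem preserves_second_θ {bs r : List C.Obj} {a a₁ a₂ c : C.Obj}
    (g : C.Hom .tight bs c) : E.Preserves [a] r g (G.θ a₁ a₂) := by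
  refine E.preserves_second_of_θ g _ ?_
  rintro z cs hz hb hc hz' hb' hc'
  subst hz hc
  -- Factoring `θ ∘₂ θ` first through `θ a a₁` and then through `θ (G.m a a₁) a₂` produces the
  -- associator `q`.
  obtain ⟨k, hk⟩ := (G.θ_univ a a₁ [a₂] (G.m a (G.m a₁ a₂))).2
    (C.sub [a] [] rfl rfl rfl (G.θ a (G.m a₁ a₂)) (G.θ a₁ a₂))
  obtain ⟨q, rfl⟩ := (G.θ_univ (G.m a a₁) a₂ [] (G.m a (G.m a₁ a₂))).2 k
  dsimp only at hk
  refine (congrArg E.map hk.symm).trans ((E.map_sub_θ _).trans ?_)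
  rw [map_θ, map_θ]
  refine Eq.trans ?_ (E.assoc q hk.symm).symm
  exact congrArg (fun k => D.sub [] [E.obj a₂] rfl rfl rfl k (E.θ a a₁)) (E.map_sub_θ q)

theorem preserves_second_u {bs r : List C.Obj} {a c : C.Obj}
    (g : C.Hom .tight bs c) : E.Preserves [a] r g G.u := by
  refine E.preserves_second_of_θ g _ ?_
  rintro z cs hz hb hc hz' hb' hc'
  subst hz hc
  rw [map_θ, map_u]
  exact E.rightUnit a

/-- Induction on the inner map: `g ∘₂ (f ∘₁ θ) = (g ∘₂ f) ∘₂ θ`, and likewise for `u`. The outer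
substitution is that of a single classifier, which has been treated for every tight outer map. -/
theorem preserves_second {y : Tightness} {as bs r : List C.Obj} {a b c : C.Obj}
    (g : C.Hom .tight bs c) (f : C.Hom y as b) : E.Preserves [a] r g f := by
  rintro z cs hz hb hc hz' hb' hc'
  obtain rfl : z = .tight := hz
  subst hb hc
  refine G.induction (P := fun {y as b} f => ∀ {r : List C.Obj} {c : C.Obj}
    (g : C.Hom .tight (a :: b :: r) c) (hz') (hb') (hc'),
      E.map (C.sub (z := .tight) (cs := [a] ++ as ++ r) [a] r rfl rfl rfl g f) =
        D.sub [E.obj a] (r.map E.obj) hz' hb' hc' (E.map g) (E.map f)) ?_ ?_ ?_ f g hz' hb' hc'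
  · intro a b p r c g hz' hb' hc'
    exact E.preserves_second_unary g p rfl rfl rfl hz' hb' hc'
  · intro a₁ a₂ s b f ih r c g hz' hb' hc'
    have e : C.sub (z := .tight) (cs := a :: a₁ :: a₂ :: s ++ r) [a] r rfl rfl rfl g
        (C.sub [] s rfl rfl rfl f (G.θ a₁ a₂)) =
        C.sub [a] (s ++ r) rfl rfl rfl (C.sub (z := .tight) (cs := a :: G.m a₁ a₂ :: (s ++ r))
          [a] r rfl rfl rfl g f) (G.θ a₁ a₂) :=
      C.sub_assoc (as := [a₁, a₂]) [a] r [] s rfl rfl rfl rfl rfl rfl rfl rfl rfl rfl rfl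
        g f (G.θ a₁ a₂)
    refine (congrArg E.map e).trans ?_
    refine (E.preserves_second_θ _ rfl rfl rfl rfl rfl (by simp)).trans ?_
    rw [map_θ]
    refine (congrArg (fun k => D.sub [E.obj a] ((s ++ r).map E.obj) rfl rfl rfl k (E.θ a₁ a₂))
      (ih g rfl rfl (by simp))).trans ?_
    rw [map_sub_θ]
    exact (D.sub_assoc' (l₁ := [E.obj a]) (r₁ := r.map E.obj) (l₂ := []) (r₂ := s.map E.obj) rfl (by simp)
      rfl rfl rfl rfl rfl rfl (by simp) (by simp) rfl (by simp) (by simp) (E.map g) (E.map f) (E.θ a₁ a₂)).symm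
  · intro s b f ih r c g hz' hb' hc'
    have e : C.sub (z := .tight) (cs := a :: s ++ r) [a] r rfl rfl rfl g
        (C.sub [] s rfl rfl rfl f G.u) =
        C.sub [a] (s ++ r) rfl rfl rfl (C.sub (z := .tight) (cs := a :: G.i :: (s ++ r)) [a] r
          rfl rfl rfl g f) G.u :=
      C.sub_assoc (as := []) [a] r [] s rfl rfl rfl rfl rfl rfl rfl rfl rfl rfl rfl g f G.u
    refine (congrArg E.map e).trans ?_
    refine (E.preserves_second_u _ rfl rfl rfl rfl rfl (by simp)).trans ?_
    rw [map_u]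
    refine (congrArg (fun k => D.sub [E.obj a] ((s ++ r).map E.obj) rfl rfl rfl k E.u)
      (ih g rfl rfl (by simp))).trans ?_
    rw [map_sub_u]
    exact (D.sub_assoc' (l₁ := [E.obj a]) (r₁ := r.map E.obj) (l₂ := []) (r₂ := s.map E.obj) rfl (by simp)
      rfl rfl rfl rfl rfl rfl (by simp) (by simp) rfl (by simp) (by simp) (E.map g) (E.map f) E.u).symm

/-- When at least two inputs precede the position, `g = k ∘₁ θ` and commutativity gives `(k ∘₁ θ) ∘
f = (k ∘ f) ∘₁ θ` with the position of `f` in `k` one step to the left. The recursion therefore ends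
at the first or the second position. -/
theorem preserves_tight {y : Tightness} {as r : List C.Obj} {b : C.Obj} (f : C.Hom y as b) :
    ∀ (l : List C.Obj) {bs : List C.Obj} {c : C.Obj} (g : C.Hom .tight bs c),
      E.Preserves l r g f
  | [], _, _, g => E.preserves_first g f
  | [_], _, _, g => E.preserves_second g f
  | a :: d :: l, bs, c, g => by
    rename_i z cs
    intro hz hb hc hz' hb' hc'
    obtain rfl : z = .tight := hz
    subst hb hc
    obtain ⟨g, rfl⟩ := (G.θ_univ a d (l ++ b :: r) c).2 g
    have e : C.sub (z := .tight) (cs := a :: d :: l ++ as ++ r) (a :: d :: l) r rfl rfl rfl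
        (C.sub (z := .tight) (cs := a :: d :: (l ++ b :: r)) [] (l ++ b :: r) rfl rfl rfl g
          (G.θ a d)) f =
        C.sub (bs := G.m a d :: (l ++ as ++ r)) [] (l ++ as ++ r) rfl rfl rfl
          (C.sub (z := .tight) (G.m a d :: l) r rfl rfl rfl g f) (G.θ a d) :=
      C.sub_comm' (l := []) (as := [a, d]) (m := l) rfl rfl rfl rfl _ _ _ _ _ _ _ _ _ _ _ _ _ _ _
    refine (congrArg E.map e).trans ?_
    refine (E.map_sub_θ _).trans ?_
    refine (congrArg (fun k => D.sub [] ((l ++ as ++ r).map E.obj) rfl rfl rfl k (E.θ a d))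
      (preserves_tight f (G.m a d :: l) g rfl rfl rfl rfl (by simp) (by simp))).trans ?_
    refine Eq.trans ?_ (congrArg (fun k => D.sub (E.obj a :: E.obj d :: l.map E.obj) (r.map E.obj)
      rfl (by simp) (by simp) k (E.map f)) (E.map_sub_θ g)).symm
    exact (D.sub_comm' rfl rfl (by simp) (by simp) rfl rfl rfl rfl (by simp) (by simp)
      (by simp) (by simp) (by simp) (by simp) (by simp) (by simp) (E.map g) (E.θ a d)
      (E.map f)).symm

/-- A loose outer map is `k ∘₁ u` with `k` tight, and substitution into it is substitution into `k`
one position to the right, followed by substitution of `u`. -/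
theorem preserves {x y : Tightness} {as bs : List C.Obj} {b c : C.Obj} (l r : List C.Obj)
    (g : C.Hom x bs c) (f : C.Hom y as b) : E.Preserves l r g f := by
  cases x with
  | tight => exact E.preserves_tight f l g
  | loose =>
    rintro z cs hz hb hc hz' hb' hc'
    subst hz hb hc
    obtain ⟨g, rfl⟩ := (G.u_univ (l ++ b :: r) c).2 g
    have e : C.sub (z := .loose) (cs := l ++ as ++ r) l r rfl rfl rfl
        (C.sub (z := .loose) (cs := l ++ b :: r) [] (l ++ b :: r) rfl rfl rfl g G.u) f =
        C.sub (bs := G.i :: (l ++ as ++ r)) [] (l ++ as ++ r) rfl rfl rfl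
          (C.sub (z := .tight) (G.i :: l) r rfl rfl rfl g f) G.u :=
      C.sub_comm' (l := []) (as := []) (m := l) rfl rfl rfl rfl _ _ _ _ _ _ _ _ _ _ _ _ _ _ _
    refine (congrArg E.map e).trans ?_
    refine (E.map_sub_u _).trans ?_
    refine (congrArg (fun k => D.sub [] ((l ++ as ++ r).map E.obj) rfl rfl rfl k E.u)
      (E.preserves_tight f (G.i :: l) g rfl rfl rfl rfl (by simp) (by simp))).trans ?_
    refine Eq.trans ?_ (congrArg (fun k => D.sub (l.map E.obj) (r.map E.obj)
      rfl (by simp) (by simp) k (E.map f)) (E.map_sub_u g)).symm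
    exact (D.sub_comm' rfl rfl (by simp) (by simp) rfl rfl rfl rfl (by simp) (by simp)
      (by simp) (by simp) (by simp) (by simp) (by simp) (by simp) (E.map g) E.u (E.map f)).symm

/-- Substitution commutes with `j`, so `f ∘₁ j 1 = j (f ∘₁ 1) = j f`. This makes the comparison a
substitution and reduces its preservation to identities. -/
theorem sub_j_id {K : SkewMulticategory.{v, u}} {a : K.Obj} {r : List K.Obj} {b : K.Obj}
    (f : K.Hom .tight (a :: r) b) :
    K.sub (cs := a :: r) [] r rfl rfl rfl f (K.j (K.id a)) = K.j f := by
  have := K.sub_lift (x := .tight) (x' := .tight) (y := .tight) (y' := .loose) (z := .tight)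
    (z' := .loose) (cs := a :: r) [] r nofun nofun nofun rfl rfl rfl rfl f (K.id a)
  refine this.trans (congrArg K.j (K.sub_id _ _ _ _ _ _))

theorem map_j {as : List C.Obj} {b : C.Obj} (f : C.Hom .tight as b) :
    E.map (C.j f) = D.j (E.map f) := by
  cases as with
  | nil => exact ((C.isEmpty_tight_nil b).false f).elim
  | cons a r =>
    -- Factoring `j 1` through `u` and then through `θ` produces the left unit map `q`, to which the
    -- condition `leftUnit` applies.
    obtain ⟨k, hk⟩ := (G.u_univ [a] a).2 (C.j (C.id a))
    obtain ⟨q, rfl⟩ := (G.θ_univ G.i a [] a).2 k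
    dsimp only at hk
    have e : E.map (C.j (C.id a)) = D.j (D.id (E.obj a)) := by
      rw [← E.leftUnit q hk, ← hk]
      refine (E.map_sub_u _).trans ?_
      exact congrArg (fun k => D.sub [] [E.obj a] rfl rfl rfl k E.u) (E.map_sub_θ q)
    rw [← sub_j_id f]
    refine (E.preserves_first f _ rfl rfl rfl rfl rfl rfl).trans ?_
    rw [e]
    exact sub_j_id (K := D) (E.map f)

/-- The skew multifunctor with given values on tight unary maps and on classifiers. -/
def toSkewMultifunctor : SkewMultifunctor C D where
  obj := E.obj
  map f := E.map f
  map_id := E.map₁_id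
  map_j := E.map_j
  map_sub l r hz hb hc hz' hb' hc' g f := E.preserves l r g f hz hb hc hz' hb' hc'

end ExtensionData

/-- A skew multifunctor is determined by its values on tight unary maps and on classifiers. -/
theorem skewMultifunctor_ext {D : SkewMulticategory.{v, u}} {S T : SkewMultifunctor C D}
    (h : S.obj = T.obj)
    (h₁ : ∀ {a b : C.Obj} (f : C.Hom .tight [a] b), HEq (S.map f) (T.map f))
    (hθ : ∀ a b, HEq (S.map (G.θ a b)) (T.map (G.θ a b))) (hu : HEq (S.map G.u) (T.map G.u)) :
    S = T := by
  obtain ⟨o, m, _, _, s⟩ := S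
  obtain ⟨o', m', _, _, s'⟩ := T
  dsimp only at h h₁ hθ hu s s'
  subst h
  obtain rfl : @m = @m' := by
    funext x as b f
    refine G.induction (P := fun f => m f = m' f) ?_ ?_ ?_ f
    · intro a d f
      exact eq_of_heq (h₁ f)
    · intro a b r d g hg
      refine (s [] r rfl rfl rfl rfl rfl rfl g _).trans ?_
      refine Eq.trans ?_ (s' [] r rfl rfl rfl rfl rfl rfl g _).symm
      rw [hg, eq_of_heq (hθ a b)]
    · intro r d g hg
      refine (s [] r rfl rfl rfl rfl rfl rfl g _).trans ?_
      refine Eq.trans ?_ (s' [] r rfl rfl rfl rfl rfl rfl g _).symm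
      rw [hg, eq_of_heq hu]
  rfl

/-- The values of a morphism of short skew multicategories. -/
def extensionData {D : SkewMulticategory.{v, u}}
    (S : ShortSkewMultifunctor C.toShort D.toShort) : G.ExtensionData D where
  obj a := S.F.obj a
  map₁ f := S.F.map f
  map₁_id a := S.F.map_id a
  map₁_comp g f := S.F.map_comp f g
  θ a b := S.T₂ (G.θ a b)
  u := S.L₀ G.u
  natural₁ {a a' b} p q h := by
    refine (D.multiHom₂_pre₁ _ _).symm.trans ((S.map_pre₁ _ (G.θ a' b)).trans ?_)
    refine Eq.trans (congrArg S.T₂ ?_) ((S.map_post q (G.θ a b)).symm.trans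
      (D.multiHom₂_post _ _))
    exact (C.multiHom₂_pre₁ _ _).trans (h.trans (C.multiHom₂_post _ _).symm)
  natural₂ {a b b'} p q h := by
    refine (D.multiHom₂_pre₂ _ _).symm.trans ((S.map_pre₂ _ (G.θ a b')).trans ?_)
    refine Eq.trans (congrArg S.T₂ ?_) ((S.map_post q (G.θ a b)).symm.trans
      (D.multiHom₂_post _ _))
    exact (C.multiHom₂_pre₂ _ _).trans (h.trans (C.multiHom₂_post _ _).symm)
  assoc {a b c} q h := by
    refine (S.map_sub22₂ (G.θ a (G.m b c)) (G.θ b c)).symm.trans ((congrArg S.T₃ h).trans ?_)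
    refine (S.map_sub22₁ _ (G.θ a b)).trans ?_
    refine congrArg (fun k => D.toShort.sub22₁ k (S.T₂ (G.θ a b))) ?_
    exact (congrArg S.T₂ (C.multiHom₂_post _ _).symm).trans
      ((S.map_post q (G.θ (G.m a b) c)).symm.trans (D.multiHom₂_post _ _))
  leftUnit {a} q h := by
    have e₃ := congrArg D.j (S.F.map_id a)
    refine Eq.trans ?_ ((S.map_sub20₁ _ G.u).symm.trans ((congrArg S.L₁ h).trans
      ((S.map_j₁ (CategoryStruct.id (obj := C.toShort.Obj) a)).trans e₃)))
    refine congrArg (fun k => D.toShort.sub20₁ k (S.L₀ G.u)) ?_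
    exact ((congrArg S.T₂ (C.multiHom₂_post _ _).symm).trans
      ((S.map_post q (G.θ G.i a)).symm.trans (D.multiHom₂_post _ _))).symm
  rightUnit a := S.map_sub20₂ (G.θ a G.i) G.u

/-- The underlying short morphism already contains the values on objects, tight unary maps, `θ` and
`u`, which generate. -/
theorem toShort_injective (G : C.Classifiers) {D : SkewMulticategory.{v, u}} {S T : SkewMultifunctor C D}
    (h : S.toShort = T.toShort) : S = T := by
  have ho : S.obj = T.obj := congrArg (fun K : ShortSkewMultifunctor C.toShort D.toShort =>
    K.F.obj) h
  refine G.skewMultifunctor_ext ho (fun {a b} f => ?_) (fun a b => ?_) ?_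
  · have : HEq (S.toShort.F.map f) (T.toShort.F.map f) := by rw [h]
    exact this
  · have : HEq (S.toShort.T₂ (G.θ a b)) (T.toShort.T₂ (G.θ a b)) := by rw [h]
    exact this
  · have : HEq (S.toShort.L₀ G.u) (T.toShort.L₀ G.u) := by rw [h]
    exact this

/-- The classifiers of the underlying short skew multicategory. -/
def toLeftRepresentation : LeftRepresentation C.toShort where
  i := G.i
  w := G.u
  w_univ := ⟨G.u_univ [], fun x => G.u_univ [x], fun x y => G.u_univ [x, y]⟩
  m := G.m
  θ := G.θ
  θ_univ a b := by
    refine ⟨fun d => ?_, fun x => G.θ_univ a b [x], fun x y => G.θ_univ a b [x, y]⟩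
    have : (fun f : G.m a b ⟶ d => (C.multiHom₂ .tight).act (𝟙 a) (𝟙 b) f (G.θ a b)) =
        fun f => C.sub [] [] rfl rfl rfl f (G.θ a b) :=
      funext fun f => C.multiHom₂_post f (G.θ a b)
    exact this ▸ G.θ_univ a b [] d

/-- The extension agrees with `S` on generators by construction. Uniqueness for short morphisms
gives agreement on all short data, so no comparison in arities three and four is needed. -/
theorem toShort_surjective (G : C.Classifiers) {D : SkewMulticategory.{v, u}}
    (S : ShortSkewMultifunctor C.toShort D.toShort) :
    ∃ T : SkewMultifunctor C D, T.toShort = S :=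
  ⟨(G.extensionData S).toSkewMultifunctor,
    G.toLeftRepresentation.shortSkewMultifunctor_ext rfl
      (fun a b => heq_of_eq ((G.extensionData S).map_θ a b))
      (heq_of_eq (G.extensionData S).map_u)⟩

end Classifiers

end SkewMulticategory

instance faithful_forgetToShortLeftRepresentable :
    forgetToShortLeftRepresentable.{v, u}.Faithful where
  map_injective {C D S T} h := by
    obtain ⟨G⟩ := C.obj.nonempty_classifiers C.property
    exact InducedCategory.hom_ext (G.toShort_injective (congrArg InducedCategory.Hom.hom h))

instance full_forgetToShortLeftRepresentable :
    forgetToShortLeftRepresentable.{v, u}.Full where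
  map_surjective {C D} S := by
    obtain ⟨G⟩ := C.obj.nonempty_classifiers C.property
    obtain ⟨T, hT⟩ := G.toShort_surjective (D := D.obj) S.hom
    exact ⟨⟨T⟩, InducedCategory.hom_ext hT⟩

/-! ### The skew multicategory of a skew monoidal category -/

/-- The objects of a skew monoidal category together with a formal strict unit. -/
inductive Unitization (A : SkewMonoidalCategory.{v, u}) : Type u
  | star : Unitization A
  | of (a : A.Obj) : Unitization A

/-! ### Adjoining a strict unit to a skew monoidal category. -/

namespace Unitization

variable {A : SkewMonoidalCategory.{v, u}}

/-- The morphisms: the only morphism into or out of the formal unit is its identity. -/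
protected def Hom : Unitization A → Unitization A → Type v
  | star, star => PUnit
  | star, of _ => PEmpty
  | of _, star => PEmpty
  | of a, of b => a ⟶ b

instance : Category.{v} (Unitization A) where
  Hom := Unitization.Hom
  id
    | star => PUnit.unit
    | of a => 𝟙 a
  comp {a b c} f g := match a, b, c, f, g with
    | star, star, star, _, _ => PUnit.unit
    | of _, of _, of _, f, g => CategoryStruct.comp (obj := A.Obj) f g
    | star, of _, _, f, _ => PEmpty.elim f
    | of _, star, _, f, _ => PEmpty.elim f
    | star, star, of _, _, g => PEmpty.elim g
    | of _, of _, star, _, g => PEmpty.elim g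
  id_comp {a b} f := by
    cases a <;> cases b
    · rfl
    · exact PEmpty.elim f
    · exact PEmpty.elim f
    · exact Category.id_comp (obj := A.Obj) f
  comp_id {a b} f := by
    cases a <;> cases b
    · rfl
    · exact PEmpty.elim f
    · exact PEmpty.elim f
    · exact Category.comp_id (obj := A.Obj) f
  assoc {a b c d} f g h := by
    cases a <;> cases b <;> try exact PEmpty.elim f
    all_goals cases c <;> try exact PEmpty.elim g
    all_goals cases d <;> try exact PEmpty.elim h
    · rfl
    · exact Category.assoc (obj := A.Obj) f g h

/-- The tensor product, for which the formal unit is strict. -/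
def tensor : Unitization A → Unitization A → Unitization A
  | star, b => b
  | of a, star => of a
  | of a, of b => of (A.tensorObj a b)

/-- The tensor product of morphisms. -/
def tensorMap {a b c d : Unitization A} (f : a ⟶ b) (g : c ⟶ d) : tensor a c ⟶ tensor b d :=
  match a, b, c, d, f, g with
  | star, star, _, _, _, g => g
  | of _, of _, star, star, f, _ => f
  | of _, of _, of _, of _, f, g => A.tensorHom f g
  | star, of _, _, _, f, _ => PEmpty.elim f
  | of _, star, _, _, f, _ => PEmpty.elim f
  | of _, of _, star, of _, _, g => PEmpty.elim g
  | of _, of _, of _, star, _, g => PEmpty.elim g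

theorem tensorMap_id (a b : Unitization A) : tensorMap (𝟙 a) (𝟙 b) = 𝟙 (tensor a b) := by
  cases a with
  | star => rfl
  | of a =>
    cases b with
    | star => rfl
    | of b => exact A.tensorHom_id a b

theorem tensorMap_comp {a b c a' b' c' : Unitization A} (f : a ⟶ b) (g : b ⟶ c) (f' : a' ⟶ b')
    (g' : b' ⟶ c') : tensorMap (f ≫ g) (f' ≫ g') = tensorMap f f' ≫ tensorMap g g' := by
  cases a <;> cases b <;> try exact PEmpty.elim f
  all_goals cases c <;> try exact PEmpty.elim g
  · rfl
  all_goals cases a' <;> cases b' <;> try exact PEmpty.elim f'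
  all_goals cases c' <;> try exact PEmpty.elim g'
  · rfl
  · exact A.tensorHom_comp f g f' g'

/-- The associator. -/
def assoc : ∀ a b c : Unitization A, tensor (tensor a b) c ⟶ tensor a (tensor b c)
  | star, _, _ => 𝟙 _
  | of _, star, _ => 𝟙 _
  | of _, of _, star => 𝟙 _
  | of a, of b, of c => A.assoc a b c

theorem assoc_natural {a b c a' b' c' : Unitization A} (f : a ⟶ a') (g : b ⟶ b') (h : c ⟶ c') :
    tensorMap (tensorMap f g) h ≫ assoc a' b' c' =
      assoc a b c ≫ tensorMap f (tensorMap g h) := by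
  cases a <;> cases a' <;> try exact PEmpty.elim f
  · exact (Category.comp_id _).trans (Category.id_comp _).symm
  all_goals cases b <;> cases b' <;> try exact PEmpty.elim g
  · exact (Category.comp_id _).trans (Category.id_comp _).symm
  all_goals cases c <;> cases c' <;> try exact PEmpty.elim h
  · exact (Category.comp_id _).trans (Category.id_comp _).symm
  · exact A.assoc_natural f g h

/-- If one of the objects is `star`, each associator involving it is an identity, and both sides
collapse to the one remaining associator. Otherwise it is the pentagon of `A`. -/
theorem pentagon (a b c d : Unitization A) :
    assoc (tensor a b) c d ≫ assoc a b (tensor c d) =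
      tensorMap (assoc a b c) (𝟙 d) ≫ assoc a (tensor b c) d ≫ tensorMap (𝟙 a) (assoc b c d) := by
  cases a with
  | star =>
    refine (Category.comp_id _).trans ?_
    change _ = tensorMap (𝟙 (tensor b c)) (𝟙 d) ≫ 𝟙 _ ≫ assoc b c d
    rw [tensorMap_id, Category.id_comp, Category.id_comp]
    rfl
  | of a =>
  cases b with
  | star =>
    refine (Category.comp_id _).trans ?_
    change _ = tensorMap (𝟙 (tensor (of a) c)) (𝟙 d) ≫ assoc (of a) c d ≫
      tensorMap (𝟙 (of a)) (𝟙 (tensor c d))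
    rw [tensorMap_id, tensorMap_id]
    exact ((Category.id_comp _).trans (Category.comp_id _)).symm
  | of b =>
  cases c with
  | star =>
    refine (Category.id_comp _).trans ?_
    change _ = tensorMap (𝟙 (tensor (of a) (of b))) (𝟙 d) ≫ assoc (of a) (of b) d ≫
      tensorMap (𝟙 (of a)) (𝟙 (tensor (of b) d))
    rw [tensorMap_id, tensorMap_id]
    exact ((Category.id_comp _).trans (Category.comp_id _)).symm
  | of c =>
  cases d with
  | star =>
    change 𝟙 _ ≫ assoc (of a) (of b) (of c) = assoc (of a) (of b) (of c) ≫ 𝟙 _ ≫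
      tensorMap (𝟙 (of a)) (𝟙 (tensor (of b) (of c)))
    rw [tensorMap_id, Category.comp_id, Category.id_comp]
    exact (Category.comp_id _).symm
  | of d => exact A.pentagon a b c d

/-- The unit of type `x`: the formal one for tight multimaps and the given one for loose
multimaps. -/
def unit : Tightness → Unitization A
  | .tight => star
  | .loose => of A.unit

/-- The objects on which the unit maps for the unit of type `x` are defined. -/
def Adm : Tightness → Unitization A → Prop
  | .tight, _ => True
  | .loose, star => False
  | .loose, of _ => True

/-- Only the loose type together with `star` is excluded: there the unit maps would have to go
between `star` and the unit of `A`, and no such morphisms exist. All other objects are admissible.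
-/
theorem adm_of (x : Tightness) (a : A.Obj) : Adm x (of a) := by cases x <;> trivial

theorem adm_unit (x : Tightness) : Adm x (unit x : Unitization A) := by cases x <;> trivial

theorem adm_tensor {x : Tightness} {e : Unitization A} (y : Unitization A) (h : Adm x e) :
    Adm x (tensor y e) := by
  cases x with
  | tight => trivial
  | loose => cases y <;> cases e <;> trivial

theorem adm_tensor_of (x : Tightness) (e : Unitization A) (a : A.Obj) :
    Adm x (tensor e (of a)) := adm_tensor e (adm_of x a)

/-- The left unit map for the unit of type `x`. -/
def leftUnit : ∀ (x : Tightness) (e : Unitization A), Adm x e → (tensor (unit x) e ⟶ e)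
  | .tight, _, _ => 𝟙 _
  | .loose, of a, _ => A.leftUnit a
  | .loose, star, h => h.elim

/-- The right unit map for the unit of type `x`. -/
def rightUnit : ∀ (x : Tightness) (e : Unitization A), Adm x e → (e ⟶ tensor e (unit x))
  | .tight, star, _ => 𝟙 _
  | .tight, of _, _ => 𝟙 _
  | .loose, of a, _ => A.rightUnit a
  | .loose, star, h => h.elim

theorem leftUnit_natural {x : Tightness} {e e' : Unitization A} (h : Adm x e) (h' : Adm x e')
    (f : e ⟶ e') : tensorMap (𝟙 (unit x)) f ≫ leftUnit x e' h' = leftUnit x e h ≫ f := by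
  cases x with
  | tight => exact (Category.comp_id _).trans (Category.id_comp _).symm
  | loose =>
    cases e with
    | star => exact h.elim
    | of a =>
      cases e' with
      | star => exact h'.elim
      | of b => exact A.leftUnit_natural f

theorem rightUnit_natural {x : Tightness} {e e' : Unitization A} (h : Adm x e) (h' : Adm x e')
    (f : e ⟶ e') : f ≫ rightUnit x e' h' = rightUnit x e h ≫ tensorMap f (𝟙 (unit x)) := by
  cases x with
  | tight =>
    cases e <;> cases e' <;> try exact PEmpty.elim f
    all_goals exact (Category.comp_id _).trans (Category.id_comp _).symm
  | loose =>
    cases e with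
    | star => exact h.elim
    | of a =>
      cases e' with
      | star => exact h'.elim
      | of b => exact A.rightUnit_natural f

/-- For the tight type the unit is strict and every unit map is an identity. For the loose type this
is the axiom of `A`, except that a factor `star` makes the associator trivial. The other unit axioms
are checked in the same way. -/
theorem unit_left {x : Tightness} {e : Unitization A} (b : Unitization A) (h : Adm x e)
    (h' : Adm x (tensor e b)) :
    assoc (unit x) e b ≫ leftUnit x (tensor e b) h' = tensorMap (leftUnit x e h) (𝟙 b) := by
  cases x with
  | tight => exact (Category.comp_id _).trans (tensorMap_id e b).symm
  | loose =>
    cases e with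
    | star => exact h.elim
    | of a =>
      cases b with
      | star => exact Category.id_comp (A.leftUnit a)
      | of b => exact A.unit_left a b

theorem unit_right {x : Tightness} {e : Unitization A} (y : Unitization A) (h : Adm x e)
    (h' : Adm x (tensor y e)) :
    rightUnit x (tensor y e) h' ≫ assoc y e (unit x) = tensorMap (𝟙 y) (rightUnit x e h) := by
  cases x with
  | tight =>
    cases y with
    | star => exact Category.comp_id _
    | of y =>
      cases e with
      | star => exact Category.comp_id _
      | of e => exact (Category.comp_id _).trans (tensorMap_id (of y) (of e)).symm
  | loose =>
    cases e with
    | star => exact h.elim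
    | of a =>
      cases y with
      | star => exact Category.comp_id _
      | of y => exact A.unit_right y a

theorem unit_middle {x : Tightness} {e b : Unitization A} (h : Adm x e) (h' : Adm x b) :
    tensorMap (rightUnit x e h) (𝟙 b) ≫ assoc e (unit x) b ≫ tensorMap (𝟙 e) (leftUnit x b h') =
      𝟙 (tensor e b) := by
  cases x with
  | tight =>
    cases e with
    | star =>
      refine (Category.id_comp _).trans (Category.id_comp _)
    | of a =>
      change tensorMap (𝟙 (of a)) (𝟙 b) ≫ 𝟙 _ ≫ tensorMap (𝟙 (of a)) (𝟙 b) = _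
      rw [tensorMap_id]
      exact (Category.id_comp _).trans (Category.id_comp _)
  | loose =>
    cases e with
    | star => exact h.elim
    | of a =>
      cases b with
      | star => exact h'.elim
      | of b => exact A.unit_middle a b

theorem unit_unit (x : Tightness) (h : Adm x (unit x : Unitization A)) :
    rightUnit x (unit x) h ≫ leftUnit x (unit x) h = 𝟙 (unit x : Unitization A) := by
  cases x with
  | tight => rfl
  | loose => exact A.unit_unit

/-! ### Left-bracketed tensor products and iterated associators. -/

/-- The tensor product of an object with a list of objects, bracketed to the left. -/
def fold : Unitization A → List A.Obj → Unitization A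
  | e, [] => e
  | e, a :: as => fold (tensor e (of a)) as

/-- The action of `fold` on morphisms. -/
def foldMap : ∀ (as : List A.Obj) {e e' : Unitization A}, (e ⟶ e') → (fold e as ⟶ fold e' as)
  | [], _, _, f => f
  | a :: as, _, _, f => foldMap as (tensorMap f (𝟙 (of a)))

theorem adm_fold {x : Tightness} : ∀ (l : List A.Obj) {e : Unitization A}, Adm x e →
    Adm x (fold e l)
  | [], _, h => h
  | a :: l, e, _ => adm_fold l (adm_tensor_of x e a)

/-- This is where the rule for the type of a substitution matters: it makes the component of the
inner map at `fold e l` and that of the outer map at `e` available whenever the composite is to have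
a component at `e`. A nonempty `l` makes `fold e l` different from `star`, whence the inner map may
be loose even if the composite is tight. -/
theorem adm_fold_of_comp {x y : Tightness} {e : Unitization A} :
    ∀ {l : List A.Obj}, Adm (x.comp l y) e → Adm x e ∧ Adm y (fold e l)
  | [], h => by
    cases x <;> cases y <;> cases e <;> first | exact ⟨trivial, trivial⟩ | exact h.elim
  | a :: l, h => by
    refine ⟨?_, adm_fold l (adm_tensor_of y e a)⟩
    cases x <;> trivial

@[simp]
theorem foldMap_id (as : List A.Obj) : ∀ (e : Unitization A), foldMap as (𝟙 e) = 𝟙 (fold e as) := by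
  induction as with
  | nil => exact fun e => rfl
  | cons a as ih =>
    intro e
    refine (congrArg (foldMap as) (tensorMap_id e (of a))).trans (ih _)

@[simp]
theorem foldMap_comp (as : List A.Obj) : ∀ {e e' e'' : Unitization A} (f : e ⟶ e') (g : e' ⟶ e''),
    foldMap as (f ≫ g) = foldMap as f ≫ foldMap as g := by
  induction as with
  | nil => exact fun _ _ => rfl
  | cons a as ih =>
    intro e e' e'' f g
    refine Eq.trans (congrArg (foldMap as) ?_) (ih _ _)
    rw [← tensorMap_comp, Category.comp_id]

@[simp]
theorem foldMap_eqToHom (as : List A.Obj) {e e' : Unitization A} (h : e = e') :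
    foldMap as (eqToHom h) = eqToHom (congrArg (fun e => fold e as) h) := by
  subst h; simp

@[simp]
theorem tensorMap_eqToHom (y : Unitization A) {e e' : Unitization A} (h : e = e') :
    tensorMap (𝟙 y) (eqToHom h) = eqToHom (congrArg (tensor y) h) := by
  subst h; exact tensorMap_id _ _

theorem id_tensorMap_comp (y : Unitization A) {a b c : Unitization A} (f : a ⟶ b) (g : b ⟶ c) :
    tensorMap (𝟙 y) (f ≫ g) = tensorMap (𝟙 y) f ≫ tensorMap (𝟙 y) g := by
  rw [← tensorMap_comp, Category.comp_id]

/-- Concatenation holds as an equality of objects, so it enters later composites only through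
`eqToHom`. -/
theorem fold_append : ∀ (e : Unitization A) (l r : List A.Obj),
    fold e (l ++ r) = fold (fold e l) r
  | _, [], _ => rfl
  | e, a :: l, r => fold_append (tensor e (of a)) l r

theorem foldMap_append (l r : List A.Obj) : ∀ {e e' : Unitization A} (f : e ⟶ e'),
    foldMap (l ++ r) f = eqToHom (fold_append e l r) ≫ foldMap r (foldMap l f) ≫
      eqToHom (fold_append e' l r).symm := by
  induction l with
  | nil =>
    intro e e' f
    change foldMap r f = eqToHom rfl ≫ foldMap r f ≫ eqToHom rfl
    simp
  | cons a l ih => intro e e' f; exact ih _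

/-- The iterated associator. -/
def foldAssoc : ∀ (y e : Unitization A) (as : List A.Obj), fold (tensor y e) as ⟶
    tensor y (fold e as)
  | _, _, [] => 𝟙 _
  | y, e, a :: as => foldMap as (assoc y e (of a)) ≫ foldAssoc y (tensor e (of a)) as

theorem foldAssoc_natural (as : List A.Obj) : ∀ {y y' e e' : Unitization A} (f : y ⟶ y')
    (g : e ⟶ e'), foldMap as (tensorMap f g) ≫ foldAssoc y' e' as =
      foldAssoc y e as ≫ tensorMap f (foldMap as g) := by
  induction as with
  | nil => exact fun _ _ => (Category.comp_id _).trans (Category.id_comp _).symm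
  | cons a as ih =>
    intro y y' e e' f g
    change foldMap as (tensorMap (tensorMap f g) (𝟙 (of a))) ≫
      foldMap as (assoc y' e' (of a)) ≫ foldAssoc y' (tensor e' (of a)) as =
      (foldMap as (assoc y e (of a)) ≫ foldAssoc y (tensor e (of a)) as) ≫
        tensorMap f (foldMap as (tensorMap g (𝟙 (of a))))
    rw [← Category.assoc, ← foldMap_comp, assoc_natural, foldMap_comp, Category.assoc, ih,
      Category.assoc]

/-- Iteration of `unit_left`, one letter of the list at a time. -/
theorem foldAssoc_leftUnit (x : Tightness) (as : List A.Obj) : ∀ {e : Unitization A}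
    (h : Adm x e) (h' : Adm x (fold e as)),
    foldAssoc (unit x) e as ≫ leftUnit x (fold e as) h' = foldMap as (leftUnit x e h) := by
  induction as with
  | nil => exact fun _ _ => Category.id_comp _
  | cons a as ih =>
    intro e h h'
    refine (Category.assoc _ _ _).trans ?_
    refine (congrArg (foldMap as (assoc (unit x) e (of a)) ≫ ·)
      (ih (adm_tensor_of x e a) h')).trans ?_
    refine (foldMap_comp as _ _).symm.trans (congrArg (foldMap as) ?_)
    exact unit_left (of a) h _

/-- The pentagon handles the first letter; naturality of the iterated associator then makes room for
the induction hypothesis. -/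
theorem foldAssoc_pentagon (y z : Unitization A) (as : List A.Obj) : ∀ (e : Unitization A),
    foldAssoc (tensor y z) e as ≫ assoc y z (fold e as) =
      foldMap as (assoc y z e) ≫ foldAssoc y (tensor z e) as ≫
        tensorMap (𝟙 y) (foldAssoc z e as) := by
  induction as with
  | nil =>
    intro e
    change 𝟙 _ ≫ assoc y z e = assoc y z e ≫ 𝟙 _ ≫ tensorMap (𝟙 y) (𝟙 _)
    rw [tensorMap_id]; simp
  | cons a as ih =>
    intro e
    change (foldMap as (assoc (tensor y z) e (of a)) ≫
        foldAssoc (tensor y z) (tensor e (of a)) as) ≫ assoc y z (fold (tensor e (of a)) as) =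
      foldMap as (tensorMap (assoc y z e) (𝟙 (of a))) ≫
        (foldMap as (assoc y (tensor z e) (of a)) ≫
          foldAssoc y (tensor (tensor z e) (of a)) as) ≫
        tensorMap (𝟙 y) (foldMap as (assoc z e (of a)) ≫ foldAssoc z (tensor e (of a)) as)
    rw [id_tensorMap_comp, Category.assoc, Category.assoc, ih, ← Category.assoc, ← foldMap_comp,
      pentagon, foldMap_comp, foldMap_comp]
    simp only [Category.assoc]
    rw [← Category.assoc (foldMap as (tensorMap (𝟙 y) (assoc z e (of a)))), foldAssoc_natural]
    simp only [Category.assoc]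

theorem foldAssoc_append (y : Unitization A) (l r : List A.Obj) : ∀ (e : Unitization A),
    foldAssoc y e (l ++ r) = eqToHom (fold_append _ l r) ≫ foldMap r (foldAssoc y e l) ≫
      foldAssoc y (fold e l) r ≫ eqToHom (congrArg (tensor y) (fold_append e l r).symm) := by
  induction l with
  | nil =>
    intro e
    change foldAssoc y e r = eqToHom rfl ≫ foldMap r (𝟙 _) ≫ foldAssoc y e r ≫ eqToHom rfl
    simp
  | cons a l ih =>
    intro e
    change foldMap (l ++ r) (assoc y e (of a)) ≫ foldAssoc y (tensor e (of a)) (l ++ r) =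
      eqToHom _ ≫ foldMap r (foldMap l (assoc y e (of a)) ≫ foldAssoc y (tensor e (of a)) l) ≫
        foldAssoc y (fold (tensor e (of a)) l) r ≫ eqToHom _
    rw [ih, foldMap_append, foldMap_comp]
    simp

/-! ### Multimaps as natural families, and their substitution. -/

/-- The component at `e` of the natural transformation induced by a multimap. -/
def ext {x : Tightness} {as : List A.Obj} {b : A.Obj} (f : fold (unit x) as ⟶ of b)
    (e : Unitization A) (h : Adm x e) : fold e as ⟶ tensor e (of b) :=
  foldMap as (rightUnit x e h) ≫ foldAssoc e (unit x) as ≫ tensorMap (𝟙 e) f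

theorem ext_natural {x : Tightness} {as : List A.Obj} {b : A.Obj} (f : fold (unit x) as ⟶ of b)
    {e e' : Unitization A} (h : Adm x e) (h' : Adm x e') (k : e ⟶ e') :
    foldMap as k ≫ ext f e' h' = ext f e h ≫ tensorMap k (𝟙 (of b)) := by
  rw [ext, ext, ← Category.assoc, ← foldMap_comp, rightUnit_natural h h', foldMap_comp,
    Category.assoc, ← Category.assoc (foldMap as (tensorMap _ _)), foldAssoc_natural]
  simp only [Category.assoc, foldMap_id, ← tensorMap_comp, Category.id_comp, Category.comp_id]

/-- The iterated associators are matched by `foldAssoc_pentagon` and the right unit maps by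
`unit_right`. Together with `ext_natural`, this compatibility characterizes the families induced by
multimaps. -/
theorem ext_assoc {x : Tightness} {as : List A.Obj} {b : A.Obj} (f : fold (unit x) as ⟶ of b)
    (y : Unitization A) {e : Unitization A} (h : Adm x e) (h' : Adm x (tensor y e)) :
    ext f (tensor y e) h' ≫ assoc y e (of b) =
      foldAssoc y e as ≫ tensorMap (𝟙 y) (ext f e h) := by
  rw [ext, ext, Category.assoc, Category.assoc, ← tensorMap_id, assoc_natural,
    ← Category.assoc (foldAssoc _ _ _), foldAssoc_pentagon, id_tensorMap_comp, id_tensorMap_comp,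
    ← Category.assoc (foldAssoc y e as), ← foldAssoc_natural, ← unit_right y h h', foldMap_comp]
  simp only [Category.assoc]

/-- Naturality moves the left unit map past `f`, where it absorbs the iterated associator, and
`unit_unit` cancels the rest. So a multimap is recovered from its family. -/
theorem ext_leftUnit {x : Tightness} {as : List A.Obj} {b : A.Obj} (f : fold (unit x) as ⟶ of b)
    (h : Adm x (unit x : Unitization A)) (h' : Adm x (of b)) :
    ext f (unit x) h ≫ leftUnit x (of b) h' = f := by
  rw [ext, Category.assoc, Category.assoc, leftUnit_natural (adm_fold as h),
    ← Category.assoc (foldAssoc _ _ _), foldAssoc_leftUnit x as h, ← Category.assoc,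
    ← foldMap_comp, unit_unit, foldMap_id, Category.id_comp]

/-- A family compatible with morphisms and with tensoring on the left is induced by a multimap. -/
theorem ext_unique {x : Tightness} {as : List A.Obj} {b : A.Obj}
    (t : ∀ e : Unitization A, Adm x e → (fold e as ⟶ tensor e (of b)))
    (ht : ∀ {e e' : Unitization A} (h : Adm x e) (h' : Adm x e') (k : e ⟶ e'),
      foldMap as k ≫ t e' h' = t e h ≫ tensorMap k (𝟙 (of b)))
    (ht' : ∀ (y : Unitization A) {e : Unitization A} (h : Adm x e) (h' : Adm x (tensor y e)),
      t (tensor y e) h' ≫ assoc y e (of b) = foldAssoc y e as ≫ tensorMap (𝟙 y) (t e h))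
    (e : Unitization A) (h : Adm x e) :
    ext (t (unit x) (adm_unit x) ≫ leftUnit x (of b) (adm_of x b)) e h = t e h := by
  -- Compatibility with tensoring by `e` replaces the component at the unit by the one at `e` times
  -- the unit, naturality along the right unit map brings it back to `e`, and `unit_middle` cancels
  -- the unit maps that remain.
  rw [ext, id_tensorMap_comp, ← Category.assoc (foldAssoc _ _ _),
    ← ht' e (adm_unit x) (adm_tensor e (adm_unit x)), Category.assoc,
    ← Category.assoc (foldMap _ _), ht h, Category.assoc, unit_middle, Category.comp_id]

theorem ext_congr {x : Tightness} {as : List A.Obj} {b : A.Obj} (f : fold (unit x) as ⟶ of b)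
    {e e' : Unitization A} (h : Adm x e) (h' : Adm x e') (k : e = e') :
    ext f e h = eqToHom (congrArg (fun e => fold e as) k) ≫ ext f e' h' ≫
      eqToHom (congrArg (fun e => tensor e (of b)) k.symm) := by
  subst k; simp

/-- The family determines the multimap. The axioms of a skew multicategory are all proved by
comparing components. -/
theorem hom_ext {x : Tightness} {as : List A.Obj} {b : A.Obj} {f g : fold (unit x) as ⟶ of b}
    (h : ∀ (e : Unitization A) (he : Adm x e), ext f e he = ext g e he) : f = g := by
  rw [← ext_leftUnit f (adm_unit x) (adm_of x b), ← ext_leftUnit g (adm_unit x) (adm_of x b), h]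

theorem fold_sub {as cs : List A.Obj} {l r : List A.Obj} (hc : cs = l ++ as ++ r)
    (e : Unitization A) : fold e cs = fold (fold (fold e l) as) r := by
  rw [hc, fold_append, fold_append]

theorem fold_cons {bs : List A.Obj} {b : A.Obj} {l r : List A.Obj} (hb : bs = l ++ b :: r)
    (e : Unitization A) : fold (tensor (fold e l) (of b)) r = fold e bs := by
  rw [hb, fold_append]; rfl

theorem foldMap_sub {as cs : List A.Obj} {l r : List A.Obj} (hc : cs = l ++ as ++ r)
    {e e' : Unitization A} (k : e ⟶ e') : foldMap cs k = eqToHom (fold_sub hc e) ≫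
      foldMap r (foldMap as (foldMap l k)) ≫ eqToHom (fold_sub hc e').symm := by
  subst hc
  rw [foldMap_append, foldMap_append]
  simp

theorem foldMap_cons {bs : List A.Obj} {b : A.Obj} {l r : List A.Obj} (hb : bs = l ++ b :: r)
    {e e' : Unitization A} (k : e ⟶ e') : foldMap bs k = eqToHom (fold_cons hb e).symm ≫
      foldMap r (tensorMap (foldMap l k) (𝟙 (of b))) ≫ eqToHom (fold_cons hb e') := by
  subst hb
  exact foldMap_append l (b :: r) k

theorem foldAssoc_congr (y : Unitization A) (as : List A.Obj) {e e' : Unitization A} (h : e = e') :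
    foldAssoc y e as = eqToHom (congrArg (fun e => fold (tensor y e) as) h) ≫
      foldAssoc y e' as ≫ eqToHom (congrArg (fun e => tensor y (fold e as)) h.symm) := by
  subst h; simp

theorem foldAssoc_sub {as cs : List A.Obj} {l r : List A.Obj} (hc : cs = l ++ as ++ r)
    (y e : Unitization A) : foldAssoc y e cs = eqToHom (fold_sub hc _) ≫
      foldMap r (foldMap as (foldAssoc y e l)) ≫ foldMap r (foldAssoc y (fold e l) as) ≫
        foldAssoc y (fold (fold e l) as) r ≫
          eqToHom (congrArg (tensor y) (fold_sub hc e).symm) := by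
  subst hc
  rw [foldAssoc_append, foldAssoc_append, foldAssoc_congr y r (fold_append e l as)]
  simp

theorem foldAssoc_cons {bs : List A.Obj} {b : A.Obj} {l r : List A.Obj} (hb : bs = l ++ b :: r)
    (y e : Unitization A) : foldAssoc y e bs = eqToHom (fold_cons hb _).symm ≫
      foldMap r (tensorMap (foldAssoc y e l) (𝟙 (of b))) ≫
        foldMap r (assoc y (fold e l) (of b)) ≫ foldAssoc y (tensor (fold e l) (of b)) r ≫
          eqToHom (congrArg (tensor y) (fold_cons hb e)) := by
  subst hb
  refine (foldAssoc_append y l (b :: r) e).trans ?_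
  congr 1
  exact congrArg (foldMap r (tensorMap (foldAssoc y e l) (𝟙 (of b))) ≫ ·)
    (Category.assoc (foldMap r (assoc y (fold e l) (of b))) _ _)

/-- The components of the natural transformation induced by a substitution. -/
def subFamily {x y z : Tightness} {as bs cs : List A.Obj} {b c : A.Obj} (l r : List A.Obj)
    (hz : z = x.comp l y) (hb : bs = l ++ b :: r) (hc : cs = l ++ as ++ r)
    (g : fold (unit x) bs ⟶ of c) (f : fold (unit y) as ⟶ of b) (e : Unitization A)
    (h : Adm z e) : fold e cs ⟶ tensor e (of c) :=
  eqToHom (fold_sub hc e) ≫ foldMap r (ext f (fold e l) (adm_fold_of_comp (hz ▸ h)).2) ≫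
    eqToHom (fold_cons hb e) ≫ ext g e (adm_fold_of_comp (hz ▸ h)).1

/-- Substitution of multimaps. -/
def sub {x y z : Tightness} {as bs cs : List A.Obj} {b c : A.Obj} (l r : List A.Obj)
    (hz : z = x.comp l y) (hb : bs = l ++ b :: r) (hc : cs = l ++ as ++ r)
    (g : fold (unit x) bs ⟶ of c) (f : fold (unit y) as ⟶ of b) : fold (unit z) cs ⟶ of c :=
  subFamily l r hz hb hc g f (unit z) (adm_unit z) ≫ leftUnit z (of c) (adm_of z c)

/-- The composite family is again natural and compatible with tensoring on the left, so it is the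
family of the multimap read off at the unit. Substitution thereby becomes composition of components.
-/
theorem ext_sub {x y z : Tightness} {as bs cs : List A.Obj} {b c : A.Obj} (l r : List A.Obj)
    (hz : z = x.comp l y) (hb : bs = l ++ b :: r) (hc : cs = l ++ as ++ r)
    (g : fold (unit x) bs ⟶ of c) (f : fold (unit y) as ⟶ of b) (e : Unitization A)
    (h : Adm z e) : ext (sub l r hz hb hc g f) e h = subFamily l r hz hb hc g f e h := by
  refine ext_unique (subFamily l r hz hb hc g f) ?_ ?_ e h
  · intro e e' h h' k
    subst hz
    have e₁ := congrArg (foldMap r) (ext_natural f (adm_fold_of_comp h).2 (adm_fold_of_comp h').2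
      (foldMap l k))
    rw [foldMap_comp, foldMap_comp] at e₁
    rw [subFamily, subFamily, foldMap_sub hc]
    simp only [Category.assoc, eqToHom_trans_assoc, eqToHom_refl, Category.id_comp]
    rw [reassoc_of% e₁, ← ext_natural g (adm_fold_of_comp h).1 (adm_fold_of_comp h').1 k,
      foldMap_cons hb]
    simp
  · intro y e h h'
    subst hz
    have a₁ := adm_fold_of_comp h
    have a₂ := adm_fold_of_comp h'
    -- The associator past `cs` splits at `l`, `as` and `r`: `e₁` carries the part for `l` past `f`
    -- by naturality, `e₄` handles the part for `as` by compatibility of `f` with tensoring, and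
    -- `e₅` the part for `r` by naturality of the iterated associator.
    have e₁ := congrArg (foldMap r) (ext_natural f a₂.2 (adm_tensor y a₁.2) (foldAssoc y e l))
    have e₄ := congrArg (foldMap r) (ext_assoc f y a₁.2 (adm_tensor y a₁.2))
    have e₅ := foldAssoc_natural r (𝟙 y) (ext f (fold e l) a₁.2)
    rw [foldMap_comp, foldMap_comp] at e₁ e₄
    rw [subFamily, subFamily, foldAssoc_sub hc]
    simp only [id_tensorMap_comp, tensorMap_eqToHom]
    simp only [Category.assoc, ext_assoc g y a₁.1 a₂.1, foldAssoc_cons hb]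
    simp only [eqToHom_trans_assoc, eqToHom_refl, Category.id_comp]
    rw [← reassoc_of% e₁, reassoc_of% e₄, reassoc_of% e₅]

/-- The transformation induced by an identity is the identity. -/
theorem ext_id (a : A.Obj) (e : Unitization A) (h : Adm .tight e) :
    ext (x := .tight) (as := [a]) (𝟙 (of a)) e h = 𝟙 (tensor e (of a)) :=
  (congrArg (fun k => tensorMap (rightUnit .tight e h) (𝟙 (of a)) ≫ k)
    ((congrArg (· ≫ tensorMap (𝟙 e) (𝟙 (of a))) (Category.comp_id (assoc e star (of a)))))).trans
    (unit_middle (x := .tight) h trivial)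

/-- The comparison from tight to loose multimaps. -/
def comparison {as : List A.Obj} {b : A.Obj} (f : fold (unit .tight) as ⟶ of b) :
    fold (unit .loose) as ⟶ of b :=
  ext f (unit .loose) trivial ≫ leftUnit .loose (of b) trivial

/-- Viewing a tight map as loose restricts its family to the objects other than `star`; no component
changes. -/
theorem ext_comparison {as : List A.Obj} {b : A.Obj} (f : fold (unit .tight) as ⟶ of b)
    (e : Unitization A) (h : Adm .loose e) : ext (comparison f) e h = ext f e trivial :=
  ext_unique (x := .loose) (fun e _ => ext f e trivial) (fun _ _ k => ext_natural f _ _ k)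
    (fun y _ _ _ => ext_assoc f y _ _) e h

end Unitization

/-! ### The axioms of a skew multicategory. -/

namespace Unitization

variable {A : SkewMonoidalCategory.{v, u}}

theorem adm_of_le {x y : Tightness} (h : x.Le y) {e : Unitization A} (he : Adm y e) : Adm x e := by
  cases x with
  | tight => trivial
  | loose =>
    obtain rfl : y = .loose := h rfl
    exact he

theorem ext_lift {x y : Tightness} (h : x.Le y) {as : List A.Obj} {b : A.Obj}
    (f : fold (unit x) as ⟶ of b) (e : Unitization A) (he : Adm y e) :
    ext (Tightness.lift (H := fun t => (fold (unit t) as ⟶ of b)) comparison h f) e he =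
      ext f e (adm_of_le h he) := by
  cases x <;> cases y
  · rfl
  · exact ext_comparison f e he
  · exact nomatch h rfl
  · rfl

theorem sub_lift {x x' y y' z z' : Tightness} {as bs cs : List A.Obj} {b c : A.Obj}
    (l r : List A.Obj) (hx : x.Le x') (hy : y.Le y') (hz : z.Le z') (e : z = x.comp l y)
    (e' : z' = x'.comp l y') (hb : bs = l ++ b :: r) (hc : cs = l ++ as ++ r)
    (g : fold (unit x) bs ⟶ of c) (f : fold (unit y) as ⟶ of b) :
    sub l r e' hb hc (Tightness.lift (H := fun t => (fold (unit t) bs ⟶ of c)) comparison hx g)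
        (Tightness.lift (H := fun t => (fold (unit t) as ⟶ of b)) comparison hy f) =
      Tightness.lift (H := fun t => (fold (unit t) cs ⟶ of c)) comparison hz
        (sub l r e hb hc g f) := by
  refine hom_ext fun k hk => ?_
  rw [ext_sub, ext_lift, ext_sub, subFamily, subFamily, ext_lift, ext_lift]

/-- The identity multimap. -/
def identity (a : A.Obj) : fold (unit .tight) [a] ⟶ of a := 𝟙 (of a)

theorem ext_identity (a : A.Obj) (e : Unitization A) (h : Adm .tight e) :
    ext (identity a) e h = 𝟙 (tensor e (of a)) := ext_id a e h

theorem id_sub {x : Tightness} {as : List A.Obj} {b : A.Obj} (hz : x = Tightness.comp .tight [] x)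
    (hb : [b] = [] ++ b :: []) (hc : as = [] ++ as ++ []) (f : fold (unit x) as ⟶ of b) :
    sub [] [] hz hb hc (identity b) f = f := by
  refine hom_ext fun e he => ?_
  rw [ext_sub, subFamily, ext_identity]
  exact (Category.id_comp _).trans ((congrArg (ext f e he ≫ ·) (Category.id_comp _)).trans
    (Category.comp_id _))

theorem sub_id {x : Tightness} {bs : List A.Obj} {b c : A.Obj} (l r : List A.Obj)
    (hz : x = x.comp l .tight) (hb : bs = l ++ b :: r) (hc : bs = l ++ [b] ++ r)
    (g : fold (unit x) bs ⟶ of c) : sub l r hz hb hc g (identity b) = g := by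
  refine hom_ext fun e he => ?_
  rw [ext_sub, subFamily, ext_identity]
  refine (congrArg (fun k => eqToHom (fold_sub hc e) ≫ k ≫ eqToHom (fold_cons hb e) ≫ ext g e he)
    (foldMap_id r (tensor (fold e l) (of b)))).trans ?_
  refine (congrArg (eqToHom (fold_sub hc e) ≫ ·) (Category.id_comp _)).trans ?_
  exact (eqToHom_trans_assoc _ _ _).trans (Category.id_comp _)

/-- Both sides have as components the composite of a component of `f`, one of `g` and one of `h`;
the bracketings of the lists differ only by `eqToHom`. -/
theorem sub_assoc {x y z xy yz w : Tightness} {as bs cs ds es fs : List A.Obj} {a b c : A.Obj}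
    (l₁ r₁ l₂ r₂ : List A.Obj) (e₁ : xy = x.comp l₁ y) (e₂ : w = xy.comp (l₁ ++ l₂) z)
    (e₃ : yz = y.comp l₂ z) (e₄ : w = x.comp l₁ yz) (hcs : cs = l₁ ++ b :: r₁)
    (hbs : bs = l₂ ++ a :: r₂) (hds : ds = l₁ ++ bs ++ r₁)
    (hds' : ds = (l₁ ++ l₂) ++ a :: (r₂ ++ r₁)) (hes : es = l₂ ++ as ++ r₂)
    (hfs : fs = l₁ ++ es ++ r₁) (hfs' : fs = (l₁ ++ l₂) ++ as ++ (r₂ ++ r₁))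
    (h : fold (unit x) cs ⟶ of c) (g : fold (unit y) bs ⟶ of b) (f : fold (unit z) as ⟶ of a) :
    sub l₁ r₁ e₄ hcs hfs h (sub l₂ r₂ e₃ hbs hes g f) =
      sub (l₁ ++ l₂) (r₂ ++ r₁) e₂ hds' hfs' (sub l₁ r₁ e₁ hcs hds h g) f := by
  refine hom_ext fun e he => ?_
  rw [ext_sub, ext_sub, subFamily, subFamily, ext_sub, ext_sub, subFamily, subFamily,
    foldMap_append r₂ r₁]
  have hk : Adm z (fold (fold e l₁) l₂) := by
    rw [← fold_append]; subst e₂; exact (adm_fold_of_comp he).2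
  rw [ext_congr f _ hk (fold_append e l₁ l₂)]
  simp

theorem sub_comm {x y z xy xz w : Tightness} {as bs cs ds es fs : List A.Obj} {a b c : A.Obj}
    (l m r : List A.Obj) (e₁ : xy = x.comp l y) (e₂ : w = xy.comp (l ++ as ++ m) z)
    (e₃ : xz = x.comp (l ++ a :: m) z) (e₄ : w = xz.comp l y)
    (hcs : cs = l ++ a :: (m ++ b :: r)) (hds : ds = l ++ as ++ (m ++ b :: r))
    (hds' : ds = (l ++ as ++ m) ++ b :: r) (hfs : fs = (l ++ as ++ m) ++ bs ++ r)
    (hcs' : cs = (l ++ a :: m) ++ b :: r) (hes : es = (l ++ a :: m) ++ bs ++ r)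
    (hes' : es = l ++ a :: (m ++ bs ++ r)) (hfs' : fs = l ++ as ++ (m ++ bs ++ r))
    (h : fold (unit x) cs ⟶ of c) (g : fold (unit y) as ⟶ of a) (f : fold (unit z) bs ⟶ of b) :
    sub (l ++ as ++ m) r e₂ hds' hfs (sub l (m ++ b :: r) e₁ hcs hds h g) f =
      sub l (m ++ bs ++ r) e₄ hes' hfs' (sub (l ++ a :: m) r e₃ hcs' hes h f) g := by
  refine hom_ext fun e he => ?_
  rw [ext_sub, ext_sub, subFamily, subFamily, ext_sub, ext_sub, subFamily, subFamily,
    foldMap_sub (as := bs) (l := m) (r := r) rfl, foldMap_cons (l := m) (r := r) rfl]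
  have k₁ : Adm z (fold (fold (fold e l) as) m) := by
    rw [← fold_sub rfl]; subst e₂; exact (adm_fold_of_comp he).2
  have k₂ : Adm z (fold (tensor (fold e l) (of a)) m) := by
    rw [fold_cons rfl]; subst e₄; subst e₃; exact (adm_fold_of_comp (adm_fold_of_comp he).1).2
  rw [ext_congr f _ k₁ (fold_sub rfl e), ext_congr f _ k₂ (fold_cons rfl e).symm]
  -- The two maps act at disjoint places, and the exchange is naturality of the family of `f` along
  -- the morphism induced by the component of `g` to its left.
  have e₅ := congrArg (foldMap r) (ext_natural f k₁ k₂ (foldMap m (ext g (fold e l) (by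
    subst e₄; exact (adm_fold_of_comp he).2))))
  rw [foldMap_comp, foldMap_comp] at e₅
  simp only [Category.assoc, eqToHom_trans_assoc, eqToHom_refl, Category.id_comp, foldMap_comp,
    foldMap_eqToHom]
  rw [reassoc_of% e₅]

end Unitization

/-- The skew multicategory of a skew monoidal category. -/
def SkewMonoidalCategory.toSkewMulticategory (A : SkewMonoidalCategory.{v, u}) :
    SkewMulticategory.{v, u} where
  Obj := A.Obj
  Hom x as b := Unitization.fold (Unitization.unit x) as ⟶ Unitization.of b
  -- A tight nullary map would be a morphism from `star` to an object of `A`, and there is none by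
  -- definition.
  isEmpty_tight_nil b := inferInstanceAs (IsEmpty PEmpty)
  id := Unitization.identity
  j := Unitization.comparison
  sub := Unitization.sub
  sub_lift := Unitization.sub_lift
  id_sub := Unitization.id_sub
  sub_id := Unitization.sub_id
  sub_assoc := Unitization.sub_assoc
  sub_comm := Unitization.sub_comm

/-! ### Left representability. -/

namespace Unitization

variable {A : SkewMonoidalCategory.{v, u}}

/-- With the strict unit in the middle, the right unit map and first associator cancel by
`unit_middle`, and what remains is the iterated `unit_left`. Using the axiom avoids a case
distinction on `unit x`. -/
theorem foldAssoc_star_leftUnit {x : Tightness} (b : A.Obj) (r : List A.Obj) :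
    foldMap (b :: r) (rightUnit .tight (unit x) trivial) ≫ foldAssoc (unit x) star (b :: r) ≫
      leftUnit x (fold (of b) r) (adm_fold r (adm_of x b)) =
        foldMap r (leftUnit x (of b) (adm_of x b)) := by
  have h := unit_middle (x := .tight) (e := (unit x : Unitization A)) (b := of b) trivial trivial
  have h' : tensorMap (rightUnit .tight (unit x) trivial) (𝟙 (of b)) ≫
      assoc (unit x) star (of b) = 𝟙 (tensor (unit x) (of b)) := by
    refine Eq.trans (congrArg (tensorMap (rightUnit .tight (unit x) trivial) (𝟙 (of b)) ≫ ·) ?_) h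
    exact (Category.comp_id _).symm.trans (congrArg (assoc (unit x) star (of b) ≫ ·)
      (tensorMap_id (unit x) (of b)).symm)
  refine (congrArg (foldMap r (tensorMap (rightUnit .tight (unit x) trivial) (𝟙 (of b))) ≫ ·)
    ((Category.assoc (foldMap r (assoc (unit x) star (of b))) _ _).trans
      (congrArg (foldMap r (assoc (unit x) star (of b)) ≫ ·)
        (foldAssoc_leftUnit x r (adm_of x b) _)))).trans ?_
  refine (Category.assoc _ _ _).symm.trans ((congrArg (· ≫ _)
    ((foldMap_comp r _ _).symm.trans ((congrArg (foldMap r) h').trans (foldMap_id r _)))).trans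
      (Category.id_comp _))

theorem ext_tight_leftUnit {x : Tightness} {b c : A.Obj} {r : List A.Obj}
    (g : fold (unit .tight) (b :: r) ⟶ of c) :
    ext g (unit x) trivial ≫ leftUnit x (of c) (adm_of x c) =
      foldMap r (leftUnit x (of b) (adm_of x b)) ≫ g := by
  have h := leftUnit_natural (e := fold (unit .tight) (b :: r)) (adm_fold r (adm_of x b))
    (adm_of x c) g
  refine (Category.assoc _ _ _).trans ?_
  refine (congrArg (foldMap (b :: r) (rightUnit .tight (unit x) trivial) ≫ ·)
    ((Category.assoc _ _ _).trans
      (congrArg (foldAssoc (unit x) star (b :: r) ≫ ·) h))).trans ?_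
  refine Eq.trans ?_ (congrArg (· ≫ g) (foldAssoc_star_leftUnit b r))
  exact (Category.assoc _ _ _).symm.trans
    ((Category.assoc (foldMap (b :: r) (rightUnit .tight (unit x) trivial) ≫
      foldAssoc (unit x) star (b :: r)) _ g).symm.trans
        (congrArg (· ≫ g) (Category.assoc _ _ _)))

/-- The unit maps and associators hidden in the components cancel, so substitution into the first
input of a tight map is plain composition with `foldMap r f`. Universality in the first position
then becomes a statement about composition. -/
theorem sub_first {y : Tightness} {as : List A.Obj} {b c : A.Obj} (r : List A.Obj)
    (g : fold (unit .tight) (b :: r) ⟶ of c) (f : fold (unit y) as ⟶ of b) :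
    sub (cs := as ++ r) [] r rfl rfl rfl g f =
      eqToHom (fold_append (unit y) as r) ≫ foldMap r f ≫ g := by
  refine (Category.assoc _ _ _).trans (congrArg (eqToHom _ ≫ ·) ?_)
  refine (Category.assoc _ _ _).trans ?_
  refine (congrArg (foldMap r (ext f (unit y) (adm_unit y)) ≫ ·)
    ((Category.assoc _ _ _).trans ((Category.id_comp _).trans (ext_tight_leftUnit g)))).trans ?_
  refine (Category.assoc _ _ _).symm.trans (congrArg (· ≫ g) ?_)
  exact (foldMap_comp r _ _).symm.trans
    (congrArg (foldMap r) (ext_leftUnit f (adm_unit y) (adm_of y b)))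

theorem exists_fold_of (a : A.Obj) (as : List A.Obj) : ∃ m, fold (of a) as = of m := by
  induction as generalizing a with
  | nil => exact ⟨a, rfl⟩
  | cons b as ih => exact ih _

end Unitization

namespace Unitization

variable (A : SkewMonoidalCategory.{v, u})

/-- By `sub_first`, substituting `eqToHom h` is precomposition with an isomorphism, hence bijective.
-/
theorem isLeftUniversal_eqToHom {x : Tightness} {as : List A.Obj} {m : A.Obj}
    (h : fold (unit x) as = of m) : A.toSkewMulticategory.IsLeftUniversal (eqToHom h) := by
  intro (r : List A.Obj) (b : A.Obj)
  have e : (fun g : fold (unit .tight) (m :: r) ⟶ of b =>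
      sub (A := A) (cs := as ++ r) [] r rfl rfl rfl g (eqToHom h)) =
      fun g => eqToHom ((fold_append (unit x) as r).trans
        (congrArg (fun e => fold e r) h)) ≫ g := by
    funext g
    rw [sub_first]
    refine (congrArg (fun k => eqToHom (fold_append (unit x) as r) ≫ k ≫ g)
      (foldMap_eqToHom r h)).trans ?_
    exact eqToHom_trans_assoc _ _ g
  refine (congrArg Function.Bijective e).mpr ?_
  exact ((eqToIso ((fold_append (unit x) as r).trans
        (congrArg (fun e => fold e r) h))).symm.homFromEquiv (Z := of b)).bijective

/-- The left-bracketed product of the list, begun with the unit of the given type, is the classifier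
as soon as it is not `star`. It is `star` only for the empty list and the tight type, the excluded
case. -/
theorem isLeftRepresentable_toSkewMulticategory : IsLeftRepresentable A.toSkewMulticategory := by
  intro x as h
  have : ∃ m, fold (unit x) as = of m := by
    cases x with
    | loose => exact exists_fold_of A.unit as
    | tight =>
      cases as with
      | nil => exact (h rfl rfl).elim
      | cons a as => exact exists_fold_of a as
  obtain ⟨m, hm⟩ := this
  exact ⟨m, eqToHom hm, isLeftUniversal_eqToHom A hm⟩

/-- The canonical classifiers. -/
def classifiers : A.toSkewMulticategory.Classifiers where
  i := A.unit
  u := 𝟙 (of A.unit)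
  u_univ := isLeftUniversal_eqToHom A (x := .loose) (as := []) rfl
  m := A.tensorObj
  θ a b := 𝟙 (of (A.tensorObj a b))
  θ_univ a b := isLeftUniversal_eqToHom A (x := .tight) (as := [a, b]) rfl

end Unitization

/-! ### Recovering the skew monoidal category from its skew multicategory. -/

namespace Unitization

section

variable {A : SkewMonoidalCategory.{v, u}}

/-- The component of the tight map `g` at `star` is `g` itself, because the tight left unit map is
an identity; only the component of `f` at `a` contributes. -/
theorem sub_second {y : Tightness} {as bs cs : List A.Obj} {a b c : A.Obj}
    (hb : bs = [a] ++ b :: []) (hc : cs = [a] ++ as ++ []) (g : fold (unit .tight) bs ⟶ of c)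
    (f : fold (unit y) as ⟶ of b) :
    sub [a] [] rfl hb hc g f =
      eqToHom (fold_sub hc star) ≫ ext f (of a) (adm_of y a) ≫ eqToHom (fold_cons hb star) ≫ g := by
  refine (Category.assoc _ _ _).trans (congrArg (eqToHom (fold_sub hc star) ≫ ·) ?_)
  refine (Category.assoc _ _ _).trans (congrArg (ext f (of a) (adm_of y a) ≫ ·) ?_)
  exact (Category.assoc _ _ _).trans (congrArg (eqToHom (fold_cons hb star) ≫ ·)
    (ext_leftUnit g trivial trivial))

theorem sub_second_of {y : Tightness} {as : List A.Obj} {a b c : A.Obj}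
    (hc : a :: as = [a] ++ as ++ []) (g : of (A.tensorObj a b) ⟶ of c)
    (f : fold (unit y) as ⟶ of b) (h : fold (of a) as ⟶ of (A.tensorObj a b))
    (hf : ext f (of a) (adm_of y a) = h) :
    sub (x := .tight) (bs := [a, b]) [a] [] rfl rfl hc g f = (h ≫ g : fold (of a) as ⟶ of c) := by
  refine (sub_second rfl hc g f).trans ?_
  refine (Category.id_comp _).trans ?_
  exact (congrArg (ext f (of a) (adm_of y a) ≫ ·) (Category.id_comp g)).trans
    (congrArg (· ≫ g) hf)

/-- Together with the next three lemmas this exhibits the structure of `A` inside the families: at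
`a`, a tight unary map gives its tensor with `a`, the binary classifier the associator and the
nullary classifier the right unit, while `comparison` of an identity gives the left unit. -/
theorem ext_unary {a b c : A.Obj} (f : b ⟶ c) :
    ext (x := .tight) (as := [b]) (b := c) f (of a) trivial = A.tensorHom (𝟙 a) f := by
  refine (congrArg (· ≫ _) (A.tensorHom_id a b)).trans ?_
  refine (Category.id_comp _).trans ?_
  exact (congrArg (· ≫ _) (Category.id_comp _)).trans (Category.id_comp _)

theorem ext_binary (a b c : A.Obj) :
    ext (x := .tight) (as := [b, c]) (𝟙 (of (A.tensorObj b c))) (of a) trivial =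
      A.assoc a b c := by
  have h₁ : foldMap [b, c] (𝟙 (of a)) = 𝟙 (fold (of a) [b, c]) := foldMap_id [b, c] (of a)
  refine (congrArg (· ≫ _) h₁).trans ((Category.id_comp _).trans ?_)
  refine (congrArg (_ ≫ ·) (A.tensorHom_id a (A.tensorObj b c))).trans
    ((Category.comp_id _).trans ?_)
  refine (congrArg (· ≫ _) (foldMap_id [c] (of (A.tensorObj a b)))).trans
    ((Category.id_comp _).trans ?_)
  exact Category.comp_id _

theorem ext_nullary (a : A.Obj) :
    ext (x := .loose) (as := []) (𝟙 (of A.unit)) (of a) trivial = A.rightUnit a :=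
  (congrArg (_ ≫ ·) ((Category.id_comp _).trans (A.tensorHom_id a A.unit))).trans
    (Category.comp_id _)

theorem comparison_id (a : A.Obj) :
    comparison (as := [a]) (𝟙 (of a)) = A.leftUnit a :=
  (congrArg (· ≫ leftUnit .loose (of a) trivial) (ext_id a (of A.unit) trivial)).trans
    (Category.id_comp _)

theorem sub_first_of {y : Tightness} {as : List A.Obj} {b c d : A.Obj}
    (g : of (A.tensorObj b d) ⟶ of c) (f : fold (unit y) as ⟶ of b)
    (h : fold (unit y) (as ++ [d]) = tensor (fold (unit y) as) (of d)) :
    sub (x := .tight) (bs := [b, d]) (cs := as ++ [d]) [] [d] rfl rfl rfl g f =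
      eqToHom h ≫ tensorMap f (𝟙 (of d)) ≫ g :=
  sub_first [d] g f

theorem sub_first_id {y : Tightness} {as : List A.Obj} {b c d : A.Obj}
    (g : of (A.tensorObj b d) ⟶ of c) (e : fold (unit y) as = of b)
    (h : fold (unit y) (as ++ [d]) = of (A.tensorObj b d)) :
    sub (x := .tight) (bs := [b, d]) (cs := as ++ [d]) [] [d] rfl rfl rfl g (eqToHom e) =
      eqToHom h ≫ g := by
  refine (sub_first [d] g (eqToHom e)).trans ?_
  refine (congrArg (fun k => eqToHom (fold_append (unit y) as [d]) ≫ k ≫ g)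
    (foldMap_eqToHom [d] e)).trans ?_
  exact eqToHom_trans_assoc _ _ g

end

variable (A : SkewMonoidalCategory.{v, u})

/-- Composition in the underlying category is defined by substitution, so it agrees with that of `A`
only after this computation. -/
theorem comp_eq {a b c : A.Obj} (f : a ⟶ b) (g : b ⟶ c) :
    (CategoryStruct.comp (obj := A.toSkewMulticategory.Obj) (X := a) (Y := b) (Z := c) f g) =
      f ≫ g :=
  (sub_first (y := .tight) (as := [a]) [] g f).trans (Category.id_comp _)

/-- The canonical classifiers of the underlying short skew multicategory. -/
abbrev rep : LeftRepresentation A.toSkewMulticategory.toShort :=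
  (classifiers A).toLeftRepresentation

/-- As the classifier is an identity, a map out of a tensor product and the binary map it classifies
are the same morphism of `A`. -/
theorem post_θ {a b d : A.Obj} (h : A.tensorObj a b ⟶ d) :
    (A.toSkewMulticategory.multiHom₂ .tight).act (a₁ := a) (a₂ := b) (b := A.tensorObj a b) (𝟙 _) (𝟙 _) h
      (𝟙 (of (A.tensorObj a b))) = h :=
  (A.toSkewMulticategory.multiHom₂_post h _).trans
    ((sub_first (y := .tight) (as := [a, b]) [] h (𝟙 (of (A.tensorObj a b)))).trans
      ((Category.id_comp _).trans (Category.id_comp _)))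

/-- Substituting `f` in the first input of the classifier gives `f` tensored with an identity, and
`g` in the second an identity tensored with `g`; functoriality of the tensor product combines them.
-/
theorem tensorHom_eq {a b c d : A.Obj} (f : a ⟶ b) (g : c ⟶ d) :
    (rep A).tensorHom (a := a) (b := b) (c := c) (d := d) f g = A.tensorHom f g := by
  refine (rep A).hom_ext (((rep A).tensorHom_spec f g).trans ?_)
  refine Eq.trans ?_ (post_θ A (A.tensorHom f g)).symm
  refine (A.toSkewMulticategory.post_id _).trans ?_
  have h₁ := (sub_first_of (y := .tight) (as := [a]) (b := b) (d := d)
    (𝟙 (of (A.tensorObj b d))) f rfl).trans ((Category.id_comp _).trans (Category.comp_id _))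
  refine (congrArg (A.toSkewMulticategory.pre [a] [] rfl rfl g) h₁).trans ?_
  refine (sub_second_of (y := .tight) (as := [c]) rfl (A.tensorHom f (𝟙 d)) g _
    (ext_unary g)).trans ?_
  refine (A.tensorHom_comp _ _ _ _).symm.trans ?_
  rw [Category.id_comp, Category.comp_id]

/-- Both sides of the equation defining the associator, computed in `A`, are `A.assoc a b c`. The
unit maps are compared likewise. -/
theorem assoc_eq (a b c : A.Obj) : (rep A).assoc a b c = A.assoc a b c := by
  refine (rep A).hom_ext_assoc (((rep A).assoc_spec a b c).trans ?_)
  have h₁ := (sub_first_id (y := .tight) (as := [a, b]) (b := A.tensorObj a b) (d := c)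
    (A.assoc a b c) rfl rfl).trans (Category.id_comp _)
  refine Eq.trans ?_ (h₁.symm.trans (congrArg (fun k =>
    A.toSkewMulticategory.toShort.sub22₁ k ((rep A).θ a b)) (post_θ A (A.assoc a b c)).symm))
  exact (sub_second_of rfl (𝟙 (of (A.tensorObj a (A.tensorObj b c)))) _ _ (ext_binary a b c)).trans
    (Category.comp_id _)

theorem leftUnit_eq (a : A.Obj) : (rep A).leftUnit a = A.leftUnit a := by
  refine (rep A).hom_ext ((rep A).hom_ext₁ (((rep A).leftUnit_spec a).trans ?_))
  have h₁ := (sub_first_id (y := .loose) (as := []) (b := A.unit) (d := a)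
    (A.leftUnit a) rfl rfl).trans (Category.id_comp _)
  refine Eq.trans ?_ (h₁.symm.trans (congrArg (fun k =>
    A.toSkewMulticategory.toShort.sub20₁ k (rep A).w) (post_θ A (A.leftUnit a)).symm))
  exact comparison_id a

theorem rightUnit_eq (a : A.Obj) : (rep A).rightUnit a = A.rightUnit a :=
  (sub_second_of rfl (𝟙 (of (A.tensorObj a A.unit))) _ _ (ext_nullary a)).trans
    (Category.comp_id _)

/-- The comparison functor, which is the identity on objects and morphisms. -/
def toRep : A.Obj ⥤ (rep A).toSkewMonoidal.Obj where
  obj a := a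
  map f := f
  map_id _ := rfl
  map_comp f g := (comp_eq A f g).symm

/-- The inverse of `toRep`. -/
def ofRep : (rep A).toSkewMonoidal.Obj ⥤ A.Obj where
  obj a := a
  map f := f
  map_id _ := rfl
  map_comp f g := comp_eq A f g

end Unitization

namespace SkewMonoidalCategory

variable (B : SkewMonoidalCategory.{v, u})

/-- Used to check the lax axioms when `f₀` and `f₂` are identities. Each is stated in a single `B`,
so that the two compositions carried by the same sets of morphisms are never mixed. -/
theorem tensorHom_id_comp {a b d : B.Obj} (h k : B.tensorObj a b ⟶ d) (e : h = k) :
    B.tensorHom (𝟙 a) (𝟙 b) ≫ 𝟙 _ ≫ h = k := by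
  simp [B.tensorHom_id, e]

theorem comp_tensorHom_id {a b d : B.Obj} (h k : d ⟶ B.tensorObj a b) (e : h = k) :
    h ≫ B.tensorHom (𝟙 a) (𝟙 b) ≫ 𝟙 _ = k := by
  simp [B.tensorHom_id, e]

theorem comp_id_eq_id_comp {a b : B.Obj} {h k : a ⟶ b} (e : h = k) : h ≫ 𝟙 _ = 𝟙 _ ≫ k := by
  simp [e]

end SkewMonoidalCategory

namespace Unitization

variable (A : SkewMonoidalCategory.{v, u})

/-- The comparison lax monoidal functor. -/
def laxToRep : LaxMonoidalFunctor A (rep A).toSkewMonoidal where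
  F := toRep A
  f₀ := 𝟙 ((rep A).toSkewMonoidal.unit)
  f₂ a b := 𝟙 ((rep A).toSkewMonoidal.tensorObj a b)
  f₂_natural p q := (rep A).toSkewMonoidal.comp_id_eq_id_comp (tensorHom_eq A p q)
  map_assoc a b c := ((rep A).toSkewMonoidal.tensorHom_id_comp _ _ rfl).trans
    ((rep A).toSkewMonoidal.comp_tensorHom_id _ _ (assoc_eq A a b c)).symm
  map_leftUnit a := (rep A).toSkewMonoidal.tensorHom_id_comp _ _ (leftUnit_eq A a).symm
  map_rightUnit a := (rep A).toSkewMonoidal.comp_tensorHom_id _ _ (rightUnit_eq A a)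

/-- The inverse of the comparison lax monoidal functor. -/
def laxOfRep : LaxMonoidalFunctor (rep A).toSkewMonoidal A where
  F := ofRep A
  f₀ := 𝟙 A.unit
  f₂ a b := 𝟙 (A.tensorObj a b)
  f₂_natural p q := A.comp_id_eq_id_comp (tensorHom_eq A p q).symm
  map_assoc a b c := (A.tensorHom_id_comp _ _ rfl).trans
    (A.comp_tensorHom_id _ _ (assoc_eq A a b c).symm).symm
  map_leftUnit a := A.tensorHom_id_comp _ _ (leftUnit_eq A a)
  map_rightUnit a := A.comp_tensorHom_id _ _ (rightUnit_eq A a).symm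

/-- A skew monoidal category is isomorphic to the one obtained from its skew multicategory. -/
def isoRep : A ≅ (rep A).toSkewMonoidal where
  hom := laxToRep A
  inv := laxOfRep A
  hom_inv_id := LaxMonoidalFunctor.ext rfl
    (heq_of_eq (Category.comp_id _)) (heq_of_eq (funext fun a => funext fun b => Category.comp_id _))
  inv_hom_id := LaxMonoidalFunctor.ext rfl (heq_of_eq (Category.comp_id (obj := (rep A).toSkewMonoidal.Obj) _))
    (heq_of_eq (funext fun a => funext fun b => Category.comp_id (obj := (rep A).toSkewMonoidal.Obj) _))

end Unitization

/-! ### Essential surjectivity and the equivalences. -/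

/-- Different choices of classifiers give isomorphic skew monoidal categories. -/
def LeftRepresentation.isoOfRepresentations {M : ShortSkewMulticategory.{v, u}}
    (R S : LeftRepresentation M) : R.toSkewMonoidal ≅ S.toSkewMonoidal where
  hom := R.toLaxMonoidalFunctor S (ShortSkewMultifunctor.id M)
  inv := S.toLaxMonoidalFunctor R (ShortSkewMultifunctor.id M)
  hom_inv_id := LaxMonoidalFunctor.ext rfl
    (heq_of_eq ((R.map₀_comp S _ R _).symm.trans R.map₀_id))
    (heq_of_eq (funext fun a => funext fun b => (R.map₂_comp S _ R _ a b).symm.trans (R.map₂_id a b)))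
  inv_hom_id := LaxMonoidalFunctor.ext rfl
    (heq_of_eq ((S.map₀_comp R _ S _).symm.trans S.map₀_id))
    (heq_of_eq (funext fun a => funext fun b => (S.map₂_comp R _ S _ a b).symm.trans (S.map₂_id a b)))

/-- The classifiers chosen in the definition of K^s need not be the canonical ones; passing to the
canonical ones is an isomorphism, after which `isoRep` identifies the result with `A`. -/
instance essSurj_forget_comp_toSkewMonoidalFunctor :
    (forgetToShortLeftRepresentable.{v, u} ⋙ toSkewMonoidalFunctor.{v, u}).EssSurj where
  mem_essImage A :=
    ⟨⟨A.toSkewMulticategory, Unitization.isLeftRepresentable_toSkewMulticategory A⟩,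
      ⟨(LeftRepresentation.isoOfRepresentations _ _).trans (Unitization.isoRep A).symm⟩⟩

/-- A preimage under the composite K^s U^s gives one under K^s by applying U^s to it. -/
instance : toSkewMonoidalFunctor.{v, u}.EssSurj where
  mem_essImage A :=
    ⟨forgetToShortLeftRepresentable.obj
      ((forgetToShortLeftRepresentable ⋙ toSkewMonoidalFunctor).objPreimage A),
      ⟨(forgetToShortLeftRepresentable ⋙ toSkewMonoidalFunctor).objObjPreimageIso A⟩⟩

end

end SkewMulti

theorem mainTheorem5 :
    SkewMulti.toSkewMonoidalFunctor.{v, u}.IsEquivalence ∧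
      SkewMulti.forgetToShortLeftRepresentable.{v, u}.IsEquivalence := by
  have h₁ : SkewMulti.toSkewMonoidalFunctor.{v, u}.IsEquivalence := {}
  have h₂ : (SkewMulti.forgetToShortLeftRepresentable.{v, u} ⋙
    SkewMulti.toSkewMonoidalFunctor.{v, u}).IsEquivalence := {}
  -- Since K^s and K^s U^s are equivalences, so is U^s.
  exact ⟨h₁, Functor.isEquivalence_of_comp_right _ SkewMulti.toSkewMonoidalFunctor.{v, u}⟩
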